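/- Throughout, $\log$ is the natural logarithm. For $3\le r\le n-3$ and $\boldsymbol d=(d_1,\dots,d_n)\in\mathbb N^n$, let $H_r(\boldsymbol d)$ be the number of simple $r$-uniform hypergraphs on the vertex set $[n]=\{1,\dots,n\}$ in which, for each $j$, exactly $d_j$ edges contain $j$. Let the density $\lambda$ be defined by $\frac1n\sum_{j}d_j=\lambda\binom{n-1}{r-1}$. In what follows $W$ ranges over the $r$-element subsets of $[n]$. For $\boldsymbol\beta\in\mathbb R^n$ put $$\lambda_W(\boldsymbol\beta)=\frac{e^{\sum_{j\in W}\beta_j}}{1+e^{\sum_{j\in W}\beta_j}},$$ and let $A(\boldsymbol\beta)=(a_{jk})$ be the symmetric $n\times n$ matrix with $$a_{jj}=\tfrac12\sum_{W\ni j}\lambda_W(\boldsymbol\beta)(1-\lambda_W(\boldsymbol\beta)),\qquad a_{jk}=\tfrac12\sum_{W\supset\{j,k\}}\lambda_W(\boldsymbol\beta)(1-\lambda_W(\boldsymbol\beta))\quad(j\ne k).$$ **Theorem 1.1.** For every real $C$ there are real constants $K$ and $c>0$, depending only on $C$, such that the following holds. Let $n$ tend to infinity along a set $S$ of natural numbers,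 and for each $n\in S$ let $r=r(n)$, $\boldsymbol d=\boldsymbol d(n)\in\mathbb N^n$ and $\boldsymbol\beta^\ast=\boldsymbol\beta^\ast(n)\in\mathbb R^n$ be such that * $3\le r\le n-3$, and $r$ divides $\sum_{j}d_j$; * $\sum_{W\ni j}\lambda_W(\boldsymbol\beta^\ast)=d_j$ for all $j\in[n]$; * $\max_{j,k\in[n]}|\beta^\ast_j-\beta^\ast_k|\le C\,\dfrac{n}{r(n-r)}$; and suppose that $r^3(n-r)^3\log n=o\bigl(\lambda(1-\lambda)\,n\binom nr\bigr)$ as $n\to\infty$ in $S$. Write $\lambda_W=\lambda_W(\boldsymbol\beta^\ast)$, $A=A(\boldsymbol\beta^\ast)$, let $|A|$ be the determinant of $A$, and put $$\varepsilon=\frac{r(n-r)n}{\lambda(1-\lambda)\binom nr}+\frac{\log^9 n}{n^2}\left(\frac{r^3(n-r)^3}{\lambda(1-\lambda)\binom nr}\right)^{3/2}+n^{-c\log n}.$$ Then for all sufficiently large $n\in S$ there is a real $\delta$ with $|\delta|\le K\varepsilon$ and $$H_r(\boldsymbol d)=\frac{r\,(1+\delta)}{2^n\,\pi^{n/2}\,|A|^{1/2}}\prod_{W}\lambda_W^{-\lambda_W}(1-\lambda_W)^{-(1-\lambda_W)},$$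 and moreover $\varepsilon=o(1/\log n)$ as $n\to\infty$ in $S$. -/

import Mathlib

open Filter Asymptotics

noncomputable section

namespace HypergraphEnum

/-- The simple `r`-uniform hypergraphs with vertex set `{1, …, n}` (modelled by `Fin n`) in which
each vertex `j` has degree `d j`, the degree of a vertex being the number of edges containing it. -/
def hypergraphsWithDegrees {n : ℕ} (r : ℕ) (d : Fin n → ℕ) : Set (Hypergraph (Fin n)) :=
  {H | H.vertexSet = Set.univ ∧ (∀ e ∈ H.edgeSet, e.ncard = r) ∧
    ∀ j, {e ∈ H.edgeSet | j ∈ e}.ncard = d j}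

theorem finite_hypergraphsWithDegrees {n : ℕ} (r : ℕ) (d : Fin n → ℕ) :
    (hypergraphsWithDegrees r d).Finite := by
  have hinj : Function.Injective
      (fun H : Hypergraph (Fin n) => (H.vertexSet, H.edgeSet)) := by
    intro H₁ H₂ h
    exact Hypergraph.ext (congrArg Prod.fst h) (congrArg Prod.snd h)
  have : Finite (Hypergraph (Fin n)) := Finite.of_injective _ hinj
  exact Set.toFinite _

/-- `H_r(d)`, the number of such hypergraphs. -/
def numHypergraphs {n : ℕ} (r : ℕ) (d : Fin n → ℕ) : ℕ :=
  (hypergraphsWithDegrees r d).ncard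

/-- The `r`-element subsets of the vertex set. -/
def rSets (n r : ℕ) : Finset (Finset (Fin n)) :=
  Finset.powersetCard r Finset.univ

/-- The density `λ`, defined by `d̄ = λ * (n - 1).choose (r - 1)`, where `d̄` is the average degree. -/
def density {n : ℕ} (r : ℕ) (d : Fin n → ℕ) : ℝ :=
  ((∑ j, (d j : ℝ)) / n) / ((n - 1).choose (r - 1) : ℝ)

/-- `λ_W(β)`, the probability of the edge `W` in the `β`-model. -/
def edgeProb {n : ℕ} (β : Fin n → ℝ) (W : Finset (Fin n)) : ℝ :=
  Real.exp (∑ j ∈ W, β j) / (1 + Real.exp (∑ j ∈ W, β j))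

/-- `β` solves the system `∑_{W ∋ j} λ_W(β) = d_j` for all vertices `j`, the sums being over the
`r`-sets `W` containing `j`. -/
def IsBetaSolution {n : ℕ} (r : ℕ) (d : Fin n → ℕ) (β : Fin n → ℝ) : Prop :=
  ∀ j, ∑ W ∈ rSets n r with j ∈ W, edgeProb β W = (d j : ℝ)

/-- The matrix `A(β)`: its entry at `(j, k)` is half the sum of `λ_W(β) (1 - λ_W(β))` over the
`r`-sets `W` containing `j` and `k` (for `j = k`: over those containing `j`). -/
def matrixA {n : ℕ} (r : ℕ) (β : Fin n → ℝ) : Matrix (Fin n) (Fin n) ℝ :=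
  Matrix.of fun j k =>
    (1 / 2) * ∑ W ∈ rSets n r with j ∈ W ∧ k ∈ W, edgeProb β W * (1 - edgeProb β W)

/-- The error term `ε` for given `n`, `r` and density `lam`; the real `c` is the constant implicit
in the exponent of the term `n ^ (-Ω(log n))`. -/
def errorTerm (c : ℝ) (n r : ℕ) (lam : ℝ) : ℝ :=
  (r : ℝ) * ((n : ℝ) - r) * n / (lam * (1 - lam) * (n.choose r : ℝ))
    + Real.log n ^ 9 / (n : ℝ) ^ 2 *
      ((r : ℝ) ^ 3 * ((n : ℝ) - r) ^ 3 / (lam * (1 - lam) * (n.choose r : ℝ))) ^ (3 / 2 : ℝ)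
    + (n : ℝ) ^ (-(c * Real.log n))

end HypergraphEnum

end

/-!
Let `ξ_W` be independent Bernoulli variables with means `λ_W`, indexed by the `r`-sets `W`. In this
`β`-model all hypergraphs with degrees `d` have the same probability
`∏ λ_W ^ λ_W * (1 - λ_W) ^ (1 - λ_W)`, since the probability of a hypergraph depends only on its
degrees (`prob_family_eq`). Hence `H_r(d)` is the probability that the random degrees equal `d`,
which is their mean, divided by this product. Fourier inversion expresses that probability as the
integral over a torus of the characteristic function `∏_W (1 - λ_W + λ_W e^{i x_W}) e^{-i λ_W x_W}`,
`x_W = ∑_{j ∈ W} θ_j` (`integral_torusCube_bernoulliProd`). In the coordinates `θ_j` it has `r`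
equal peaks, because the degrees always sum to a multiple of `r`. In the coordinates
`y_j = θ_j - θ_{n₀}`, `y_{n₀} = ∑_{j ∈ W₀} θ_j` all `x_W` are integral linear forms (`edgeForm`),
and the origin is the only peak; the change of coordinates has determinant `r`, which accounts for
the factor `r` in the formula.

Write `M = λ (1 - λ) n.choose r`. The bound on the spread of `β` makes all `λ_W (1 - λ_W)`
comparable with `λ (1 - λ)` (`exists_bound_density`). The integral is compared with that of the
Gaussian weight `e^{-Q}`, `Q = ∑_W λ_W (1 - λ_W) x_W² / 2`, whose value is the main term
(`gaussMass_edgePrecision`). The key estimate is that under the Gaussian measure every `x_W` has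
variance at most `v = O(n / M)` (`edgeForm_sq_le`), while the weighted variances sum to `n`.

* Where all `|x_W| ≤ η` with `η²` of order `1 / n`, the third order cumulant expansion applies. The
  cubic term is odd and drops out; Wick's formula bounds its mean square, and the mean of the
  quartic term, by `O(n v) = O(n² / M)` (`norm_integral_slab_sub_le`).
* In the dyadic shells `η ≤ max |x_W| ≤ 2 η ≤ 1` the Gaussian tail `e^{-η² / (4 v)}` beats the
  number of edges (`integral_slab_sub_slab_le`).
* Elsewhere on the torus, either two edges exchanging one vertex have forms differing by a
  non-negligible `y_j`, or all `x_W` stay away from `2πℤ`. In both cases the characteristic function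
  is at most `e^{-c M / (n q²)}` with `q = min r (n - r)` (`norm_bernoulliProd_le_of_notMem_slab`),
  which is negligible even against a crude lower bound for the Gaussian mass (`le_gaussMass`).

The growth hypothesis gives `M ≥ Ω q² n² log n` for every constant `Ω`, for large `n`. The total
relative error is `O(n² / M)`, hence bounded by the first term of `ε` alone.
-/

noncomputable section

namespace HypergraphEnum

/-! ### Gaussian measures on `ℝⁿ` -/

section

open MeasureTheory ProbabilityTheory Matrix
open scoped NNReal ENNReal

variable {κ : Type*} [Fintype κ] [DecidableEq κ]

/-- The total mass `∫ exp (-(y ⬝ᵥ H y) / 2) dy` of the Gaussian weight with precision matrix `H`. -/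
def gaussMass (H : Matrix κ κ ℝ) : ℝ :=
  √((2 * Real.pi) ^ Fintype.card κ / H.det)

/-- The centred Gaussian probability measure with precision matrix `H`. -/
def gaussMeasure (H : Matrix κ κ ℝ) : Measure (κ → ℝ) :=
  ENNReal.ofReal (gaussMass H)⁻¹ •
    volume.withDensity (fun y => ENNReal.ofReal (Real.exp (-(y ⬝ᵥ H *ᵥ y) / 2)))

lemma exists_transpose_mul_self_eq {H : Matrix κ κ ℝ} (hH : H.PosDef) :
    ∃ B : Matrix κ κ ℝ, B.det ≠ 0 ∧ Bᵀ * B = H := by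
  open scoped MatrixOrder in
  obtain ⟨B, hB⟩ := CStarAlgebra.nonneg_iff_eq_star_mul_self.mp hH.posSemidef.nonneg
  have hB' : Bᵀ * B = H := by
    rw [hB, star_eq_conjTranspose, conjTranspose_eq_transpose_of_trivial]
  refine ⟨B, fun h0 => ?_, hB'⟩
  have := hH.det_pos
  rw [← hB', det_mul, det_transpose, h0] at this
  simp at this

lemma gaussMass_pos {H : Matrix κ κ ℝ} (hH : H.PosDef) : 0 < gaussMass H :=
  Real.sqrt_pos.2 (div_pos (by positivity) hH.det_pos)

lemma integral_comp_mulVec {E : Type*} [NormedAddCommGroup E] [NormedSpace ℝ E]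
    {B : Matrix κ κ ℝ} (hB : B.det ≠ 0) (f : (κ → ℝ) → E) (hf : Continuous f) :
    ∫ y, f (B *ᵥ y) = |B.det|⁻¹ • ∫ z, f z := by
  have h := Real.map_matrix_volume_pi_eq_smul_volume_pi hB
  have hc : Continuous (fun y : κ → ℝ => toLin' B y) := LinearMap.continuous_of_finiteDimensional _
  have h2 : ∫ z, f z ∂(Measure.map (toLin' B) volume) = ∫ y, f (toLin' B y) :=
    integral_map hc.aemeasurable hf.aestronglyMeasurable
  rw [h, integral_smul_measure, ENNReal.toReal_ofReal (abs_nonneg _), abs_inv] at h2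
  simpa using h2.symm

lemma integrable_comp_mulVec {E : Type*} [NormedAddCommGroup E]
    {B : Matrix κ κ ℝ} (hB : B.det ≠ 0) {f : (κ → ℝ) → E} (hf : Integrable f) :
    Integrable (fun y => f (B *ᵥ y)) := by
  have h := Real.map_matrix_volume_pi_eq_smul_volume_pi hB
  have hc : Continuous (fun y : κ → ℝ => toLin' B y) := LinearMap.continuous_of_finiteDimensional _
  have h2 : Integrable f (Measure.map (toLin' B) volume) := by
    rw [h]; exact hf.smul_measure ENNReal.ofReal_ne_top
  simpa [Function.comp_def] using h2.comp_measurable hc.measurable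

omit [DecidableEq κ] in
lemma dotProduct_factor {B H : Matrix κ κ ℝ} (h : Bᵀ * B = H) (y : κ → ℝ) :
    y ⬝ᵥ H *ᵥ y = ∑ i, (B *ᵥ y) i ^ 2 := by
  rw [← h, ← mulVec_mulVec, dotProduct_mulVec, vecMul_transpose]
  simp [dotProduct, sq]

lemma integrable_exp_neg_quadForm {H : Matrix κ κ ℝ} (hH : H.PosDef) :
    Integrable (fun y : κ → ℝ => Real.exp (-(y ⬝ᵥ H *ᵥ y) / 2)) := by
  obtain ⟨B, hB, h⟩ := exists_transpose_mul_self_eq hH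
  have h1 : Integrable (fun z : κ → ℝ => ∏ i, Real.exp (-(1 / 2) * (z i) ^ 2)) :=
    Integrable.fintype_prod (f := fun _ (x : ℝ) => Real.exp (-(1 / 2) * x ^ 2))
      (fun _ => integrable_exp_neg_mul_sq (by norm_num))
  refine (integrable_comp_mulVec hB h1).congr (ae_of_all _ fun y => ?_)
  simp only [dotProduct_factor h, ← Real.exp_sum]
  congr 1
  rw [← Finset.mul_sum]; ring

/-- The Fourier transform of the Gaussian weight, by the substitution `z = B y` with `Bᵀ B = H`. -/
lemma integral_cexp_quadForm {H : Matrix κ κ ℝ} (hH : H.PosDef) (a : κ → ℝ) (t : ℝ) :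
    ∫ y : κ → ℝ, Complex.exp (-((y ⬝ᵥ H *ᵥ y / 2 : ℝ) : ℂ) + t * Complex.I * ((a ⬝ᵥ y : ℝ) : ℂ))
      = (gaussMass H : ℂ) * Complex.exp (-((a ⬝ᵥ H⁻¹ *ᵥ a) * t ^ 2 / 2 : ℝ)) := by
  obtain ⟨B, hB, h⟩ := exists_transpose_mul_self_eq hH
  have hBu : IsUnit B.det := isUnit_iff_ne_zero.2 hB
  set b : κ → ℝ := a ᵥ* B⁻¹ with hb
  have hab : ∀ y : κ → ℝ, a ⬝ᵥ y = b ⬝ᵥ (B *ᵥ y) := by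
    intro y
    rw [hb, dotProduct_mulVec, vecMul_vecMul, nonsing_inv_mul _ hBu, vecMul_one]
  have hbb : a ⬝ᵥ H⁻¹ *ᵥ a = ∑ i, b i ^ 2 := by
    rw [← h, Matrix.mul_inv_rev, ← mulVec_mulVec, dotProduct_mulVec, ← hb, ← transpose_nonsing_inv,
      mulVec_transpose, ← hb]
    simp [dotProduct, sq]
  have hint := GaussianFourier.integral_cexp_neg_mul_sum_add (ι := κ) (b := (1 / 2 : ℂ))
    (by norm_num) (fun i => (t * Complex.I) * (b i : ℂ))
  have key := integral_comp_mulVec hB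
    (fun z : κ → ℝ => Complex.exp (-(1 / 2 : ℂ) * ∑ i, (z i : ℂ) ^ 2
      + ∑ i, t * Complex.I * (b i : ℂ) * (z i : ℂ))) (by fun_prop)
  rw [hint] at key
  have e1 : ∀ y : κ → ℝ, Complex.exp (-((y ⬝ᵥ H *ᵥ y / 2 : ℝ) : ℂ)
      + t * Complex.I * ((a ⬝ᵥ y : ℝ) : ℂ)) =
      Complex.exp (-(1 / 2 : ℂ) * ∑ i, ((B *ᵥ y) i : ℂ) ^ 2
      + ∑ i, t * Complex.I * (b i : ℂ) * ((B *ᵥ y) i : ℂ)) := by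
    intro y
    rw [dotProduct_factor h, hab]
    congr 1
    simp only [dotProduct, Complex.ofReal_sum, Complex.ofReal_div, Complex.ofReal_pow,
      Complex.ofReal_mul, Finset.mul_sum, mul_assoc]
    congr 1
    · rw [Finset.sum_div, ← Finset.sum_neg_distrib]
      refine Finset.sum_congr rfl fun i _ => ?_
      push_cast; ring
  simp_rw [e1]
  rw [key]
  have hG : (gaussMass H : ℂ) =
      (|B.det|⁻¹ : ℝ) * ((Real.pi : ℂ) / (1 / 2 : ℂ)) ^ (Fintype.card κ / 2 : ℂ) := by
    have e2 : ((Real.pi : ℂ) / (1 / 2 : ℂ)) ^ (Fintype.card κ / 2 : ℂ)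
        = (((2 * Real.pi) ^ (Fintype.card κ / 2 : ℝ) : ℝ) : ℂ) := by
      rw [Complex.ofReal_cpow (by positivity)]
      congr 1 <;> push_cast <;> ring
    rw [e2, ← Complex.ofReal_mul]
    congr 1
    have hd : H.det = |B.det| ^ 2 := by
      rw [← h, det_mul, det_transpose, sq_abs, sq]
    rw [gaussMass, hd, Real.sqrt_div' _ (by positivity), Real.sqrt_sq (abs_nonneg _),
      Real.sqrt_eq_rpow, ← Real.rpow_natCast, ← Real.rpow_mul (by positivity)]
    rw [div_eq_inv_mul]; congr 2; ring
  rw [hG, Complex.real_smul, mul_assoc]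
  congr 3
  rw [hbb]
  simp only [mul_pow, Complex.I_sq, Complex.ofReal_div, Complex.ofReal_mul,
    Complex.ofReal_sum, Complex.ofReal_pow, ← Finset.mul_sum]
  push_cast
  ring

lemma integral_exp_neg_quadForm {H : Matrix κ κ ℝ} (hH : H.PosDef) :
    ∫ y : κ → ℝ, Real.exp (-(y ⬝ᵥ H *ᵥ y) / 2) = gaussMass H := by
  have h := integral_cexp_quadForm hH 0 0
  simp only [Complex.ofReal_zero, zero_mul, add_zero, zero_dotProduct] at h
  have e : ∀ y : κ → ℝ, Complex.exp (-((y ⬝ᵥ H *ᵥ y / 2 : ℝ) : ℂ))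
      = ((Real.exp (-(y ⬝ᵥ H *ᵥ y) / 2) : ℝ) : ℂ) := by
    intro y; push_cast; congr 1; ring
  simp_rw [e] at h
  rw [integral_complex_ofReal] at h
  have h3 : ((∫ y : κ → ℝ, Real.exp (-(y ⬝ᵥ H *ᵥ y) / 2) : ℝ) : ℂ) = ((gaussMass H : ℝ) : ℂ) := by
    rw [h]; simp
  exact_mod_cast h3

lemma isProbabilityMeasure_gaussMeasure {H : Matrix κ κ ℝ} (hH : H.PosDef) :
    IsProbabilityMeasure (gaussMeasure H) := by
  constructor
  have hG := gaussMass_pos hH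
  rw [gaussMeasure, Measure.smul_apply, withDensity_apply _ MeasurableSet.univ, setLIntegral_univ,
    ← ofReal_integral_eq_lintegral_ofReal (integrable_exp_neg_quadForm hH)
      (ae_of_all _ fun _ => (Real.exp_pos _).le), integral_exp_neg_quadForm hH, smul_eq_mul,
    ← ENNReal.ofReal_mul (by positivity), inv_mul_cancel₀ hG.ne', ENNReal.ofReal_one]

omit [DecidableEq κ] in
lemma measurable_exp_neg_quadForm (H : Matrix κ κ ℝ) :
    Measurable (fun y : κ → ℝ => Real.exp (-(y ⬝ᵥ H *ᵥ y) / 2)) := by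
  apply Continuous.measurable
  fun_prop

lemma integral_gaussMeasure {E : Type*} [NormedAddCommGroup E] [NormedSpace ℝ E]
    {H : Matrix κ κ ℝ} (hH : H.PosDef) (f : (κ → ℝ) → E) :
    ∫ y, f y ∂(gaussMeasure H)
      = (gaussMass H)⁻¹ • ∫ y, Real.exp (-(y ⬝ᵥ H *ᵥ y) / 2) • f y := by
  have hG := gaussMass_pos hH
  rw [gaussMeasure, integral_smul_measure, ENNReal.toReal_ofReal (by positivity),
    integral_withDensity_eq_integral_toReal_smul₀
      (measurable_exp_neg_quadForm H).ennreal_ofReal.aemeasurable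
      (ae_of_all _ fun _ => ENNReal.ofReal_lt_top)]
  simp_rw [ENNReal.toReal_ofReal (Real.exp_pos _).le]

lemma integrable_gaussMeasure_iff {E : Type*} [NormedAddCommGroup E] [NormedSpace ℝ E]
    {H : Matrix κ κ ℝ} (hH : H.PosDef) (f : (κ → ℝ) → E) :
    Integrable f (gaussMeasure H)
      ↔ Integrable (fun y => Real.exp (-(y ⬝ᵥ H *ᵥ y) / 2) • f y) := by
  have hG := gaussMass_pos hH
  rw [gaussMeasure, integrable_smul_measure (by simpa using hG) ENNReal.ofReal_ne_top,
    integrable_withDensity_iff_integrable_smul₀'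
      (measurable_exp_neg_quadForm H).ennreal_ofReal.aemeasurable
      (ae_of_all _ fun _ => ENNReal.ofReal_lt_top)]
  simp_rw [ENNReal.toReal_ofReal (Real.exp_pos _).le]

/-- Linear functionals of the Gaussian measure are one-dimensional Gaussians; the characteristic
function identifies them. -/
lemma map_dotProduct_gaussMeasure {H : Matrix κ κ ℝ} (hH : H.PosDef) (a : κ → ℝ) :
    (gaussMeasure H).map (fun y => a ⬝ᵥ y) = gaussianReal 0 (a ⬝ᵥ H⁻¹ *ᵥ a).toNNReal := by
  have := isProbabilityMeasure_gaussMeasure hH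
  have hm : Measurable (fun y : κ → ℝ => a ⬝ᵥ y) := Continuous.measurable (by fun_prop)
  have := Measure.isProbabilityMeasure_map (μ := gaussMeasure H) hm.aemeasurable
  have hG := gaussMass_pos hH
  have hv : 0 ≤ a ⬝ᵥ H⁻¹ *ᵥ a := by
    simpa using hH.inv.posSemidef.dotProduct_mulVec_nonneg a
  refine Measure.ext_of_charFun (funext fun t => ?_)
  rw [charFun_gaussianReal, charFun_apply_real, integral_map hm.aemeasurable (by fun_prop),
    integral_gaussMeasure hH]
  have e : ∀ y : κ → ℝ, Real.exp (-(y ⬝ᵥ H *ᵥ y) / 2) •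
      Complex.exp (t * ((a ⬝ᵥ y : ℝ) : ℂ) * Complex.I) =
      Complex.exp (-((y ⬝ᵥ H *ᵥ y / 2 : ℝ) : ℂ) + t * Complex.I * ((a ⬝ᵥ y : ℝ) : ℂ)) := by
    intro y
    rw [Complex.exp_add, Complex.real_smul]
    push_cast
    congr 2 <;> ring
  simp_rw [e]
  rw [integral_cexp_quadForm hH, Complex.real_smul, ← mul_assoc, ← Complex.ofReal_mul,
    inv_mul_cancel₀ hG.ne', Complex.ofReal_one, one_mul]
  congr 1
  simp [Real.coe_toNNReal _ hv]

/-- The fourth and sixth moments, read off from the moment generating function: each of its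
derivatives is a polynomial times `exp (v t² / 2)`. -/
lemma integral_pow_gaussianReal (v : ℝ≥0) :
    ∫ x, x ^ 4 ∂(gaussianReal 0 v) = 3 * (v : ℝ) ^ 2 ∧
    ∫ x, x ^ 6 ∂(gaussianReal 0 v) = 15 * (v : ℝ) ^ 3 := by
  have hm : mgf (fun x => x) (gaussianReal 0 v) = fun t => Real.exp (v * t ^ 2 / 2) := by
    rw [mgf_fun_id_gaussianReal]; simp
  generalize hw : (v : ℝ) = w at hm
  have hE : ∀ t : ℝ, HasDerivAt (fun t : ℝ => Real.exp (w * t ^ 2 / 2))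
      (Real.exp (w * t ^ 2 / 2) * (w * t)) t := by
    intro t
    have : HasDerivAt (fun t : ℝ => w * t ^ 2 / 2) (w * t) t := by
      have := ((hasDerivAt_pow 2 t).const_mul w).div_const 2
      exact this.congr_deriv (by simp; ring)
    exact this.exp
  have step : ∀ (p p' q : ℝ → ℝ), (∀ t, HasDerivAt p (p' t) t) →
      (∀ t, q t = p' t + w * t * p t) →
      deriv (fun t => p t * Real.exp (w * t ^ 2 / 2)) =
        fun t => q t * Real.exp (w * t ^ 2 / 2) := by
    intro p p' q hp hq
    ext t
    refine ((hp t).mul (hE t)).deriv.trans ?_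
    rw [hq]; ring
  have hpoly : ∀ (c0 c1 c2 c3 c4 c5 t : ℝ), HasDerivAt
      (fun t : ℝ => c0 + c1 * t + c2 * t ^ 2 + c3 * t ^ 3 + c4 * t ^ 4 + c5 * t ^ 5)
      (c1 + 2 * c2 * t + 3 * c3 * t ^ 2 + 4 * c4 * t ^ 3 + 5 * c5 * t ^ 4) t := by
    intro c0 c1 c2 c3 c4 c5 t
    have h := (((((hasDerivAt_const t c0).add ((hasDerivAt_id t).const_mul c1)).add
      ((hasDerivAt_pow 2 t).const_mul c2)).add ((hasDerivAt_pow 3 t).const_mul c3)).add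
      ((hasDerivAt_pow 4 t).const_mul c4)).add ((hasDerivAt_pow 5 t).const_mul c5)
    exact h.congr_deriv (by simp; ring)
  have h0 : iteratedDeriv 0 (mgf (fun x => x) (gaussianReal 0 v)) =
      fun t => (fun t : ℝ => 1 + 0 * t + 0 * t ^ 2 + 0 * t ^ 3 + 0 * t ^ 4 + 0 * t ^ 5) t
        * Real.exp (w * t ^ 2 / 2) := by
    rw [iteratedDeriv_zero, hm]; ext t; simp
  have h1 : iteratedDeriv 1 (mgf (fun x => x) (gaussianReal 0 v)) =
      fun t => (fun t : ℝ => 0 + w * t + 0 * t ^ 2 + 0 * t ^ 3 + 0 * t ^ 4 + 0 * t ^ 5) t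
        * Real.exp (w * t ^ 2 / 2) := by
    rw [iteratedDeriv_succ, h0]
    exact step _ _ _ (hpoly _ _ _ _ _ _) (fun t => by ring)
  have h2 : iteratedDeriv 2 (mgf (fun x => x) (gaussianReal 0 v)) =
      fun t => (fun t : ℝ => w + 0 * t + w ^ 2 * t ^ 2 + 0 * t ^ 3 + 0 * t ^ 4 + 0 * t ^ 5) t
        * Real.exp (w * t ^ 2 / 2) := by
    rw [iteratedDeriv_succ, h1]
    exact step _ _ _ (hpoly _ _ _ _ _ _) (fun t => by ring)
  have h3 : iteratedDeriv 3 (mgf (fun x => x) (gaussianReal 0 v)) =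
      fun t => (fun t : ℝ => 0 + 3 * w ^ 2 * t + 0 * t ^ 2 + w ^ 3 * t ^ 3 + 0 * t ^ 4
        + 0 * t ^ 5) t * Real.exp (w * t ^ 2 / 2) := by
    rw [iteratedDeriv_succ, h2]
    exact step _ _ _ (hpoly _ _ _ _ _ _) (fun t => by ring)
  have h4 : iteratedDeriv 4 (mgf (fun x => x) (gaussianReal 0 v)) =
      fun t => (fun t : ℝ => 3 * w ^ 2 + 0 * t + 6 * w ^ 3 * t ^ 2 + 0 * t ^ 3 + w ^ 4 * t ^ 4
        + 0 * t ^ 5) t * Real.exp (w * t ^ 2 / 2) := by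
    rw [iteratedDeriv_succ, h3]
    exact step _ _ _ (hpoly _ _ _ _ _ _) (fun t => by ring)
  have h5 : iteratedDeriv 5 (mgf (fun x => x) (gaussianReal 0 v)) =
      fun t => (fun t : ℝ => 0 + 15 * w ^ 3 * t + 0 * t ^ 2 + 10 * w ^ 4 * t ^ 3 + 0 * t ^ 4
        + w ^ 5 * t ^ 5) t * Real.exp (w * t ^ 2 / 2) := by
    rw [iteratedDeriv_succ, h4]
    exact step _ _ _ (hpoly _ _ _ _ _ _) (fun t => by ring)
  have h6 : iteratedDeriv 6 (mgf (fun x => x) (gaussianReal 0 v)) =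
      fun t => (15 * w ^ 3 + 45 * w ^ 4 * t ^ 2 + 15 * w ^ 5 * t ^ 4 + w ^ 6 * t ^ 6)
        * Real.exp (w * t ^ 2 / 2) := by
    rw [iteratedDeriv_succ, h5]
    exact step _ _ _ (hpoly _ _ _ _ _ _) (fun t => by ring)
  have hs : (0 : ℝ) ∈ interior (integrableExpSet (fun x => x) (gaussianReal 0 v)) := by simp
  constructor
  · have := iteratedDeriv_mgf_zero hs 4
    rw [h4] at this
    simpa using this.symm
  · have := iteratedDeriv_mgf_zero hs 6
    rw [h6] at this
    simpa using this.symm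

end

/-! ### Moments and tails of Gaussian measures -/

section

open MeasureTheory ProbabilityTheory Matrix
open scoped NNReal ENNReal

section Moments

variable {κ : Type*} [Fintype κ] [DecidableEq κ] {H : Matrix κ κ ℝ}

lemma integrable_dotProduct_pow (hH : H.PosDef) (a : κ → ℝ) (k : ℕ) :
    Integrable (fun y => (a ⬝ᵥ y) ^ k) (gaussMeasure H) := by
  have hm : Measurable (fun y : κ → ℝ => a ⬝ᵥ y) := Continuous.measurable (by fun_prop)
  have h : Integrable (fun x : ℝ => x ^ k) ((gaussMeasure H).map (fun y => a ⬝ᵥ y)) := by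
    rw [map_dotProduct_gaussMeasure hH]
    have := (memLp_id_gaussianReal (μ := 0) (v := (a ⬝ᵥ H⁻¹ *ᵥ a).toNNReal) k).integrable_norm_pow'
    refine this.mono (by fun_prop) (ae_of_all _ fun x => ?_)
    simp
  exact h.comp_measurable hm

lemma variance_nonneg (hH : H.PosDef) (a : κ → ℝ) : 0 ≤ a ⬝ᵥ H⁻¹ *ᵥ a := by
  simpa using hH.inv.posSemidef.dotProduct_mulVec_nonneg a

lemma integral_dotProduct_pow_four (hH : H.PosDef) (a : κ → ℝ) :
    ∫ y, (a ⬝ᵥ y) ^ 4 ∂(gaussMeasure H) = 3 * (a ⬝ᵥ H⁻¹ *ᵥ a) ^ 2 := by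
  have hm : Measurable (fun y : κ → ℝ => a ⬝ᵥ y) := Continuous.measurable (by fun_prop)
  have h := integral_map (μ := gaussMeasure H) hm.aemeasurable
    (f := fun x : ℝ => x ^ 4) (by fun_prop)
  rw [← h, map_dotProduct_gaussMeasure hH, (integral_pow_gaussianReal _).1,
    Real.coe_toNNReal _ (variance_nonneg hH a)]

lemma integral_dotProduct_pow_six (hH : H.PosDef) (a : κ → ℝ) :
    ∫ y, (a ⬝ᵥ y) ^ 6 ∂(gaussMeasure H) = 15 * (a ⬝ᵥ H⁻¹ *ᵥ a) ^ 3 := by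
  have hm : Measurable (fun y : κ → ℝ => a ⬝ᵥ y) := Continuous.measurable (by fun_prop)
  have h := integral_map (μ := gaussMeasure H) hm.aemeasurable
    (f := fun x : ℝ => x ^ 6) (by fun_prop)
  rw [← h, map_dotProduct_gaussMeasure hH, (integral_pow_gaussianReal _).2,
    Real.coe_toNNReal _ (variance_nonneg hH a)]

lemma covariance_comm (hH : H.PosDef) (a b : κ → ℝ) : b ⬝ᵥ H⁻¹ *ᵥ a = a ⬝ᵥ H⁻¹ *ᵥ b := by
  have hs : (H⁻¹)ᵀ = H⁻¹ := by
    have := hH.inv.isHermitian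
    rwa [IsHermitian, conjTranspose_eq_transpose_of_trivial] at this
  rw [dotProduct_comm, ← hs, mulVec_transpose, ← dotProduct_mulVec, hs]

lemma integrable_dotProduct_cube_mul_cube (hH : H.PosDef) (a b : κ → ℝ) :
    Integrable (fun y => (a ⬝ᵥ y) ^ 3 * (b ⬝ᵥ y) ^ 3) (gaussMeasure H) := by
  refine ((integrable_dotProduct_pow hH a 6).add (integrable_dotProduct_pow hH b 6)).mono
    (Continuous.aestronglyMeasurable (by fun_prop)) (ae_of_all _ fun y => ?_)
  simp only [Pi.add_apply, Real.norm_eq_abs]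
  rw [abs_of_nonneg (by positivity : 0 ≤ (a ⬝ᵥ y) ^ 6 + (b ⬝ᵥ y) ^ 6), abs_le]
  constructor <;> nlinarith [sq_nonneg ((a ⬝ᵥ y) ^ 3 + (b ⬝ᵥ y) ^ 3),
    sq_nonneg ((a ⬝ᵥ y) ^ 3 - (b ⬝ᵥ y) ^ 3), sq_nonneg ((a ⬝ᵥ y) ^ 3), sq_nonneg ((b ⬝ᵥ y) ^ 3)]

/-- Wick's formula for two cubes, obtained from the sixth moments of `a ± b`, `a ± 2b` and `2a ± b`
by polarization. -/
lemma integral_dotProduct_cube_mul_cube (hH : H.PosDef) (a b : κ → ℝ) :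
    ∫ y, (a ⬝ᵥ y) ^ 3 * (b ⬝ᵥ y) ^ 3 ∂(gaussMeasure H) =
      9 * (a ⬝ᵥ H⁻¹ *ᵥ a) * (b ⬝ᵥ H⁻¹ *ᵥ b) * (a ⬝ᵥ H⁻¹ *ᵥ b) + 6 * (a ⬝ᵥ H⁻¹ *ᵥ b) ^ 3 := by
  have hi : ∀ p q : ℝ, Integrable (fun y => ((p • a + q • b) ⬝ᵥ y) ^ 6) (gaussMeasure H) :=
    fun p q => integrable_dotProduct_pow hH _ 6
  have hv : ∀ p q : ℝ, ∫ y, ((p • a + q • b) ⬝ᵥ y) ^ 6 ∂(gaussMeasure H) =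
      15 * (p ^ 2 * (a ⬝ᵥ H⁻¹ *ᵥ a) + 2 * p * q * (a ⬝ᵥ H⁻¹ *ᵥ b)
        + q ^ 2 * (b ⬝ᵥ H⁻¹ *ᵥ b)) ^ 3 := by
    intro p q
    rw [integral_dotProduct_pow_six hH]
    simp only [mulVec_add, mulVec_smul, add_dotProduct, dotProduct_add, smul_dotProduct,
      dotProduct_smul, smul_eq_mul, covariance_comm hH a b]
    ring
  have e : ∀ y : κ → ℝ, (a ⬝ᵥ y) ^ 3 * (b ⬝ᵥ y) ^ 3 =
      (1 / 720) * (34 * (((1 : ℝ) • a + (1 : ℝ) • b) ⬝ᵥ y) ^ 6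
        - 34 * (((1 : ℝ) • a + (-1 : ℝ) • b) ⬝ᵥ y) ^ 6
        - (((1 : ℝ) • a + (2 : ℝ) • b) ⬝ᵥ y) ^ 6 + (((1 : ℝ) • a + (-2 : ℝ) • b) ⬝ᵥ y) ^ 6
        - (((2 : ℝ) • a + (1 : ℝ) • b) ⬝ᵥ y) ^ 6 + (((2 : ℝ) • a + (-1 : ℝ) • b) ⬝ᵥ y) ^ 6) := by
    intro y
    simp only [add_dotProduct, smul_dotProduct, smul_eq_mul]
    ring
  simp_rw [e]
  rw [integral_const_mul, integral_add, integral_sub, integral_add, integral_sub, integral_sub,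
    integral_const_mul, integral_const_mul]
  · simp only [hv]; ring
  · exact (hi _ _).const_mul _
  · exact (hi _ _).const_mul _
  · exact ((hi _ _).const_mul _).sub ((hi _ _).const_mul _)
  · exact hi _ _
  · exact (((hi _ _).const_mul _).sub ((hi _ _).const_mul _)).sub (hi _ _)
  · exact hi _ _
  · exact ((((hi _ _).const_mul _).sub ((hi _ _).const_mul _)).sub (hi _ _)).add (hi _ _)
  · exact hi _ _
  · exact (((((hi _ _).const_mul _).sub ((hi _ _).const_mul _)).sub (hi _ _)).add
      (hi _ _)).sub (hi _ _)
  · exact hi _ _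

/-- The Chernoff bound for a linear functional; only an upper bound for its variance matters. -/
lemma gaussMeasure_tail (hH : H.PosDef) (a : κ → ℝ) {v h : ℝ} (hv : 0 < v)
    (hav : a ⬝ᵥ H⁻¹ *ᵥ a ≤ v) (hh : 0 ≤ h) :
    (gaussMeasure H).real {y | h < |a ⬝ᵥ y|} ≤ 2 * Real.exp (-h ^ 2 / (2 * v)) := by
  have := isProbabilityMeasure_gaussMeasure hH
  have hmgf : ∀ b : κ → ℝ, b ⬝ᵥ H⁻¹ *ᵥ b ≤ v →
      HasSubgaussianMGF (fun y => b ⬝ᵥ y) v.toNNReal (gaussMeasure H) := by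
    intro b hb
    have hmap := map_dotProduct_gaussMeasure hH b
    constructor
    · intro t
      have hm : Measurable (fun y : κ → ℝ => b ⬝ᵥ y) := Continuous.measurable (by fun_prop)
      have h : Integrable (fun x : ℝ => Real.exp (t * x))
          ((gaussMeasure H).map (fun y => b ⬝ᵥ y)) := by
        rw [hmap]; exact integrable_exp_mul_gaussianReal t
      exact h.comp_measurable hm
    · intro t
      rw [mgf_gaussianReal hmap, zero_mul, zero_add, Real.coe_toNNReal _ (variance_nonneg hH b),
        Real.coe_toNNReal _ hv.le]
      gcongr
  have h1 := (hmgf a hav).measure_ge_le hh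
  have h2 := (hmgf (-a) (by simpa [mulVec_neg] using hav)).measure_ge_le hh
  rw [Real.coe_toNNReal _ hv.le] at h1 h2
  calc (gaussMeasure H).real {y | h < |a ⬝ᵥ y|}
      ≤ (gaussMeasure H).real ({y | h ≤ a ⬝ᵥ y} ∪ {y | h ≤ (-a) ⬝ᵥ y}) := by
        refine measureReal_mono (fun y hy => ?_)
        have hy' : h < |a ⬝ᵥ y| := by simpa using hy
        rcases lt_abs.1 hy' with hy | hy
        · exact Or.inl hy.le
        · right; simpa using hy.le
    _ ≤ _ := measureReal_union_le _ _
    _ ≤ _ := by linarith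

end Moments

/-! ### Quadratic forms built from weighted linear forms -/

section WeightedForms

variable {κ E : Type*} [Fintype κ] [DecidableEq κ]

/-- The precision matrix `∑ₑ wₑ Lₑ Lₑᵀ` of the quadratic form `∑ₑ wₑ (Lₑ ⬝ᵥ y)²`. -/
def precision (s : Finset E) (w : E → ℝ) (L : E → κ → ℝ) : Matrix κ κ ℝ :=
  ∑ e ∈ s, w e • vecMulVec (L e) (L e)

variable {s : Finset E} {w : E → ℝ} {L : E → κ → ℝ}

omit [DecidableEq κ] in
lemma precision_mulVec (y : κ → ℝ) :
    precision s w L *ᵥ y = ∑ e ∈ s, (w e * (L e ⬝ᵥ y)) • L e := by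
  ext j
  simp only [precision, sum_mulVec, smul_mulVec, vecMulVec_mulVec, Finset.sum_apply, Pi.smul_apply,
    smul_eq_mul, op_smul_eq_smul]
  refine Finset.sum_congr rfl fun e _ => by ring

omit [DecidableEq κ] in
lemma dotProduct_precision_mulVec (x y : κ → ℝ) :
    x ⬝ᵥ precision s w L *ᵥ y = ∑ e ∈ s, w e * (L e ⬝ᵥ x) * (L e ⬝ᵥ y) := by
  rw [precision_mulVec, dotProduct_sum]
  refine Finset.sum_congr rfl fun e _ => ?_
  rw [dotProduct_smul, smul_eq_mul, dotProduct_comm x]; ring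

/-- If `(Lₑ ⬝ᵥ y)²` is at most `v` times the quadratic form, then `Lₑ ⬝ᵥ y` has variance at most
`v`: take `y = H⁻¹ Lₑ`. -/
lemma variance_le (hH : (precision s w L).PosDef) {v : ℝ} (hv0 : 0 ≤ v) {e : E}
    (hv : ∀ y, (L e ⬝ᵥ y) ^ 2 ≤ v * (y ⬝ᵥ precision s w L *ᵥ y)) :
    L e ⬝ᵥ (precision s w L)⁻¹ *ᵥ L e ≤ v := by
  set H := precision s w L
  have hu : IsUnit H.det := hH.det_pos.ne'.isUnit
  have h := hv (H⁻¹ *ᵥ L e)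
  rw [mulVec_mulVec, mul_nonsing_inv _ hu, one_mulVec, dotProduct_comm (H⁻¹ *ᵥ L e)] at h
  rcases (variance_nonneg hH (L e)).lt_or_eq with h0 | h0
  · nlinarith
  · rw [← h0]; exact hv0

/-- The weighted variances of the forms sum to the trace of `H⁻¹ H`, hence to the dimension. -/
lemma sum_weight_mul_variance (hH : (precision s w L).PosDef) :
    ∑ e ∈ s, w e * (L e ⬝ᵥ (precision s w L)⁻¹ *ᵥ L e) = Fintype.card κ := by
  set H := precision s w L with hHd
  have hu : IsUnit H.det := hH.det_pos.ne'.isUnit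
  have h : trace (H⁻¹ * H) = Fintype.card κ := by
    rw [nonsing_inv_mul _ hu, trace_one]
  rw [← h]
  nth_rewrite 3 [hHd]
  rw [precision, Finset.mul_sum, trace_sum]
  refine Finset.sum_congr rfl fun e _ => ?_
  rw [mul_smul_comm, trace_smul, smul_eq_mul, mul_vecMulVec, trace_vecMulVec, dotProduct_comm]

lemma sum_weight_mul_covariance_sq (hH : (precision s w L).PosDef) (a : κ → ℝ) :
    ∑ e ∈ s, w e * (a ⬝ᵥ (precision s w L)⁻¹ *ᵥ L e) ^ 2
      = a ⬝ᵥ (precision s w L)⁻¹ *ᵥ a := by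
  set H := precision s w L with hHd
  have hu : IsUnit H.det := hH.det_pos.ne'.isUnit
  have h := dotProduct_precision_mulVec (s := s) (w := w) (L := L) (H⁻¹ *ᵥ a) (H⁻¹ *ᵥ a)
  rw [← hHd, mulVec_mulVec, mul_nonsing_inv _ hu, one_mulVec, dotProduct_comm] at h
  rw [h]
  refine Finset.sum_congr rfl fun e _ => ?_
  rw [covariance_comm hH]; ring

/-- Since `∑ₑ wₑ Lₑ Lₑᵀ` is the inverse covariance, a linear combination `∑ₑ aₑ Lₑ ⬝ᵥ y` has
variance at most `∑ₑ aₑ² / wₑ`. -/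
lemma variance_sum_le (hH : (precision s w L).PosDef) (hw : ∀ e ∈ s, 0 < w e) (a : E → ℝ) :
    ∑ e ∈ s, ∑ f ∈ s, a e * a f * (L e ⬝ᵥ (precision s w L)⁻¹ *ᵥ L f)
      ≤ ∑ e ∈ s, a e ^ 2 / w e := by
  set H := precision s w L with hHd
  set t : κ → ℝ := ∑ e ∈ s, a e • L e with ht
  have h1 : ∑ e ∈ s, ∑ f ∈ s, a e * a f * (L e ⬝ᵥ H⁻¹ *ᵥ L f) = t ⬝ᵥ H⁻¹ *ᵥ t := by
    rw [ht, mulVec_sum, sum_dotProduct]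
    refine Finset.sum_congr rfl fun e _ => ?_
    rw [dotProduct_sum]
    refine Finset.sum_congr rfl fun f _ => ?_
    rw [mulVec_smul, smul_dotProduct, dotProduct_smul, smul_eq_mul, smul_eq_mul]; ring
  have h2 : t ⬝ᵥ H⁻¹ *ᵥ t = ∑ e ∈ s, a e * (t ⬝ᵥ H⁻¹ *ᵥ L e) := by
    conv_lhs => rw [← covariance_comm hH]
    nth_rewrite 2 [ht]
    rw [mulVec_sum, dotProduct_sum]
    refine Finset.sum_congr rfl fun e _ => ?_
    rw [mulVec_smul, dotProduct_smul, smul_eq_mul]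
  have h3 := sum_weight_mul_covariance_sq hH t
  have h4 : ∑ e ∈ s, 2 * (a e * (t ⬝ᵥ H⁻¹ *ᵥ L e)) ≤
      ∑ e ∈ s, (a e ^ 2 / w e + w e * (t ⬝ᵥ H⁻¹ *ᵥ L e) ^ 2) := by
    refine Finset.sum_le_sum fun e he => ?_
    have hwe := hw e he
    set x := t ⬝ᵥ H⁻¹ *ᵥ L e
    have : a e ^ 2 / w e + w e * x ^ 2 - 2 * (a e * x) = (a e - w e * x) ^ 2 / w e := by
      field_simp; ring
    have : 0 ≤ (a e - w e * x) ^ 2 / w e := by positivity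
    linarith
  rw [← Finset.mul_sum, ← h2, Finset.sum_add_distrib, h3] at h4
  rw [h1]; linarith

lemma integral_weighted_fourth_le (hH : (precision s w L).PosDef) (hw : ∀ e ∈ s, 0 < w e) {v : ℝ}
    (hv : ∀ e ∈ s, L e ⬝ᵥ (precision s w L)⁻¹ *ᵥ L e ≤ v) :
    ∫ y, ∑ e ∈ s, w e * (L e ⬝ᵥ y) ^ 4 ∂(gaussMeasure (precision s w L))
      ≤ 3 * Fintype.card κ * v := by
  rw [integral_finsetSum _ fun e _ => (integrable_dotProduct_pow hH _ 4).const_mul _]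
  simp_rw [integral_const_mul, integral_dotProduct_pow_four hH]
  rw [← sum_weight_mul_variance hH, Finset.mul_sum, Finset.sum_mul]
  refine Finset.sum_le_sum fun e he => ?_
  have h1 := variance_nonneg hH (L e)
  have h2 := hw e he
  have h3 := hv e he
  calc _ = 3 * (w e * (L e ⬝ᵥ (precision s w L)⁻¹ *ᵥ L e)) *
        (L e ⬝ᵥ (precision s w L)⁻¹ *ᵥ L e) := by
        ring
    _ ≤ _ := by gcongr

/-- The second moment of the cubic term: by Wick's formula it splits into a part which is the
variance of a linear functional and a part controlled by the squared covariances. -/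
lemma integral_cubic_sq_le (hH : (precision s w L).PosDef) (hw : ∀ e ∈ s, 0 < w e) {v : ℝ}
    (hv : ∀ e ∈ s, L e ⬝ᵥ (precision s w L)⁻¹ *ᵥ L e ≤ v) (c : E → ℝ)
    (hc : ∀ e ∈ s, |c e| ≤ w e) :
    ∫ y, (∑ e ∈ s, c e * (L e ⬝ᵥ y) ^ 3) ^ 2 ∂(gaussMeasure (precision s w L))
      ≤ 15 * Fintype.card κ * v := by
  set H := precision s w L with hHd
  have hI : ∀ e f, Integrable (fun y => c e * c f * ((L e ⬝ᵥ y) ^ 3 * (L f ⬝ᵥ y) ^ 3))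
      (gaussMeasure H) := fun e f => (integrable_dotProduct_cube_mul_cube hH _ _).const_mul _
  have e1 : ∀ y : κ → ℝ, (∑ e ∈ s, c e * (L e ⬝ᵥ y) ^ 3) ^ 2 =
      ∑ e ∈ s, ∑ f ∈ s, c e * c f * ((L e ⬝ᵥ y) ^ 3 * (L f ⬝ᵥ y) ^ 3) := by
    intro y
    rw [sq, Finset.sum_mul_sum]
    refine Finset.sum_congr rfl fun e _ => Finset.sum_congr rfl fun f _ => by ring
  simp_rw [e1]
  rw [integral_finsetSum _ fun e _ => integrable_finsetSum _ fun f _ => hI e f]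
  simp_rw [integral_finsetSum _ fun f (_ : f ∈ s) => hI _ f, integral_const_mul,
    integral_dotProduct_cube_mul_cube hH]
  set V : E → ℝ := fun e => L e ⬝ᵥ H⁻¹ *ᵥ L e with hV
  set R : E → E → ℝ := fun e f => L e ⬝ᵥ H⁻¹ *ᵥ L f with hR
  have hV0 : ∀ e, 0 ≤ V e := fun e => variance_nonneg hH _
  have hsum : ∑ e ∈ s, w e * V e = Fintype.card κ := sum_weight_mul_variance hH
  have hcs : ∀ e ∈ s, ∀ f ∈ s, |R e f| ≤ v := by
    intro e he f hf
    have h1 := variance_nonneg hH (L e + L f)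
    have h2 := variance_nonneg hH (L e - L f)
    simp only [mulVec_add, mulVec_sub, add_dotProduct, dotProduct_add, sub_dotProduct,
      dotProduct_sub, covariance_comm hH (L e) (L f)] at h1 h2
    have h3 := hv e he
    have h4 := hv f hf
    rw [abs_le]
    constructor <;> simp only [hR] <;> linarith
  have hA : ∑ e ∈ s, ∑ f ∈ s, (c e * V e) * (c f * V f) * R e f ≤ v * Fintype.card κ := by
    refine (variance_sum_le hH hw (fun e => c e * V e)).trans ?_
    rw [← hsum, Finset.mul_sum]
    refine Finset.sum_le_sum fun e he => ?_
    have hwe := hw e he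
    have hce := hc e he
    rw [div_le_iff₀ hwe]
    have : c e ^ 2 ≤ w e ^ 2 := by rw [← sq_abs]; gcongr
    calc (c e * V e) ^ 2 = c e ^ 2 * V e * V e := by ring
      _ ≤ w e ^ 2 * V e * v := by
        have := hV0 e
        gcongr
        exact hv e he
      _ = _ := by ring
  have hB : ∑ e ∈ s, ∑ f ∈ s, c e * c f * R e f ^ 3 ≤ v * Fintype.card κ := by
    rw [← hsum, Finset.mul_sum]
    refine Finset.sum_le_sum fun e he => ?_
    have h5 : ∑ f ∈ s, w f * R e f ^ 2 = V e := sum_weight_mul_covariance_sq hH (L e)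
    rw [← h5, Finset.mul_sum, Finset.mul_sum]
    refine Finset.sum_le_sum fun f hf => ?_
    have := hw e he
    have := hw f hf
    have := hc e he
    have := hc f hf
    have := hcs e he f hf
    calc c e * c f * R e f ^ 3 ≤ |c e * c f * R e f ^ 3| := le_abs_self _
      _ = |c e| * |c f| * |R e f| * R e f ^ 2 := by
        rw [abs_mul, abs_mul, abs_pow, pow_succ' |R e f|, sq_abs]; ring
      _ ≤ w e * w f * v * R e f ^ 2 := by gcongr
      _ = _ := by ring
  calc ∑ e ∈ s, ∑ f ∈ s, c e * c f * (9 * V e * V f * R e f + 6 * R e f ^ 3)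
      = 9 * ∑ e ∈ s, ∑ f ∈ s, (c e * V e) * (c f * V f) * R e f
        + 6 * ∑ e ∈ s, ∑ f ∈ s, c e * c f * R e f ^ 3 := by
        rw [Finset.mul_sum, Finset.mul_sum, ← Finset.sum_add_distrib]
        refine Finset.sum_congr rfl fun e _ => ?_
        rw [Finset.mul_sum, Finset.mul_sum, ← Finset.sum_add_distrib]
        refine Finset.sum_congr rfl fun f _ => by ring
    _ ≤ 9 * (v * Fintype.card κ) + 6 * (v * Fintype.card κ) := by gcongr
    _ = _ := by ring

end WeightedForms

end

/-! ### The characteristic function of a Bernoulli variable -/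

section

open Complex in
/-- The characteristic function at `x` of a centred Bernoulli variable with mean `p`. -/
def bernoulliChar (p x : ℝ) : ℂ :=
  (1 - p + p * exp (x * I)) * exp (-(p * x * I))

open Complex in
lemma continuous_bernoulliChar (p : ℝ) : Continuous (bernoulliChar p) := by
  unfold bernoulliChar
  fun_prop

open Complex in
/-- Exchanging success and failure; this allows `p ≤ 1 / 2` to be assumed. -/
lemma bernoulliChar_one_sub_neg (p x : ℝ) :
    bernoulliChar (1 - p) (-x) = bernoulliChar p x := by
  have h : exp (-(x * I)) * exp (x * I) = 1 := by rw [← exp_add]; simp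
  have h2 : exp (-((1 - p) * -x * I)) = exp (x * I) * exp (-(p * x * I)) := by
    rw [← exp_add]; ring_nf
  simp only [bernoulliChar, ofReal_sub, ofReal_one, ofReal_neg, neg_mul (x : ℂ)]
  rw [h2]
  linear_combination (1 - p) * exp (-(p * x * I)) * h

/-- The fourth order expansion of `1 + p (eᵘ - 1)` at `u = 0`, with error uniformly of order
`p u⁴`. -/
lemma norm_one_add_mul_exp_sub_le {p : ℝ} (hp0 : 0 ≤ p) (hp : p ≤ 1 / 2) {u : ℂ} (hu : ‖u‖ ≤ 1) :
    ‖1 + p * (Complex.exp u - 1) - Complex.exp (p * u + p * (1 - p) / 2 * u ^ 2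
      + p * (1 - p) * (1 - 2 * p) / 6 * u ^ 3)‖ ≤ p * ‖u‖ ^ 4 := by
  set a : ℝ := (1 - p) / 2 with ha
  set b : ℝ := (1 - p) * (1 - 2 * p) / 6 with hb
  have ha0 : 0 ≤ a := by rw [ha]; linarith
  have ha1 : a ≤ 1 / 2 := by rw [ha]; linarith
  have hb0 : 0 ≤ b := by rw [hb]; apply div_nonneg (mul_nonneg _ _) <;> linarith
  have hb1 : b ≤ 1 / 6 := by rw [hb]; nlinarith
  set t : ℂ := a + b * u with ht
  have hna : ‖(a : ℂ)‖ ≤ 1 / 2 := by rw [Complex.norm_real, Real.norm_of_nonneg ha0]; exact ha1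
  have hnb : ‖(b : ℂ)‖ ≤ 1 / 6 := by rw [Complex.norm_real, Real.norm_of_nonneg hb0]; exact hb1
  have hnp : ‖(p : ℂ)‖ = p := by rw [Complex.norm_real, Real.norm_of_nonneg hp0]
  have hnt : ‖t‖ ≤ 2 / 3 := by
    calc ‖t‖ ≤ ‖(a : ℂ)‖ + ‖(b : ℂ)‖ * ‖u‖ := by rw [ht, ← norm_mul]; exact norm_add_le _ _
      _ ≤ 1 / 2 + 1 / 6 * 1 := by gcongr
      _ = _ := by norm_num
  set z : ℂ := p * (u * (1 + t * u)) with hz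
  have hzz : p * u + p * (1 - p) / 2 * u ^ 2 + p * (1 - p) * (1 - 2 * p) / 6 * u ^ 3 = z := by
    rw [hz, ht, ha, hb]; push_cast; ring
  rw [hzz]
  have hnz : ‖z‖ ≤ p * (5 / 3 * ‖u‖) := by
    rw [hz, norm_mul, hnp, norm_mul]
    have : ‖1 + t * u‖ ≤ 5 / 3 := by
      calc ‖1 + t * u‖ ≤ ‖(1 : ℂ)‖ + ‖t‖ * ‖u‖ := by rw [← norm_mul]; exact norm_add_le _ _
        _ ≤ 1 + 2 / 3 * 1 := by rw [norm_one]; gcongr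
        _ = _ := by norm_num
    rw [mul_comm (5 / 3)]
    gcongr
  have hnz1 : ‖z‖ ≤ 1 := by nlinarith [norm_nonneg u]
  have hez := Complex.exp_bound hnz1 (n := 4) (by norm_num)
  have heu := Complex.exp_bound hu (n := 4) (by norm_num)
  norm_num [Finset.sum_range_succ, Nat.factorial] at hez heu
  -- `p u⁴ q` collects the terms of order at least `4` in the cubic Taylor polynomial of `exp z`
  set q : ℂ := p * (a ^ 2 + 2 * b + 2 * a * b * u + b ^ 2 * u ^ 2) / 2
    + p ^ 2 * (3 * t + 3 * t ^ 2 * u + t ^ 3 * u ^ 2) / 6 with hq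
  have hnq : ‖q‖ ≤ 1 / 2 := by
    have h1 : ‖(a : ℂ) ^ 2 + 2 * b + 2 * a * b * u + b ^ 2 * u ^ 2‖
        ≤ (1 / 2) ^ 2 + 2 * (1 / 6) + 2 * (1 / 2) * (1 / 6) * 1 + (1 / 6) ^ 2 * 1 ^ 2 := by
      refine (norm_add_le _ _).trans (add_le_add ((norm_add_le _ _).trans (add_le_add
        ((norm_add_le _ _).trans (add_le_add ?_ ?_)) ?_)) ?_) <;>
      simp only [norm_mul, norm_pow, Complex.norm_ofNat] <;> gcongr
    have h2 : ‖3 * t + 3 * t ^ 2 * u + t ^ 3 * u ^ 2‖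
        ≤ 3 * (2 / 3) + 3 * (2 / 3) ^ 2 * 1 + (2 / 3) ^ 3 * 1 ^ 2 := by
      refine (norm_add_le _ _).trans
        (add_le_add ((norm_add_le _ _).trans (add_le_add ?_ ?_)) ?_) <;>
      simp only [norm_mul, norm_pow, Complex.norm_ofNat] <;> gcongr
    calc ‖q‖ ≤ p * ‖(a : ℂ) ^ 2 + 2 * b + 2 * a * b * u + b ^ 2 * u ^ 2‖ / 2
          + p ^ 2 * ‖3 * t + 3 * t ^ 2 * u + t ^ 3 * u ^ 2‖ / 6 := by
          rw [hq]
          refine (norm_add_le _ _).trans (le_of_eq ?_)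
          rw [norm_div, norm_div, norm_mul, norm_mul, norm_pow, hnp]; norm_num
      _ ≤ (1 / 2) *
            ((1 / 2) ^ 2 + 2 * (1 / 6) + 2 * (1 / 2) * (1 / 6) * 1 + (1 / 6) ^ 2 * 1 ^ 2) / 2
          + (1 / 2) ^ 2 * (3 * (2 / 3) + 3 * (2 / 3) ^ 2 * 1 + (2 / 3) ^ 3 * 1 ^ 2) / 6 := by gcongr
      _ ≤ _ := by norm_num
  have hid : 1 + p * (Complex.exp u - 1) - Complex.exp z =
      p * (Complex.exp u - (1 + u + u ^ 2 / 2 + u ^ 3 / 6))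
      - (Complex.exp z - (1 + z + z ^ 2 / 2 + z ^ 3 / 6)) - p * u ^ 4 * q := by
    have : (1 + z + z ^ 2 / 2 + z ^ 3 / 6) - (1 + p * (u + u ^ 2 / 2 + u ^ 3 / 6)) =
        p * u ^ 4 * q := by
      have hp2 : (a : ℂ) = (1 - p) / 2 := by rw [ha]; push_cast; ring
      have hp3 : (b : ℂ) = (1 - p) * (1 - 2 * p) / 6 := by rw [hb]; push_cast; ring
      rw [hq, hz, ht, hp2, hp3]; ring
    linear_combination -this
  rw [hid]
  have hu4 : 0 ≤ ‖u‖ ^ 4 := by positivity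
  have hz4 : ‖z‖ ^ 4 ≤ p * (625 / 648 * ‖u‖ ^ 4) := by
    calc ‖z‖ ^ 4 ≤ (p * (5 / 3 * ‖u‖)) ^ 4 := by gcongr
      _ = p * (p ^ 3 * (625 / 81 * ‖u‖ ^ 4)) := by ring
      _ ≤ p * ((1 / 2) ^ 3 * (625 / 81 * ‖u‖ ^ 4)) := by gcongr
      _ = _ := by ring
  have hpu : 0 ≤ p * ‖u‖ ^ 4 := by positivity
  calc _ ≤ ‖p * (Complex.exp u - (1 + u + u ^ 2 / 2 + u ^ 3 / 6))‖
        + ‖Complex.exp z - (1 + z + z ^ 2 / 2 + z ^ 3 / 6)‖ + ‖p * u ^ 4 * q‖ :=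
        (norm_sub_le _ _).trans (add_le_add (norm_sub_le _ _) le_rfl)
    _ ≤ p * (‖u‖ ^ 4 * (5 / 96)) + p * (625 / 648 * ‖u‖ ^ 4) * (5 / 96)
        + p * ‖u‖ ^ 4 * (1 / 2) := by
        rw [norm_mul, hnp, norm_mul, norm_mul, hnp, norm_pow]
        gcongr
        exact hez.trans (by gcongr)
    _ ≤ _ := by nlinarith

open Complex in
/-- Near `0`, the characteristic function of a centred Bernoulli variable is the exponential of its
third order cumulant expansion, up to a relative error of fourth order. -/
lemma exists_bernoulliChar_eq {p : ℝ} (hp0 : 0 < p) (hp1 : p < 1) {x : ℝ} (hx : |x| ≤ 1) :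
    ∃ ρ : ℂ, ‖ρ‖ ≤ 4 * (p * (1 - p) * x ^ 4) ∧ bernoulliChar p x =
      exp (-(p * (1 - p) * x ^ 2 / 2 : ℝ) - (p * (1 - p) * (1 - 2 * p) / 6 * x ^ 3 : ℝ) * I)
        * (1 + ρ) := by
  wlog hp : p ≤ 1 / 2 generalizing p x
  · obtain ⟨ρ, h1, h2⟩ := this (p := 1 - p) (x := -x) (by linarith) (by linarith)
      (by rwa [abs_neg]) (by linarith)
    refine ⟨ρ, h1.trans (le_of_eq (by ring)), ?_⟩
    rw [← bernoulliChar_one_sub_neg, h2]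
    congr 2
    congr 1
    · congr 2; ring
    · congr 2; ring
  set z : ℂ := -(p * (1 - p) * x ^ 2 / 2 : ℝ)
    - (p * (1 - p) * (1 - 2 * p) / 6 * x ^ 3 : ℝ) * I with hz
  have key := norm_one_add_mul_exp_sub_le hp0.le hp (u := x * I) (by simpa using hx)
  have hxI : ‖(x * I : ℂ)‖ ^ 4 = x ^ 4 := by
    rw [norm_mul, norm_I, mul_one, norm_real, Real.norm_eq_abs, Even.pow_abs (by decide)]
  rw [hxI] at key
  have hI3 : I ^ 3 = -I := by rw [pow_succ, I_sq]; ring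
  have hzz : p * (x * I) + p * (1 - p) / 2 * (x * I) ^ 2
      + p * (1 - p) * (1 - 2 * p) / 6 * (x * I) ^ 3 = z + p * x * I := by
    rw [hz, mul_pow, mul_pow, hI3, I_sq]; push_cast; ring
  rw [hzz] at key
  have hE : exp z * exp (-z) = 1 := by rw [← exp_add]; simp
  have hE2 : exp (-(p * x * I)) * exp (p * x * I) = 1 := by rw [← exp_add]; simp
  refine ⟨bernoulliChar p x * exp (-z) - 1, ?_, ?_⟩
  · have e : bernoulliChar p x * exp (-z) - 1 =
        (1 + p * (exp (x * I) - 1) - exp (z + p * x * I)) * (exp (-(p * x * I)) * exp (-z)) := by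
      rw [bernoulliChar, exp_add]
      linear_combination exp (-(p * x * I)) * exp (p * x * I) * hE + hE2
    have hn1 : ‖exp (-(p * x * I))‖ = 1 := by
      rw [norm_exp]; simp
    have hn2 : ‖exp (-z)‖ ≤ 2 := by
      rw [norm_exp]
      have : (-z).re = p * (1 - p) * x ^ 2 / 2 := by
        rw [hz]
        simp only [neg_re, sub_re, ofReal_re, re_ofReal_mul, I_re, mul_zero]; ring
      rw [this]
      have h1 : p * (1 - p) * x ^ 2 / 2 ≤ 1 / 2 := by
        have : x ^ 2 ≤ 1 := by rw [← sq_abs]; nlinarith [abs_nonneg x]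
        have : p * (1 - p) ≤ 1 := by nlinarith
        have : 0 ≤ p * (1 - p) := by nlinarith
        nlinarith
      calc Real.exp (p * (1 - p) * x ^ 2 / 2) ≤ Real.exp (1 / 2) := Real.exp_le_exp.2 h1
        _ ≤ 2 := by
          rw [← Real.le_log_iff_exp_le (by norm_num)]
          linarith [Real.log_two_gt_d9]
    rw [e, norm_mul, norm_mul, hn1, one_mul]
    have hx4 : 0 ≤ x ^ 4 := by positivity
    calc _ ≤ p * x ^ 4 * 2 := by gcongr
      _ ≤ _ := by nlinarith [mul_nonneg hp0.le hx4]
  · linear_combination (1 - bernoulliChar p x) * hE - hE * (1 : ℂ)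

open Complex in
lemma norm_bernoulliChar_le (p x : ℝ) :
    ‖bernoulliChar p x‖ ≤ Real.exp (-(p * (1 - p) * (1 - Real.cos x))) := by
  have hn1 : ‖exp (-(p * x * I))‖ = 1 := by rw [norm_exp]; simp
  rw [bernoulliChar, norm_mul, hn1, mul_one]
  have e : (1 - p + p * exp (x * I) : ℂ) =
      ((1 - p + p * Real.cos x : ℝ) : ℂ) + (p * Real.sin x : ℝ) * I := by
    rw [exp_mul_I]; push_cast; ring
  have hsq : ‖(1 - p + p * exp (x * I) : ℂ)‖ ^ 2 = 1 - 2 * (p * (1 - p) * (1 - Real.cos x)) := by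
    rw [e, ← normSq_eq_norm_sq, normSq_add_mul_I]
    linear_combination p ^ 2 * Real.sin_sq_add_cos_sq x
  have h2 : ‖(1 - p + p * exp (x * I) : ℂ)‖ ^ 2
      ≤ Real.exp (-(p * (1 - p) * (1 - Real.cos x))) ^ 2 := by
    rw [hsq, ← Real.exp_nat_mul]
    have := Real.add_one_le_exp (((2 : ℕ) : ℝ) * -(p * (1 - p) * (1 - Real.cos x)))
    push_cast at this ⊢
    linarith
  exact le_of_sq_le_sq h2 (Real.exp_pos _).le

lemma one_sub_cos_ge {x h : ℝ} (hx : |x| ≤ h) (hh : h ≤ 1) :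
    (1 - h ^ 2 / 9) * x ^ 2 / 2 ≤ 1 - Real.cos x := by
  have h1 := Real.cos_bound (hx.trans hh)
  have h2 := (abs_le.1 h1).2
  have h3 : |x| ^ 4 = x ^ 2 * x ^ 2 := by rw [Even.pow_abs (by decide)]; ring
  have h4 : x ^ 2 ≤ h ^ 2 := by rw [← sq_abs]; gcongr
  rw [h3] at h2
  nlinarith [sq_nonneg x, mul_le_mul_of_nonneg_left h4 (sq_nonneg x)]

lemma norm_bernoulliChar_le_exp_sq {p : ℝ} (hp0 : 0 ≤ p) (hp1 : p ≤ 1) {x h : ℝ} (hx : |x| ≤ h)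
    (hh : h ≤ 1) :
    ‖bernoulliChar p x‖ ≤ Real.exp (-((1 - h ^ 2 / 9) * (p * (1 - p) * x ^ 2) / 2)) := by
  refine (norm_bernoulliChar_le p x).trans (Real.exp_le_exp.2 (neg_le_neg ?_))
  have h1 : 0 ≤ p * (1 - p) := mul_nonneg hp0 (by linarith)
  calc _ = p * (1 - p) * ((1 - h ^ 2 / 9) * x ^ 2 / 2) := by ring
    _ ≤ _ := mul_le_mul_of_nonneg_left (one_sub_cos_ge hx hh) h1

end

/-! ### Slabs and dyadic shells -/

section

open MeasureTheory ProbabilityTheory Matrix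
open scoped NNReal ENNReal

section Scaling

variable {κ : Type*} [Fintype κ] [DecidableEq κ] {H : Matrix κ κ ℝ}

/-- Widening the Gaussian by `1 - t` multiplies its mass by `(1 - t) ^ (-card κ / 2)`. -/
lemma gaussMass_smul_le (hH : H.PosDef) {t : ℝ} (ht0 : 0 ≤ t) (ht : t ≤ 1 / 2) :
    gaussMass ((1 - t) • H) ≤ Real.exp (Fintype.card κ * t) * gaussMass H := by
  have hd := hH.det_pos
  have h1 : 0 < 1 - t := by linarith
  have h2 : 1 ≤ Real.exp (2 * t) * (1 - t) := by
    have := Real.add_one_le_exp (2 * t)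
    nlinarith
  have h3 : 1 ≤ Real.exp (Fintype.card κ * t) ^ 2 * (1 - t) ^ Fintype.card κ := by
    have : Real.exp (Fintype.card κ * t) ^ 2 = Real.exp (2 * t) ^ Fintype.card κ := by
      rw [← Real.exp_nat_mul, ← Real.exp_nat_mul]; congr 1; push_cast; ring
    rw [this, ← mul_pow]
    exact one_le_pow₀ h2
  rw [gaussMass, gaussMass, ← Real.sqrt_sq (Real.exp_pos (Fintype.card κ * t)).le,
    ← Real.sqrt_mul (by positivity), det_smul]
  refine Real.sqrt_le_sqrt ?_
  rw [div_le_iff₀ (by positivity)]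
  have e : Real.exp (Fintype.card κ * t) ^ 2 * ((2 * Real.pi) ^ Fintype.card κ / H.det) *
      ((1 - t) ^ Fintype.card κ * H.det) =
      (Real.exp (Fintype.card κ * t) ^ 2 * (1 - t) ^ Fintype.card κ)
        * (2 * Real.pi) ^ Fintype.card κ := by
    field_simp
  rw [e]
  have : 0 < (2 * Real.pi) ^ Fintype.card κ := by positivity
  nlinarith

lemma setIntegral_exp_neg_quadForm (hH : H.PosDef) {S : Set (κ → ℝ)} (hS : MeasurableSet S) :
    ∫ y in S, Real.exp (-(y ⬝ᵥ H *ᵥ y) / 2) = gaussMass H * (gaussMeasure H).real S := by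
  have h := integral_gaussMeasure hH (S.indicator (1 : (κ → ℝ) → ℝ))
  rw [integral_indicator_one hS] at h
  have e : ∀ y : κ → ℝ, Real.exp (-(y ⬝ᵥ H *ᵥ y) / 2) • S.indicator (1 : (κ → ℝ) → ℝ) y
      = S.indicator (fun y => Real.exp (-(y ⬝ᵥ H *ᵥ y) / 2)) y := by
    intro y
    by_cases hy : y ∈ S <;> simp [hy]
  simp_rw [e] at h
  rw [integral_indicator hS] at h
  rw [h, smul_eq_mul, ← mul_assoc, mul_inv_cancel₀ (gaussMass_pos hH).ne', one_mul]

end Scaling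

variable {κ E : Type*} [Fintype κ] [DecidableEq κ]

/-- The region where all the linear forms `L e`, `e ∈ s`, are at most `h` in absolute value. -/
def slab (s : Finset E) (L : E → κ → ℝ) (h : ℝ) : Set (κ → ℝ) :=
  {y | ∀ e ∈ s, |L e ⬝ᵥ y| ≤ h}

omit [DecidableEq κ] in
lemma isClosed_slab (s : Finset E) (L : E → κ → ℝ) (h : ℝ) : IsClosed (slab s L h) := by
  have : slab s L h = ⋂ e ∈ s, {y | |L e ⬝ᵥ y| ≤ h} := by ext; simp [slab]
  rw [this]
  exact isClosed_biInter fun e _ => isClosed_le (by fun_prop) continuous_const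

omit [DecidableEq κ] in
lemma measurableSet_slab (s : Finset E) (L : E → κ → ℝ) (h : ℝ) : MeasurableSet (slab s L h) :=
  (isClosed_slab s L h).measurableSet

/-- The characteristic function of a sum of independent vectors `(ξₑ - pₑ) Lₑ` with `ξₑ` Bernoulli
of mean `pₑ`. -/
def bernoulliProd (s : Finset E) (p : E → ℝ) (L : E → κ → ℝ) (y : κ → ℝ) : ℂ :=
  ∏ e ∈ s, bernoulliChar (p e) (L e ⬝ᵥ y)

omit [DecidableEq κ] in
lemma continuous_bernoulliProd (s : Finset E) (p : E → ℝ) (L : E → κ → ℝ) :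
    Continuous (bernoulliProd s p L) :=
  continuous_finsetProd _ fun e _ => (continuous_bernoulliChar (p e)).comp (by fun_prop)

/-- The variance `p (1 - p)` of a Bernoulli variable. -/
def bernoulliVar (p : E → ℝ) (e : E) : ℝ := p e * (1 - p e)

variable {s : Finset E} {p : E → ℝ} {L : E → κ → ℝ}

omit [DecidableEq κ] in
/-- On a slab of width `h ≤ 1` the characteristic function is dominated by a Gaussian weight which
is wider by the factor `1 - h² / 9`. -/
lemma norm_bernoulliProd_le (hp : ∀ e ∈ s, 0 < p e ∧ p e < 1) {h : ℝ} (hh : h ≤ 1) {y : κ → ℝ}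
    (hy : y ∈ slab s L h) :
    ‖bernoulliProd s p L y‖ ≤
      Real.exp (-(y ⬝ᵥ ((1 - h ^ 2 / 9) • precision s (bernoulliVar p) L) *ᵥ y) / 2) := by
  rw [bernoulliProd, norm_prod, smul_mulVec, dotProduct_smul, dotProduct_precision_mulVec,
    smul_eq_mul, Finset.mul_sum, ← Finset.sum_neg_distrib, Finset.sum_div, Real.exp_sum]
  refine Finset.prod_le_prod (fun _ _ => norm_nonneg _) fun e he => ?_
  refine (norm_bernoulliChar_le_exp_sq (hp e he).1.le (hp e he).2.le (hy e he) hh).trans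
    (le_of_eq ?_)
  congr 1
  simp only [bernoulliVar]
  ring

/-- The union bound over the linear forms, for the Gaussian with precision matrix `t • H`. -/
lemma gaussMeasure_compl_slab_le (hH : (precision s (bernoulliVar p) L).PosDef) {v η t : ℝ}
    (hv0 : 0 < v) (ht : 0 < t)
    (hv : ∀ e ∈ s, ∀ y, (L e ⬝ᵥ y) ^ 2 ≤ v * (y ⬝ᵥ precision s (bernoulliVar p) L *ᵥ y))
    (hη : 0 ≤ η) :
    (gaussMeasure (t • precision s (bernoulliVar p) L)).real (slab s L η)ᶜ
      ≤ s.card * (2 * Real.exp (-(t * η ^ 2) / (2 * v))) := by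
  have : IsProbabilityMeasure (gaussMeasure (t • precision s (bernoulliVar p) L)) :=
    isProbabilityMeasure_gaussMeasure (hH.smul ht)
  have hsub : (slab s L η)ᶜ ⊆ ⋃ e ∈ s, {y | η < |L e ⬝ᵥ y|} := by
    intro y hy
    simp only [slab, Set.mem_compl_iff, Set.mem_ofPred_eq, not_forall, not_le] at hy
    obtain ⟨e, he, h⟩ := hy
    simp only [Set.mem_iUnion]
    exact ⟨e, he, h⟩
  refine (measureReal_mono hsub (measure_ne_top _ _)).trans
    ((measureReal_biUnion_finset_le _ _).trans ?_)
  rw [← nsmul_eq_mul]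
  refine Finset.sum_le_card_nsmul _ _ _ fun e he => ?_
  have hsm : t • precision s (bernoulliVar p) L =
      precision s (fun e => t * bernoulliVar p e) L := by
    simp [precision, Finset.smul_sum, smul_smul]
  have hvar : L e ⬝ᵥ (t • precision s (bernoulliVar p) L)⁻¹ *ᵥ L e ≤ v / t := by
    rw [hsm]
    refine variance_le (by rw [← hsm]; exact hH.smul ht) (by positivity) fun y => ?_
    rw [← hsm, smul_mulVec, dotProduct_smul, smul_eq_mul, ← mul_assoc, div_mul_cancel₀ _ ht.ne']
    exact hv e he y
  refine (gaussMeasure_tail (hH.smul ht) (L e) (by positivity) hvar hη).trans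
    (le_of_eq ?_)
  congr 2
  field_simp

/-- In a dyadic shell of slabs the loss from comparing the characteristic function with a slightly
wider Gaussian is outweighed by the Gaussian tail. -/
lemma integral_shell_le (hp : ∀ e ∈ s, 0 < p e ∧ p e < 1)
    (hH : (precision s (bernoulliVar p) L).PosDef) {v η : ℝ} (hv0 : 0 < v)
    (hv : ∀ e ∈ s, ∀ y, (L e ⬝ᵥ y) ^ 2 ≤ v * (y ⬝ᵥ precision s (bernoulliVar p) L *ᵥ y))
    (hnv : Fintype.card κ * v ≤ 1 / 16) (hη : 0 ≤ η) (hη1 : 2 * η ≤ 1) :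
    ∫ y in slab s L (2 * η) \ slab s L η, ‖bernoulliProd s p L y‖ ≤
      gaussMass (precision s (bernoulliVar p) L) *
        (s.card * (2 * Real.exp (-η ^ 2 / (4 * v)))) := by
  set H := precision s (bernoulliVar p) L with hHd
  set t : ℝ := (2 * η) ^ 2 / 9 with ht
  have ht0 : 0 ≤ t := by positivity
  have ht1 : t ≤ 1 / 9 := by rw [ht]; nlinarith
  have hpd : ((1 - t) • H).PosDef := hH.smul (by linarith)
  have hmS : MeasurableSet (slab s L (2 * η) \ slab s L η) :=
    (measurableSet_slab _ _ _).diff (measurableSet_slab _ _ _)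
  have hint := integrable_exp_neg_quadForm hpd
  calc ∫ y in slab s L (2 * η) \ slab s L η, ‖bernoulliProd s p L y‖
      ≤ ∫ y in slab s L (2 * η) \ slab s L η, Real.exp (-(y ⬝ᵥ ((1 - t) • H) *ᵥ y) / 2) := by
        refine setIntegral_mono_on ?_ hint.integrableOn hmS fun y hy =>
          norm_bernoulliProd_le hp hη1 hy.1
        refine Integrable.mono' hint.integrableOn
          (continuous_bernoulliProd s p L).norm.aestronglyMeasurable ?_
        refine (ae_restrict_iff' hmS).2 (ae_of_all _ fun y hy => ?_)
        rw [norm_norm]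
        exact norm_bernoulliProd_le hp hη1 hy.1
    _ ≤ ∫ y in (slab s L η)ᶜ, Real.exp (-(y ⬝ᵥ ((1 - t) • H) *ᵥ y) / 2) := by
        refine setIntegral_mono_set hint.integrableOn (ae_of_all _ fun y => (Real.exp_pos _).le) ?_
        exact ae_of_all _ fun y hy => hy.2
    _ = gaussMass ((1 - t) • H) * (gaussMeasure ((1 - t) • H)).real (slab s L η)ᶜ :=
        setIntegral_exp_neg_quadForm hpd (measurableSet_slab _ _ _).compl
    _ ≤ (Real.exp (Fintype.card κ * t) * gaussMass H) *
          (s.card * (2 * Real.exp (-((1 - t) * η ^ 2) / (2 * v)))) := by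
        have := gaussMass_pos hH
        gcongr
        · exact gaussMass_smul_le hH ht0 (by linarith)
        · exact gaussMeasure_compl_slab_le hH hv0 (by linarith) hv hη
    _ = gaussMass H * (s.card * (2 * (Real.exp (Fintype.card κ * t) *
          Real.exp (-((1 - t) * η ^ 2) / (2 * v))))) := by ring
    _ ≤ _ := by
        have := gaussMass_pos hH
        rw [← Real.exp_add]
        gcongr
        have e : -η ^ 2 / (4 * v) - (Fintype.card κ * t + -((1 - t) * η ^ 2) / (2 * v)) =
            η ^ 2 * ((1 - t) / 2 - 1 / 4 - 4 / 9 * (Fintype.card κ * v)) / v := by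
          rw [ht]; field_simp; ring
        have h0 : 0 ≤ η ^ 2 * ((1 - t) / 2 - 1 / 4 - 4 / 9 * (Fintype.card κ * v)) / v := by
          refine div_nonneg (mul_nonneg (sq_nonneg _) ?_) hv0.le
          linarith
        linarith

/-- The contribution of everything between the central slab of width `2⁻ᵏ` and the slab of
width `1`. -/
lemma integral_slab_sub_slab_le (hp : ∀ e ∈ s, 0 < p e ∧ p e < 1)
    (hH : (precision s (bernoulliVar p) L).PosDef) {v : ℝ} (hv0 : 0 < v)
    (hv : ∀ e ∈ s, ∀ y, (L e ⬝ᵥ y) ^ 2 ≤ v * (y ⬝ᵥ precision s (bernoulliVar p) L *ᵥ y))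
    (hnv : Fintype.card κ * v ≤ 1 / 16) (k : ℕ) :
    ∫ y in slab s L 1 \ slab s L ((1 / 2) ^ k), ‖bernoulliProd s p L y‖ ≤
      k * (gaussMass (precision s (bernoulliVar p) L) *
        (s.card * (2 * Real.exp (-((1 / 2) ^ k) ^ 2 / (4 * v))))) := by
  set H := precision s (bernoulliVar p) L with hHd
  have hG := gaussMass_pos hH
  have hintU : IntegrableOn (fun y => ‖bernoulliProd s p L y‖) (slab s L 1) := by
    have hpd : ((1 - (1 : ℝ) ^ 2 / 9) • H).PosDef := hH.smul (by norm_num)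
    refine Integrable.mono' (integrable_exp_neg_quadForm hpd).integrableOn
      (continuous_bernoulliProd s p L).norm.aestronglyMeasurable ?_
    refine (ae_restrict_iff' (measurableSet_slab _ _ _)).2 (ae_of_all _ fun y hy => ?_)
    rw [norm_norm]
    exact norm_bernoulliProd_le hp le_rfl hy
  have hsub : ∀ k : ℕ, slab s L ((1 / 2) ^ k) ⊆ slab s L 1 := fun k y hy e he =>
    (hy e he).trans (pow_le_one₀ (by norm_num) (by norm_num))
  induction k with
  | zero => simp
  | succ k ih =>
    have h2 : 2 * ((1 : ℝ) / 2) ^ (k + 1) = (1 / 2) ^ k := by rw [pow_succ]; ring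
    have hsh := integral_shell_le hp hH hv0 hv hnv (η := (1 / 2) ^ (k + 1)) (by positivity)
      (by rw [h2]; exact pow_le_one₀ (by norm_num) (by norm_num))
    rw [h2] at hsh
    have hle : ((1 : ℝ) / 2) ^ (k + 1) ≤ (1 / 2) ^ k :=
      pow_le_pow_of_le_one (by norm_num) (by norm_num) (Nat.le_succ k)
    have hsplit : slab s L 1 \ slab s L ((1 / 2) ^ (k + 1)) =
        (slab s L 1 \ slab s L ((1 / 2) ^ k)) ∪
          (slab s L ((1 / 2) ^ k) \ slab s L ((1 / 2) ^ (k + 1))) := by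
      have h3 : slab s L ((1 / 2) ^ (k + 1)) ⊆ slab s L ((1 / 2) ^ k) :=
        fun y hy e he => (hy e he).trans hle
      ext y
      have h4 := @hsub k y
      have h5 := @h3 y
      simp only [Set.mem_sdiff, Set.mem_union]
      tauto
    have hdisj : Disjoint (slab s L 1 \ slab s L ((1 / 2) ^ k))
        (slab s L ((1 / 2) ^ k) \ slab s L ((1 / 2) ^ (k + 1))) :=
      Set.disjoint_left.2 fun y h h' => h.2 h'.1
    rw [hsplit, setIntegral_union hdisj ((measurableSet_slab _ _ _).diff (measurableSet_slab _ _ _))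
      (hintU.mono_set Set.sdiff_subset) (hintU.mono_set (Set.sdiff_subset.trans (hsub k)))]
    have hmono : Real.exp (-((1 / 2 : ℝ) ^ k) ^ 2 / (4 * v)) ≤
        Real.exp (-((1 / 2 : ℝ) ^ (k + 1)) ^ 2 / (4 * v)) := by
      gcongr
    calc _ ≤ k * (gaussMass H * (s.card * (2 * Real.exp (-((1 / 2) ^ k) ^ 2 / (4 * v))))) +
          gaussMass H * (s.card * (2 * Real.exp (-((1 / 2) ^ (k + 1)) ^ 2 / (4 * v)))) :=
          add_le_add ih hsh
      _ ≤ k * (gaussMass H * (s.card * (2 * Real.exp (-((1 / 2) ^ (k + 1)) ^ 2 / (4 * v))))) +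
          gaussMass H * (s.card * (2 * Real.exp (-((1 / 2) ^ (k + 1)) ^ 2 / (4 * v)))) := by
          gcongr
      _ = _ := by push_cast; ring

end

/-! ### Laplace's method near the origin -/

section

open MeasureTheory ProbabilityTheory Matrix
open scoped NNReal ENNReal

variable {κ E : Type*} [Fintype κ] [DecidableEq κ]
variable {s : Finset E} {p : E → ℝ} {L : E → κ → ℝ}

/-- The third order term in the cumulant expansion of `log (bernoulliProd s p L)` is `-i` times this
real cubic form. -/
def cubicForm (s : Finset E) (p : E → ℝ) (L : E → κ → ℝ) (y : κ → ℝ) : ℝ :=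
  ∑ e ∈ s, bernoulliVar p e * (1 - 2 * p e) / 6 * (L e ⬝ᵥ y) ^ 3

omit [DecidableEq κ] in
lemma continuous_cubicForm (s : Finset E) (p : E → ℝ) (L : E → κ → ℝ) :
    Continuous (cubicForm s p L) := by
  unfold cubicForm
  fun_prop

omit [DecidableEq κ] in
lemma cubicForm_neg (y : κ → ℝ) : cubicForm s p L (-y) = -cubicForm s p L y := by
  simp only [cubicForm, dotProduct_neg, ← Finset.sum_neg_distrib]
  exact Finset.sum_congr rfl fun e _ => by ring

lemma norm_exp_mul_I_sub_le (x : ℝ) :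
    ‖Complex.exp (x * Complex.I) - 1 - x * Complex.I‖ ≤ 2 * x ^ 2 := by
  have hn : ‖(x * Complex.I : ℂ)‖ = |x| := by simp
  rcases le_total |x| 1 with h | h
  · have := Complex.norm_exp_sub_one_sub_id_le (x := x * Complex.I) (by rwa [hn])
    rw [hn, sq_abs] at this
    linarith [sq_nonneg x]
  · have h1 : ‖Complex.exp (x * Complex.I) - 1‖ ≤ |x| := by
      have := Real.norm_exp_I_mul_ofReal_sub_one_le (x := x)
      rwa [mul_comm, Real.norm_eq_abs] at this
    have h2 := norm_sub_le (Complex.exp (x * Complex.I) - 1) (x * Complex.I)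
    rw [hn] at h2
    nlinarith [sq_abs x]

open Complex in
omit [DecidableEq κ] in
/-- The pointwise comparison in the central slab: apart from an odd cubic term, the
characteristic function agrees with the Gaussian weight up to the quartic form and the square of
the cubic form. -/
lemma norm_bernoulliProd_sub_le (hp : ∀ e ∈ s, 0 < p e ∧ p e < 1) {η : ℝ} (hη1 : η ≤ 1) {y : κ → ℝ}
    (hy : y ∈ slab s L η) :
    ‖bernoulliProd s p L y - Real.exp (-(y ⬝ᵥ precision s (bernoulliVar p) L *ᵥ y) / 2)
        * (1 - cubicForm s p L y * I)‖ ≤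
      4 * (Real.exp (-(y ⬝ᵥ ((1 - 8 * η ^ 2) • precision s (bernoulliVar p) L) *ᵥ y) / 2) *
        ∑ e ∈ s, bernoulliVar p e * (L e ⬝ᵥ y) ^ 4) +
      Real.exp (-(y ⬝ᵥ precision s (bernoulliVar p) L *ᵥ y) / 2) * (2 * cubicForm s p L y ^ 2) := by
  classical
  set H := precision s (bernoulliVar p) L with hHd
  set S4 := ∑ e ∈ s, bernoulliVar p e * (L e ⬝ᵥ y) ^ 4 with hS4
  set c := cubicForm s p L y with hc
  have hw : ∀ e ∈ s, 0 < bernoulliVar p e := fun e he =>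
    mul_pos (hp e he).1 (by linarith [(hp e he).2])
  have hex : ∀ e : E, ∃ ρ : ℂ, e ∈ s → ‖ρ‖ ≤ 4 * (bernoulliVar p e * (L e ⬝ᵥ y) ^ 4) ∧
      bernoulliChar (p e) (L e ⬝ᵥ y) = exp (-(p e * (1 - p e) * (L e ⬝ᵥ y) ^ 2 / 2 : ℝ)
        - (p e * (1 - p e) * (1 - 2 * p e) / 6 * (L e ⬝ᵥ y) ^ 3 : ℝ) * I) * (1 + ρ) := by
    intro e
    by_cases he : e ∈ s
    · obtain ⟨ρ, h⟩ := exists_bernoulliChar_eq (hp e he).1 (hp e he).2 ((hy e he).trans hη1)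
      exact ⟨ρ, fun _ => h⟩
    · exact ⟨0, fun h => absurd h he⟩
  choose ρ hρ using hex
  have hQ : y ⬝ᵥ H *ᵥ y = ∑ e ∈ s, bernoulliVar p e * (L e ⬝ᵥ y) ^ 2 := by
    rw [hHd, dotProduct_precision_mulVec]
    exact Finset.sum_congr rfl fun e _ => by ring
  have hF : bernoulliProd s p L y = Real.exp (-(y ⬝ᵥ H *ᵥ y) / 2) * exp ((-c : ℝ) * I)
      * ∏ e ∈ s, (1 + ρ e) := by
    rw [bernoulliProd, Finset.prod_congr rfl fun e he => (hρ e he).2, Finset.prod_mul_distrib,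
      ← Complex.exp_sum, ofReal_exp, ← Complex.exp_add]
    congr 2
    rw [hQ, hc, cubicForm, Finset.sum_sub_distrib, ← Finset.sum_mul]
    push_cast
    rw [← Finset.sum_neg_distrib, Finset.sum_div, neg_mul, sub_eq_add_neg]
    congr 1
    · exact Finset.sum_congr rfl fun e _ => by rw [bernoulliVar]; push_cast; ring
    · simp only [bernoulliVar]; push_cast; rfl
  have hS40 : 0 ≤ S4 := Finset.sum_nonneg fun e he => by have := hw e he; positivity
  have hprod : ‖∏ e ∈ s, (1 + ρ e) - 1‖ ≤ 4 * S4 * Real.exp (4 * S4) := by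
    refine (Finset.norm_prod_one_add_sub_one_le s ρ).trans ?_
    have h1 : ∑ e ∈ s, ‖ρ e‖ ≤ 4 * S4 := by
      rw [hS4, Finset.mul_sum]; exact Finset.sum_le_sum fun e he => (hρ e he).1
    have h2 : Real.exp (∑ e ∈ s, ‖ρ e‖) ≤ Real.exp (4 * S4) := Real.exp_le_exp.2 h1
    have h3 := Real.add_one_le_exp (-(4 * S4))
    have h4 : Real.exp (-(4 * S4)) * Real.exp (4 * S4) = 1 := by rw [← Real.exp_add]; simp
    nlinarith [Real.exp_pos (4 * S4)]
  have hS4Q : S4 ≤ η ^ 2 * (y ⬝ᵥ H *ᵥ y) := by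
    rw [hQ, hS4, Finset.mul_sum]
    refine Finset.sum_le_sum fun e he => ?_
    have h1 : (L e ⬝ᵥ y) ^ 2 ≤ η ^ 2 := by
      rw [← sq_abs]; have := hy e he; gcongr
    have h2 := hw e he
    calc bernoulliVar p e * (L e ⬝ᵥ y) ^ 4
        = (L e ⬝ᵥ y) ^ 2 * (bernoulliVar p e * (L e ⬝ᵥ y) ^ 2) := by ring
      _ ≤ _ := by gcongr
  have hexp : Real.exp (-(y ⬝ᵥ H *ᵥ y) / 2) * Real.exp (4 * S4) ≤
      Real.exp (-(y ⬝ᵥ ((1 - 8 * η ^ 2) • H) *ᵥ y) / 2) := by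
    rw [← Real.exp_add, smul_mulVec, dotProduct_smul, smul_eq_mul]
    refine Real.exp_le_exp.2 ?_
    linarith
  have hdec : bernoulliProd s p L y - Real.exp (-(y ⬝ᵥ H *ᵥ y) / 2) * (1 - c * I) =
      Real.exp (-(y ⬝ᵥ H *ᵥ y) / 2) * (exp ((-c : ℝ) * I) * (∏ e ∈ s, (1 + ρ e) - 1))
      + Real.exp (-(y ⬝ᵥ H *ᵥ y) / 2) * (exp ((-c : ℝ) * I) - 1 - (-c : ℝ) * I) := by
    rw [hF]; push_cast; ring
  rw [hdec]
  refine (norm_add_le _ _).trans ?_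
  have hn1 : ‖((Real.exp (-(y ⬝ᵥ H *ᵥ y) / 2) : ℝ) : ℂ)‖ = Real.exp (-(y ⬝ᵥ H *ᵥ y) / 2) := by
    rw [norm_real, Real.norm_of_nonneg (Real.exp_pos _).le]
  rw [norm_mul, norm_mul, norm_mul, hn1, norm_exp_ofReal_mul_I, one_mul]
  have hE := Real.exp_pos (-(y ⬝ᵥ H *ᵥ y) / 2)
  have h5 := norm_exp_mul_I_sub_le (-c)
  calc _ ≤ Real.exp (-(y ⬝ᵥ H *ᵥ y) / 2) * (4 * S4 * Real.exp (4 * S4))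
        + Real.exp (-(y ⬝ᵥ H *ᵥ y) / 2) * (2 * (-c) ^ 2) := by gcongr
    _ = 4 * ((Real.exp (-(y ⬝ᵥ H *ᵥ y) / 2) * Real.exp (4 * S4)) * S4)
        + Real.exp (-(y ⬝ᵥ H *ᵥ y) / 2) * (2 * c ^ 2) := by ring
    _ ≤ _ := by gcongr

lemma integrable_cubicForm (hH : (precision s (bernoulliVar p) L).PosDef) :
    Integrable (cubicForm s p L) (gaussMeasure (precision s (bernoulliVar p) L)) :=
  integrable_finsetSum _ fun _ _ => (integrable_dotProduct_pow hH _ 3).const_mul _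

lemma integrable_cubicForm_sq (hH : (precision s (bernoulliVar p) L).PosDef) :
    Integrable (fun y => cubicForm s p L y ^ 2)
      (gaussMeasure (precision s (bernoulliVar p) L)) := by
  have e1 : ∀ y : κ → ℝ, cubicForm s p L y ^ 2 = ∑ e ∈ s, ∑ f ∈ s,
      (bernoulliVar p e * (1 - 2 * p e) / 6) * (bernoulliVar p f * (1 - 2 * p f) / 6)
        * ((L e ⬝ᵥ y) ^ 3 * (L f ⬝ᵥ y) ^ 3) := by
    intro y
    rw [cubicForm, sq, Finset.sum_mul_sum]
    refine Finset.sum_congr rfl fun e _ => Finset.sum_congr rfl fun f _ => by ring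
  simp_rw [e1]
  exact integrable_finsetSum _ fun e _ => integrable_finsetSum _ fun f _ =>
    (integrable_dotProduct_cube_mul_cube hH _ _).const_mul _

/-- The quartic form integrated against a slightly wider Gaussian. -/
lemma integral_quartic_le (hp : ∀ e ∈ s, 0 < p e ∧ p e < 1)
    (hH : (precision s (bernoulliVar p) L).PosDef) {v t : ℝ} (hv0 : 0 < v)
    (hv : ∀ e ∈ s, ∀ y, (L e ⬝ᵥ y) ^ 2 ≤ v * (y ⬝ᵥ precision s (bernoulliVar p) L *ᵥ y))
    (ht0 : 0 ≤ t) (ht : t ≤ 1 / 2) (hnt : Fintype.card κ * t ≤ 1 / 2) :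
    Integrable (fun y => Real.exp (-(y ⬝ᵥ ((1 - t) • precision s (bernoulliVar p) L) *ᵥ y) / 2) *
        ∑ e ∈ s, bernoulliVar p e * (L e ⬝ᵥ y) ^ 4) ∧
    ∫ y, Real.exp (-(y ⬝ᵥ ((1 - t) • precision s (bernoulliVar p) L) *ᵥ y) / 2) *
        ∑ e ∈ s, bernoulliVar p e * (L e ⬝ᵥ y) ^ 4
      ≤ gaussMass (precision s (bernoulliVar p) L) * (24 * (Fintype.card κ * v)) := by
  set H := precision s (bernoulliVar p) L with hHd
  have h1 : 0 < 1 - t := by linarith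
  have hG := gaussMass_pos hH
  have hpd : ((1 - t) • H).PosDef := hH.smul h1
  have hsm : (1 - t) • H = precision s (fun e => (1 - t) * bernoulliVar p e) L := by
    simp [hHd, precision, Finset.smul_sum, smul_smul]
  have hpd' := hpd
  rw [hsm] at hpd'
  have hI : Integrable (fun y => ∑ e ∈ s, bernoulliVar p e * (L e ⬝ᵥ y) ^ 4)
      (gaussMeasure ((1 - t) • H)) :=
    integrable_finsetSum _ fun e _ => (integrable_dotProduct_pow hpd _ 4).const_mul _
  refine ⟨(integrable_gaussMeasure_iff hpd _).1 hI, ?_⟩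
  have hw : ∀ e ∈ s, 0 < (1 - t) * bernoulliVar p e := fun e he =>
    mul_pos h1 (mul_pos (hp e he).1 (by linarith [(hp e he).2]))
  have h4 := integral_weighted_fourth_le hpd' hw (v := v / (1 - t)) (fun e he =>
    variance_le hpd' (by positivity) fun y => by
      rw [← hsm, smul_mulVec, dotProduct_smul, smul_eq_mul, ← mul_assoc, div_mul_cancel₀ _ h1.ne']
      exact hv e he y)
  rw [← hsm] at h4
  have h5 : ∫ y, ∑ e ∈ s, (1 - t) * bernoulliVar p e * (L e ⬝ᵥ y) ^ 4 ∂(gaussMeasure ((1 - t) • H))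
      = (1 - t) *
        ∫ y, ∑ e ∈ s, bernoulliVar p e * (L e ⬝ᵥ y) ^ 4 ∂(gaussMeasure ((1 - t) • H)) := by
    rw [← integral_const_mul]
    simp only [Finset.mul_sum, mul_assoc]
  have h6 := integral_gaussMeasure hpd (fun y => ∑ e ∈ s, bernoulliVar p e * (L e ⬝ᵥ y) ^ 4)
  simp only [smul_eq_mul] at h6
  have hG' := gaussMass_pos hpd
  rw [h5, h6, ← mul_assoc, mul_comm (1 - t), mul_assoc, inv_mul_le_iff₀ hG'] at h4
  set J := ∫ y, Real.exp (-(y ⬝ᵥ ((1 - t) • H) *ᵥ y) / 2) *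
        ∑ e ∈ s, bernoulliVar p e * (L e ⬝ᵥ y) ^ 4
  have h7 : gaussMass ((1 - t) • H) ≤ 2 * gaussMass H := by
    refine (gaussMass_smul_le hH ht0 ht).trans ?_
    gcongr
    calc Real.exp (Fintype.card κ * t) ≤ Real.exp (1 / 2) := Real.exp_le_exp.2 hnt
      _ ≤ 2 := by
        rw [← Real.le_log_iff_exp_le (by norm_num)]
        linarith [Real.log_two_gt_d9]
  have h8 : v / (1 - t) ≤ 2 * v := by
    rw [div_le_iff₀ h1]; nlinarith
  have h9 : (1 - t) * J ≤ 2 * gaussMass H * (3 * Fintype.card κ * (2 * v)) := by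
    refine h4.trans ?_
    gcongr
  have h10 : 0 ≤ gaussMass H * (Fintype.card κ * v) := by positivity
  nlinarith

omit [DecidableEq κ] in
/-- The cubic term does not contribute, being odd. -/
lemma setIntegral_exp_mul_cubicForm_eq_zero (H : Matrix κ κ ℝ) (η : ℝ) :
    ∫ y in slab s L η, Real.exp (-(y ⬝ᵥ H *ᵥ y) / 2) * cubicForm s p L y = 0 := by
  rw [← integral_indicator (measurableSet_slab _ _ _)]
  set f := (slab s L η).indicator (fun y => Real.exp (-(y ⬝ᵥ H *ᵥ y) / 2) * cubicForm s p L y)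
  have h : ∀ y, f (-y) = -f y := by
    intro y
    have hiff : -y ∈ slab s L η ↔ y ∈ slab s L η := by simp [slab]
    by_cases hy : y ∈ slab s L η
    · simp only [f, Set.indicator_of_mem hy, Set.indicator_of_mem (hiff.2 hy), cubicForm_neg,
        mulVec_neg, neg_dotProduct, dotProduct_neg, neg_neg]
      ring
    · simp only [f, Set.indicator_of_notMem hy, Set.indicator_of_notMem (mt hiff.1 hy), neg_zero]
  have h2 := integral_neg_eq_self f volume
  simp_rw [h] at h2
  rw [integral_neg] at h2
  linarith

/-- The central slab carries the Gaussian mass, up to a relative error of order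
`card κ * v` and the Gaussian tail. -/
lemma norm_integral_slab_sub_le (hp : ∀ e ∈ s, 0 < p e ∧ p e < 1)
    (hH : (precision s (bernoulliVar p) L).PosDef) {v η : ℝ} (hv0 : 0 < v)
    (hv : ∀ e ∈ s, ∀ y, (L e ⬝ᵥ y) ^ 2 ≤ v * (y ⬝ᵥ precision s (bernoulliVar p) L *ᵥ y))
    (hη : 0 ≤ η) (hη1 : 16 * η ^ 2 * Fintype.card κ ≤ 1) (hη2 : 4 * η ≤ 1) :
    ‖(∫ y in slab s L η, bernoulliProd s p L y) - gaussMass (precision s (bernoulliVar p) L)‖ ≤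
      gaussMass (precision s (bernoulliVar p) L) * (126 * (Fintype.card κ * v)
        + s.card * (2 * Real.exp (-η ^ 2 / (2 * v)))) := by
  set H := precision s (bernoulliVar p) L with hHd
  have hG := gaussMass_pos hH
  have hmS := measurableSet_slab s L η
  set S := slab s L η with hS
  have hw : ∀ e ∈ s, 0 < bernoulliVar p e := fun e he =>
    mul_pos (hp e he).1 (by linarith [(hp e he).2])
  have h8 : 8 * η ^ 2 ≤ 1 / 2 := by nlinarith
  obtain ⟨hI4, hB4⟩ := integral_quartic_le hp hH hv0 hv (t := 8 * η ^ 2) (by positivity) h8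
    (by linarith)
  have hIc2 := (integrable_gaussMeasure_iff hH _).1 (integrable_cubicForm_sq hH)
  have hIc := (integrable_gaussMeasure_iff hH _).1 (integrable_cubicForm hH)
  simp only [smul_eq_mul] at hIc2 hIc
  have hIe := integrable_exp_neg_quadForm hH
  have hBc : ∫ y, Real.exp (-(y ⬝ᵥ H *ᵥ y) / 2) * cubicForm s p L y ^ 2
      ≤ gaussMass H * (15 * Fintype.card κ * v) := by
    have h1 := integral_cubic_sq_le hH hw (v := v)
      (fun e he => variance_le hH hv0.le (hv e he))
      (fun e => bernoulliVar p e * (1 - 2 * p e) / 6) (fun e he => by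
        have h2 := hw e he
        have h3 := hp e he
        rw [abs_le]
        constructor <;> nlinarith)
    have h2 := integral_gaussMeasure hH (fun y => cubicForm s p L y ^ 2)
    simp only [smul_eq_mul] at h2
    change ∫ y, cubicForm s p L y ^ 2 ∂(gaussMeasure H) ≤ _ at h1
    rwa [h2, inv_mul_le_iff₀ hG] at h1
  set B : (κ → ℝ) → ℝ := fun y =>
    4 * (Real.exp (-(y ⬝ᵥ ((1 - 8 * η ^ 2) • H) *ᵥ y) / 2) *
        ∑ e ∈ s, bernoulliVar p e * (L e ⬝ᵥ y) ^ 4) +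
      2 * (Real.exp (-(y ⬝ᵥ H *ᵥ y) / 2) * cubicForm s p L y ^ 2) with hB
  have hIB : Integrable B := (hI4.const_mul 4).add (hIc2.const_mul 2)
  set g : (κ → ℝ) → ℂ := fun y =>
    Real.exp (-(y ⬝ᵥ H *ᵥ y) / 2) * (1 - cubicForm s p L y * Complex.I) with hg
  have hgeq : ∀ y, g y = ((Real.exp (-(y ⬝ᵥ H *ᵥ y) / 2) : ℝ) : ℂ)
      - ((Real.exp (-(y ⬝ᵥ H *ᵥ y) / 2) * cubicForm s p L y : ℝ) : ℂ) * Complex.I := by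
    intro y; simp only [hg]; push_cast; ring
  have hIg : IntegrableOn g S := by
    refine Integrable.integrableOn ?_
    have h := hIe.ofReal (𝕜 := ℂ) |>.sub ((hIc.ofReal (𝕜 := ℂ)).mul_const Complex.I)
    exact h.congr (ae_of_all _ fun y => (hgeq y).symm)
  have hpt : ∀ y ∈ S, ‖bernoulliProd s p L y - g y‖ ≤ B y := by
    intro y hy
    refine (norm_bernoulliProd_sub_le hp (by linarith) hy).trans (le_of_eq ?_)
    rw [hB]; ring
  have hcont : Continuous (fun y => bernoulliProd s p L y - g y) := by
    have h1 := continuous_bernoulliProd s p L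
    have h2 := continuous_cubicForm s p L
    simp only [hg]
    fun_prop
  have hID : IntegrableOn (fun y => bernoulliProd s p L y - g y) S :=
    Integrable.mono' hIB.integrableOn hcont.aestronglyMeasurable
      ((ae_restrict_iff' hmS).2 (ae_of_all _ hpt))
  have hsplit : ∫ y in S, bernoulliProd s p L y =
      (∫ y in S, (bernoulliProd s p L y - g y)) + ∫ y in S, g y := by
    rw [← integral_add hID hIg]
    simp
  have hgS : ∫ y in S, g y = ((gaussMass H * (gaussMeasure H).real S : ℝ) : ℂ) := by
    simp_rw [hgeq]
    have h1 : Integrable (fun y => ((Real.exp (-(y ⬝ᵥ H *ᵥ y) / 2) : ℝ) : ℂ))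
      (volume.restrict S) := hIe.ofReal.restrict
    have h2 : Integrable (fun y => ((Real.exp (-(y ⬝ᵥ H *ᵥ y) / 2) * cubicForm s p L y : ℝ) : ℂ)
      * Complex.I) (volume.restrict S) := (hIc.ofReal.mul_const Complex.I).restrict
    rw [integral_sub h1 h2,
      integral_mul_const, integral_complex_ofReal, integral_complex_ofReal,
      setIntegral_exp_mul_cubicForm_eq_zero, setIntegral_exp_neg_quadForm hH hmS]
    simp
  have hprob := isProbabilityMeasure_gaussMeasure hH
  have hcompl : (gaussMeasure H).real S = 1 - (gaussMeasure H).real Sᶜ := by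
    rw [probReal_compl_eq_one_sub hmS]; ring
  have htail : (gaussMeasure H).real Sᶜ ≤ s.card * (2 * Real.exp (-η ^ 2 / (2 * v))) := by
    have := gaussMeasure_compl_slab_le hH (t := 1) hv0 one_pos hv hη
    simpa using this
  have hfin : (∫ y in S, bernoulliProd s p L y) - gaussMass H =
      (∫ y in S, (bernoulliProd s p L y - g y))
        - ((gaussMass H * (gaussMeasure H).real Sᶜ : ℝ) : ℂ) := by
    rw [hsplit, hgS, hcompl]; push_cast; ring
  rw [hfin]
  refine (norm_sub_le _ _).trans ?_
  rw [Complex.norm_real, Real.norm_of_nonneg (by positivity), mul_add]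
  refine add_le_add ?_ (by gcongr)
  calc ‖∫ y in S, (bernoulliProd s p L y - g y)‖
      ≤ ∫ y in S, B y := norm_integral_le_of_norm_le hIB.integrableOn
        ((ae_restrict_iff' hmS).2 (ae_of_all _ hpt))
    _ ≤ ∫ y, B y := by
        refine setIntegral_le_integral hIB (ae_of_all _ fun y => ?_)
        have : 0 ≤ ∑ e ∈ s, bernoulliVar p e * (L e ⬝ᵥ y) ^ 4 :=
          Finset.sum_nonneg fun e he => by have := hw e he; positivity
        simp only [hB, Pi.zero_apply]
        positivity
    _ = 4 * (∫ y, Real.exp (-(y ⬝ᵥ ((1 - 8 * η ^ 2) • H) *ᵥ y) / 2) *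
          ∑ e ∈ s, bernoulliVar p e * (L e ⬝ᵥ y) ^ 4)
        + 2 * ∫ y, Real.exp (-(y ⬝ᵥ H *ᵥ y) / 2) * cubicForm s p L y ^ 2 := by
        rw [hB, integral_add (hI4.const_mul 4) (hIc2.const_mul 2), integral_const_mul,
          integral_const_mul]
    _ ≤ 4 * (gaussMass H * (24 * (Fintype.card κ * v)))
        + 2 * (gaussMass H * (15 * Fintype.card κ * v)) := by gcongr
    _ = _ := by ring

/-- The integral of the characteristic function over the slab of width `1` is the Gaussian mass, up
to a relative error of order `card κ * v`. -/
theorem norm_integral_slab_one_sub_le (hp : ∀ e ∈ s, 0 < p e ∧ p e < 1)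
    (hH : (precision s (bernoulliVar p) L).PosDef) {v : ℝ} (hv0 : 0 < v)
    (hv : ∀ e ∈ s, ∀ y, (L e ⬝ᵥ y) ^ 2 ≤ v * (y ⬝ᵥ precision s (bernoulliVar p) L *ᵥ y))
    (hn : 0 < Fintype.card κ) (hnv : Fintype.card κ * v ≤ 1 / 16) :
    ‖(∫ y in slab s L 1, bernoulliProd s p L y) - gaussMass (precision s (bernoulliVar p) L)‖ ≤
      gaussMass (precision s (bernoulliVar p) L) * (126 * (Fintype.card κ * v)
        + 130 * Fintype.card κ * s.card * Real.exp (-1 / (256 * (Fintype.card κ * v)))) := by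
  set H := precision s (bernoulliVar p) L with hHd
  have hG := gaussMass_pos hH
  have hn1 : (1 : ℝ) ≤ Fintype.card κ := by exact_mod_cast hn
  set n : ℝ := (Fintype.card κ : ℝ) with hnd
  -- the least `k` with `16 n ≤ 4ᵏ`, so that `4ᵏ < 64 n`
  obtain ⟨k, hk1, hk2⟩ : ∃ k : ℕ, 16 * n ≤ 4 ^ k ∧ (4 : ℝ) ^ k ≤ 64 * n := by
    obtain ⟨k, hk1, hk2⟩ := exists_nat_pow_near (x := 16 * n) (y := 4) (by linarith) (by norm_num)
    exact ⟨k + 1, hk2.le, by rw [pow_succ]; linarith⟩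
  have hk4 : (k : ℝ) ≤ 64 * n := by
    refine le_trans ?_ hk2
    have : k < 4 ^ k := Nat.lt_pow_self (by norm_num)
    exact_mod_cast this.le
  set η : ℝ := (1 / 2) ^ k with hη
  have hη0 : 0 < η := by positivity
  have hη4 : η ^ 2 * 4 ^ k = 1 := by
    rw [hη, ← pow_mul, mul_comm k 2, pow_mul, ← mul_pow]; norm_num
  have hη1 : 16 * η ^ 2 * n ≤ 1 := by nlinarith [sq_nonneg η]
  have hη2 : 4 * η ≤ 1 := by
    have : (4 * η) ^ 2 ≤ 1 ^ 2 := by nlinarith [sq_nonneg η]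
    exact le_of_sq_le_sq this (by norm_num)
  have hη3 : 1 ≤ η ^ 2 * (64 * n) := by nlinarith [sq_nonneg η]
  have hA := norm_integral_slab_sub_le hp hH hv0 hv hη0.le hη1 hη2
  have hB := integral_slab_sub_slab_le hp hH hv0 hv hnv k
  rw [← hη, ← hHd] at hB
  rw [← hnd, ← hHd] at hA
  have hsub : slab s L η ⊆ slab s L 1 := fun y hy e he => (hy e he).trans (by linarith)
  have hintU : IntegrableOn (bernoulliProd s p L) (slab s L 1) := by
    have hpd : ((1 - (1 : ℝ) ^ 2 / 9) • H).PosDef := hH.smul (by norm_num)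
    refine Integrable.mono' (integrable_exp_neg_quadForm hpd).integrableOn
      (continuous_bernoulliProd s p L).aestronglyMeasurable ?_
    exact (ae_restrict_iff' (measurableSet_slab _ _ _)).2
      (ae_of_all _ fun y hy => norm_bernoulliProd_le hp le_rfl hy)
  have hsplit : ∫ y in slab s L 1, bernoulliProd s p L y =
      (∫ y in slab s L 1 \ slab s L η, bernoulliProd s p L y)
        + ∫ y in slab s L η, bernoulliProd s p L y := by
    rw [← setIntegral_union Set.disjoint_sdiff_left (measurableSet_slab _ _ _)
      (hintU.mono_set Set.sdiff_subset) (hintU.mono_set hsub), Set.sdiff_union_of_subset hsub]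
  set X := Real.exp (-1 / (256 * (n * v))) with hX
  have hX1 : Real.exp (-η ^ 2 / (4 * v)) ≤ X := by
    refine Real.exp_le_exp.2 ?_
    rw [neg_div, neg_div, neg_le_neg_iff, div_le_div_iff₀ (by positivity) (by positivity)]
    nlinarith
  have hX2 : Real.exp (-η ^ 2 / (2 * v)) ≤ X := by
    refine le_trans (Real.exp_le_exp.2 ?_) hX1
    rw [neg_div, neg_div, neg_le_neg_iff]
    gcongr
    norm_num
  rw [hsplit, add_sub_assoc]
  refine (norm_add_le _ _).trans ?_
  calc _ ≤ k * (gaussMass H * (s.card * (2 * Real.exp (-η ^ 2 / (4 * v)))))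
        + gaussMass H * (126 * (n * v) + s.card * (2 * Real.exp (-η ^ 2 / (2 * v)))) :=
        add_le_add ((norm_integral_le_integral_norm _).trans hB) hA
    _ ≤ (64 * n) * (gaussMass H * (s.card * (2 * X)))
        + gaussMass H * (126 * (n * v) + s.card * (2 * X)) := by gcongr
    _ = gaussMass H * (126 * (n * v) + (128 * n + 2 * 1) * s.card * X) := by ring
    _ ≤ gaussMass H * (126 * (n * v) + (128 * n + 2 * n) * s.card * X) := by gcongr
    _ = _ := by ring

end

/-! ### Counting `r`-sets -/

section

open Matrix

section Counting

variable {n r : ℕ}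

lemma mem_rSets {W : Finset (Fin n)} : W ∈ rSets n r ↔ W.card = r := by
  simp [rSets]

lemma card_rSets (n r : ℕ) : (rSets n r).card = n.choose r := by
  simp [rSets]

lemma card_rSets_superset (T : Finset (Fin n)) (hT : T.card ≤ r) :
    (rSets n r |>.filter (T ⊆ ·)).card = (n - T.card).choose (r - T.card) := by
  have h1 : (Finset.powersetCard (r - T.card) (Finset.univ \ T)).card
      = (n - T.card).choose (r - T.card) := by
    rw [Finset.card_powersetCard, Finset.card_sdiff_of_subset (Finset.subset_univ _)]
    simp
  rw [← h1]
  refine Finset.card_nbij' (fun W => W \ T) (fun U => U ∪ T) ?_ ?_ ?_ ?_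
  · intro W hW
    simp only [Finset.coe_filter, Set.mem_ofPred_eq, mem_rSets] at hW
    simp only [Finset.mem_coe, Finset.mem_powersetCard]
    exact ⟨Finset.sdiff_subset_sdiff (Finset.subset_univ _) le_rfl, by
      rw [Finset.card_sdiff_of_subset hW.2, hW.1]⟩
  · intro U hU
    simp only [Finset.mem_coe, Finset.mem_powersetCard] at hU
    have hd : Disjoint U T := Finset.disjoint_left.2 fun x hx hT' =>
      (Finset.mem_sdiff.1 (hU.1 hx)).2 hT'
    simp only [Finset.coe_filter, Set.mem_ofPred_eq, mem_rSets]
    refine ⟨?_, Finset.subset_union_right⟩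
    rw [Finset.card_union_of_disjoint hd, hU.2]; omega
  · intro W hW
    simp only [Finset.coe_filter, Set.mem_ofPred_eq, mem_rSets] at hW
    exact Finset.sdiff_union_of_subset hW.2
  · intro U hU
    simp only [Finset.mem_coe, Finset.mem_powersetCard] at hU
    have hd : Disjoint U T := Finset.disjoint_left.2 fun x hx hT' =>
      (Finset.mem_sdiff.1 (hU.1 hx)).2 hT'
    change (U ∪ T) \ T = U
    rw [Finset.union_sdiff_right]
    exact Finset.sdiff_eq_self_of_disjoint hd

lemma card_rSets_mem (hr : 1 ≤ r) (j : Fin n) :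
    (rSets n r |>.filter (j ∈ ·)).card = (n - 1).choose (r - 1) := by
  have := card_rSets_superset (r := r) {j} (by simpa using hr)
  simpa using this

lemma card_rSets_mem_mem (hr : 2 ≤ r) {j k : Fin n} (hjk : j ≠ k) :
    (rSets n r |>.filter (fun W => j ∈ W ∧ k ∈ W)).card = (n - 2).choose (r - 2) := by
  have h2 : ({j, k} : Finset (Fin n)).card = 2 := Finset.card_pair hjk
  have := card_rSets_superset (r := r) {j, k} (by omega)
  rw [h2] at this
  simpa [Finset.insert_subset_iff] using this

lemma choose_sub_one_eq (hr : 2 ≤ r) (hn : 2 ≤ n) :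
    (n - 1).choose (r - 1) = (n - 2).choose (r - 1) + (n - 2).choose (r - 2) := by
  obtain ⟨r, rfl⟩ := Nat.exists_eq_add_of_le' hr
  obtain ⟨n, rfl⟩ := Nat.exists_eq_add_of_le' hn
  simp only [Nat.add_sub_cancel]
  rw [show n + 2 - 1 = n + 1 by omega, show r + 2 - 1 = r + 1 by omega, Nat.choose_succ_succ]
  ring

lemma card_rSets_mem_notMem (hr : 2 ≤ r) {j k : Fin n} (hjk : j ≠ k) :
    (rSets n r |>.filter (fun W => j ∈ W ∧ k ∉ W)).card = (n - 2).choose (r - 1) := by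
  have hn : 2 ≤ n := by
    have h2 : ({j, k} : Finset (Fin n)).card = 2 := Finset.card_pair hjk
    simpa [h2] using Finset.card_le_univ ({j, k} : Finset (Fin n))
  have h1 := card_rSets_mem (n := n) (r := r) (by omega) j
  rw [choose_sub_one_eq hr hn, ← Finset.card_filter_add_card_filter_not (fun W => k ∈ W),
    Finset.filter_filter, Finset.filter_filter, card_rSets_mem_mem hr hjk] at h1
  omega

lemma choose_identities (hr : 2 ≤ r) (hrn : r + 1 ≤ n) :
    ((n - 2).choose (r - 1) : ℝ) * (n * (n - 1)) = n.choose r * (r * (n - r)) ∧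
    ((n - 2).choose (r - 2) : ℝ) * (n * (n - 1)) = n.choose r * (r * (r - 1)) := by
  obtain ⟨r, rfl⟩ := Nat.exists_eq_add_of_le' hr
  obtain ⟨m, rfl⟩ := Nat.exists_eq_add_of_le' (show 2 ≤ n by omega)
  have h1 := Nat.add_one_mul_choose_eq (m + 1) (r + 1)
  have h2 := Nat.add_one_mul_choose_eq m r
  have h3 := Nat.choose_succ_right_eq m r
  have hle : r ≤ m := by omega
  simp only [Nat.add_sub_cancel, show r + 2 - 1 = r + 1 by omega]
  have h1' : ((m : ℝ) + 1 + 1) * (m + 1).choose (r + 1) = (m + 2).choose (r + 2) * (r + 2) := by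
    exact_mod_cast h1
  have h2' : ((m : ℝ) + 1) * m.choose r = (m + 1).choose (r + 1) * (r + 1) := by
    exact_mod_cast h2
  have h3' : (m.choose (r + 1) : ℝ) * (r + 1) = m.choose r * (m - r) := by
    have : ((m.choose (r + 1) * (r + 1) : ℕ) : ℝ) = ((m.choose r * (m - r) : ℕ) : ℝ) := by rw [h3]
    push_cast [Nat.cast_sub hle] at this
    exact this
  have hr1 : (r : ℝ) + 1 ≠ 0 := by positivity
  push_cast
  constructor
  · apply mul_right_cancel₀ hr1
    linear_combination (m + 2 : ℝ) * (m + 1) * h3' + (m + 2 : ℝ) * (m - r) * h2'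
      + (r + 1 : ℝ) * (m - r) * h1'
  · linear_combination (m + 2 : ℝ) * h2' + (r + 1 : ℝ) * h1'

/-- The quadratic form `∑_W (∑_{j ∈ W} θ_j)²` in closed form: by symmetry it is a combination of
`∑ θ_j²` and `(∑ θ_j)²`. -/
lemma sum_rSets_sq (hr : 2 ≤ r) (hn : 2 ≤ n) (θ : Fin n → ℝ) :
    ∑ W ∈ rSets n r, (∑ j ∈ W, θ j) ^ 2 =
      ((n - 2).choose (r - 1) : ℝ) * ∑ j, θ j ^ 2
        + ((n - 2).choose (r - 2) : ℝ) * (∑ j, θ j) ^ 2 := by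
  have h1 : ∀ W : Finset (Fin n), (∑ j ∈ W, θ j) ^ 2 =
      ∑ j, ∑ k, θ j * θ k * (if j ∈ W ∧ k ∈ W then 1 else 0) := by
    intro W
    have : ∑ j ∈ W, θ j = ∑ j, (if j ∈ W then θ j else 0) := by simp
    rw [this, sq, Finset.sum_mul_sum]
    refine Finset.sum_congr rfl fun j _ => Finset.sum_congr rfl fun k _ => ?_
    by_cases hj : j ∈ W <;> by_cases hk : k ∈ W <;> simp [hj, hk]
  rw [Finset.sum_congr rfl fun W _ => h1 W, Finset.sum_comm]
  have h2 : ∀ j, ∑ W ∈ rSets n r, ∑ k, θ j * θ k * (if j ∈ W ∧ k ∈ W then (1 : ℝ) else 0) =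
      ((n - 2).choose (r - 1) : ℝ) * θ j ^ 2
        + ((n - 2).choose (r - 2) : ℝ) * (θ j * ∑ k, θ k) := by
    intro j
    rw [Finset.sum_comm]
    have h3 : ∀ k, ∑ W ∈ rSets n r, θ j * θ k * (if j ∈ W ∧ k ∈ W then (1 : ℝ) else 0) =
        (if k = j then ((n - 2).choose (r - 1) : ℝ) * θ j ^ 2 else 0)
          + ((n - 2).choose (r - 2) : ℝ) * (θ j * θ k) := by
      intro k
      rw [← Finset.mul_sum, Finset.sum_boole]
      by_cases hk : k = j
      · subst hk
        simp only [and_self, if_true, card_rSets_mem (show 1 ≤ r by omega),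
          choose_sub_one_eq hr hn]
        push_cast; ring
      · rw [card_rSets_mem_mem hr (Ne.symm hk), if_neg hk]; ring
    simp_rw [h3]
    rw [Finset.sum_add_distrib, Finset.sum_ite_eq' Finset.univ j, if_pos (Finset.mem_univ j),
      ← Finset.mul_sum, ← Finset.mul_sum]
  simp_rw [h2]
  rw [Finset.sum_add_distrib, ← Finset.mul_sum, ← Finset.mul_sum, ← Finset.sum_mul, sq (∑ j, θ j)]

/-- A single sum over an `r`-set is controlled by the average of the squares of all of them; the
inequality separates the mean of `θ` from the deviation from the mean. -/
lemma sq_sum_le_sum_rSets_sq (hr : 2 ≤ r) (hrn : r + 1 ≤ n) (θ : Fin n → ℝ) {W : Finset (Fin n)}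
    (hW : W ∈ rSets n r) :
    (n.choose r : ℝ) * (∑ j ∈ W, θ j) ^ 2 ≤ 2 * n * ∑ W ∈ rSets n r, (∑ j ∈ W, θ j) ^ 2 := by
  obtain ⟨ha, hb⟩ := choose_identities hr hrn
  rw [sum_rSets_sq hr (by omega)]
  set a : ℝ := ((n - 2).choose (r - 1) : ℝ)
  set b : ℝ := ((n - 2).choose (r - 2) : ℝ)
  set N : ℝ := (n.choose r : ℝ)
  set S := ∑ j, θ j with hS
  set U := ∑ j, θ j ^ 2 with hU
  set T := ∑ j ∈ W, θ j with hT
  have hWc : (W.card : ℝ) = r := by exact_mod_cast mem_rSets.1 hW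
  have hn0 : (0 : ℝ) < n := by exact_mod_cast (by omega : 0 < n)
  have hn1 : (0 : ℝ) < (n : ℝ) - 1 := by
    have : (2 : ℝ) ≤ n := by exact_mod_cast (by omega : 2 ≤ n)
    linarith
  have hN0 : 0 ≤ N := Nat.cast_nonneg _
  have hr0 : (0 : ℝ) ≤ r := Nat.cast_nonneg _
  have hnr : (0 : ℝ) ≤ (n : ℝ) - r := by
    have : (r : ℝ) ≤ n := by exact_mod_cast (by omega : r ≤ n)
    linarith
  have hcs := Finset.sum_mul_sq_le_sq_mul_sq Finset.univ
    (fun j => (if j ∈ W then (1 : ℝ) else 0) - r / n) (fun j => θ j - S / n)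
  have e1 : ∑ j, ((if j ∈ W then (1 : ℝ) else 0) - r / n) * (θ j - S / n) = T - r * S / n := by
    have : ∀ j, ((if j ∈ W then (1 : ℝ) else 0) - r / n) * (θ j - S / n) =
        (if j ∈ W then θ j else 0) - (if j ∈ W then (1 : ℝ) else 0) * (S / n) - r / n * θ j
          + r / n * (S / n) := by
      intro j; split_ifs <;> ring
    simp_rw [this]
    rw [Finset.sum_add_distrib, Finset.sum_sub_distrib, Finset.sum_sub_distrib, ← Finset.sum_mul,
      ← Finset.mul_sum, Finset.sum_const, Finset.card_univ, Fintype.card_fin, ← hS]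
    simp only [Finset.sum_ite_mem, Finset.univ_inter, Finset.sum_const, nsmul_eq_mul, mul_one, hWc]
    rw [← hT]; field_simp; ring
  have e2 : ∑ j, ((if j ∈ W then (1 : ℝ) else 0) - r / n) ^ 2 = r * (n - r) / n := by
    have : ∀ j, ((if j ∈ W then (1 : ℝ) else 0) - r / n) ^ 2 =
        (if j ∈ W then (1 : ℝ) else 0) * (1 - 2 * (r / n)) + (r / n) ^ 2 := by
      intro j; split_ifs <;> ring
    simp_rw [this]
    rw [Finset.sum_add_distrib, ← Finset.sum_mul, Finset.sum_const, Finset.card_univ,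
      Fintype.card_fin]
    simp only [Finset.sum_ite_mem, Finset.univ_inter, Finset.sum_const, nsmul_eq_mul, mul_one, hWc]
    field_simp; ring
  have e3 : ∑ j, (θ j - S / n) ^ 2 = U - S ^ 2 / n := by
    have : ∀ j, (θ j - S / n) ^ 2 = θ j ^ 2 - 2 * (S / n) * θ j + (S / n) ^ 2 := by
      intro j; ring
    simp_rw [this]
    rw [Finset.sum_add_distrib, Finset.sum_sub_distrib, ← Finset.mul_sum, Finset.sum_const,
      Finset.card_univ, Fintype.card_fin, ← hS, nsmul_eq_mul]
    field_simp; ring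
  have hV : 0 ≤ U - S ^ 2 / n := by rw [← e3]; positivity
  rw [e1, e2, e3] at hcs
  have hT2 : T ^ 2 ≤ 2 * (r * S / n) ^ 2 + 2 * (r * (n - r) / n * (U - S ^ 2 / n)) := by
    nlinarith [sq_nonneg (T - 2 * (r * S / n))]
  have haV : N * (r * (n - r) / n) ≤ n * a := by
    have : N * (r * (n - r) / n) = a * (n - 1) := by field_simp; linarith
    have ha0 : 0 ≤ a := Nat.cast_nonneg _
    rw [this]; nlinarith
  have hbS : a + n * b = N * r ^ 2 / n := by
    have : (a + n * b) * (n * (n - 1)) = N * r ^ 2 / n * (n * (n - 1)) := by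
      have e : N * r ^ 2 / n * (n * ((n : ℝ) - 1)) = N * r ^ 2 * (n - 1) := by field_simp
      rw [e]
      linear_combination ha + n * hb
    exact mul_right_cancel₀ (by positivity) this
  have hbS2 : N * (r / n) ^ 2 ≤ a + n * b := by
    rw [hbS, div_pow, mul_div_assoc]
    have : (1 : ℝ) ≤ n := by linarith
    gcongr
    nlinarith
  calc N * T ^ 2 ≤ N * (2 * (r * S / n) ^ 2 + 2 * (r * (n - r) / n * (U - S ^ 2 / n))) := by gcongr
    _ = 2 * (N * (r / n) ^ 2 * S ^ 2) + 2 * (N * (r * (n - r) / n) * (U - S ^ 2 / n)) := by ring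
    _ ≤ 2 * ((a + n * b) * S ^ 2) + 2 * (n * a * (U - S ^ 2 / n)) := by gcongr
    _ = 2 * n * (a * U + b * S ^ 2) := by field_simp; ring

end Counting

/-! ### Coordinates on the torus -/

section Coordinates

variable {n r : ℕ}

/-- The change of coordinates `θ ↦ y` with `y j = θ j - θ n₀` for `j ≠ n₀` and
`y n₀ = ∑ j ∈ W₀, θ j`. In these coordinates all forms `∑ j ∈ W, θ j` with `|W| = |W₀|` have integer
coefficients with a coefficient `1` at `n₀`, so that `y` runs over a standard torus on which the
characteristic function has only one peak. -/
def coordMatrix (n₀ : Fin n) (W₀ : Finset (Fin n)) : Matrix (Fin n) (Fin n) ℝ :=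
  Matrix.of fun j k =>
    if j = n₀ then (if k ∈ W₀ then 1 else 0)
    else (if k = j then 1 else 0) - (if k = n₀ then 1 else 0)

/-- The integer coefficients of `∑ j ∈ W, θ j` in the coordinates given by `coordMatrix`. -/
def edgeFormInt (n₀ : Fin n) (W₀ W : Finset (Fin n)) (j : Fin n) : ℤ :=
  if j = n₀ then 1 else (if j ∈ W then 1 else 0) - (if j ∈ W₀ then 1 else 0)

/-- The linear form `∑ j ∈ W, θ j` in the coordinates given by `coordMatrix`. -/
def edgeForm (n₀ : Fin n) (W₀ W : Finset (Fin n)) (j : Fin n) : ℝ :=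
  edgeFormInt n₀ W₀ W j

variable {n₀ : Fin n} {W₀ : Finset (Fin n)}

lemma edgeForm_apply (W : Finset (Fin n)) (j : Fin n) : edgeForm n₀ W₀ W j =
    if j = n₀ then 1 else (if j ∈ W then (1 : ℝ) else 0) - (if j ∈ W₀ then 1 else 0) := by
  simp only [edgeForm, edgeFormInt]
  split_ifs <;> simp

lemma edgeForm_dotProduct (W : Finset (Fin n)) (y : Fin n → ℝ) :
    edgeForm n₀ W₀ W ⬝ᵥ y = y n₀ + ∑ j ∈ Finset.univ.erase n₀,
      ((if j ∈ W then (1 : ℝ) else 0) - (if j ∈ W₀ then 1 else 0)) * y j := by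
  rw [dotProduct, ← Finset.add_sum_erase _ _ (Finset.mem_univ n₀)]
  congr 1
  · simp [edgeForm_apply]
  · refine Finset.sum_congr rfl fun j hj => ?_
    rw [edgeForm_apply, if_neg (Finset.ne_of_mem_erase hj)]

lemma coordMatrix_mulVec (θ : Fin n → ℝ) (j : Fin n) :
    (coordMatrix n₀ W₀ *ᵥ θ) j = if j = n₀ then ∑ k ∈ W₀, θ k else θ j - θ n₀ := by
  simp only [mulVec, dotProduct, coordMatrix, Matrix.of_apply]
  split_ifs with h
  · simp
  · simp [sub_mul, Finset.sum_sub_distrib]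

lemma edgeForm_dotProduct_coordMatrix {W : Finset (Fin n)} (hW : W.card = W₀.card)
    (θ : Fin n → ℝ) :
    edgeForm n₀ W₀ W ⬝ᵥ (coordMatrix n₀ W₀ *ᵥ θ) = ∑ j ∈ W, θ j := by
  rw [edgeForm_dotProduct, coordMatrix_mulVec, if_pos rfl]
  have h1 : ∀ j ∈ Finset.univ.erase n₀,
      ((if j ∈ W then (1 : ℝ) else 0) - (if j ∈ W₀ then 1 else 0)) * (coordMatrix n₀ W₀ *ᵥ θ) j =
      ((if j ∈ W then (1 : ℝ) else 0) - (if j ∈ W₀ then 1 else 0)) * (θ j - θ n₀) := by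
    intro j hj
    rw [coordMatrix_mulVec, if_neg (Finset.ne_of_mem_erase hj)]
  rw [Finset.sum_congr rfl h1, Finset.sum_erase _ (by simp)]
  simp only [sub_mul, ite_mul, one_mul, zero_mul, Finset.sum_sub_distrib, Finset.sum_ite_mem,
    Finset.univ_inter, Finset.sum_const, hW]
  ring

lemma det_coordMatrix (n₀ : Fin n) (W₀ : Finset (Fin n)) : (coordMatrix n₀ W₀).det = W₀.card := by
  -- adding all columns to column `n₀` clears it except on the diagonal
  have hE : (updateCol (1 : Matrix (Fin n) (Fin n) ℝ) n₀ (fun _ => 1)).det = 1 := by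
    rw [← cramer_apply, cramer_one]; simp
  have hR : coordMatrix n₀ W₀ * updateCol (1 : Matrix (Fin n) (Fin n) ℝ) n₀ (fun _ => 1) =
      updateRow (1 : Matrix (Fin n) (Fin n) ℝ) n₀
        (fun k => if k = n₀ then (W₀.card : ℝ) else if k ∈ W₀ then 1 else 0) := by
    ext j k
    have hcol : (coordMatrix n₀ W₀ * updateCol (1 : Matrix (Fin n) (Fin n) ℝ) n₀ (fun _ => 1)) j k =
        (coordMatrix n₀ W₀ *ᵥ (fun i => if k = n₀ then 1 else if i = k then 1 else 0)) j := by
      rw [mul_apply, mulVec, dotProduct]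
      refine Finset.sum_congr rfl fun i _ => ?_
      rw [updateCol_apply, one_apply]
    rw [hcol, coordMatrix_mulVec, updateRow_apply]
    by_cases hj : j = n₀
    · simp only [hj, if_true]
      by_cases hk : k = n₀
      · simp [hk]
      · simp [hk]
    · simp only [hj, if_false]
      by_cases hk : k = n₀
      · simp [hk, one_apply, hj]
      · simp [hk, one_apply, Ne.symm hk]
  have hdet := congrArg det hR
  rw [det_mul, hE, mul_one] at hdet
  rw [hdet, ← det_transpose, ← updateCol_transpose, transpose_one, ← cramer_apply, cramer_one]
  simp

/-- The precision matrix of the characteristic function in the torus coordinates. -/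
def edgePrecision (r : ℕ) (n₀ : Fin n) (W₀ : Finset (Fin n)) (p : Finset (Fin n) → ℝ) :
    Matrix (Fin n) (Fin n) ℝ :=
  precision (rSets n r) (bernoulliVar p) (edgeForm n₀ W₀)

lemma matrixA_eq (hW₀ : W₀.card = r) (β : Fin n → ℝ) :
    matrixA r β = (1 / 2 : ℝ) •
      ((coordMatrix n₀ W₀)ᵀ * edgePrecision r n₀ W₀ (edgeProb β) * coordMatrix n₀ W₀) := by
  have hL : ∀ W ∈ rSets n r, ∀ j : Fin n, (edgeForm n₀ W₀ W ᵥ* coordMatrix n₀ W₀) j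
      = if j ∈ W then 1 else 0 := by
    intro W hW j
    have := edgeForm_dotProduct_coordMatrix (n₀ := n₀)
      ((mem_rSets.1 hW).trans hW₀.symm) (Pi.single j 1)
    rw [dotProduct_mulVec, dotProduct_single, mul_one] at this
    rw [this]; simp [Pi.single_apply]
  ext j k
  have hq : ((coordMatrix n₀ W₀)ᵀ * edgePrecision r n₀ W₀ (edgeProb β) * coordMatrix n₀ W₀) j k =
      ∑ W ∈ rSets n r, bernoulliVar (edgeProb β) W *
        (edgeForm n₀ W₀ W ᵥ* coordMatrix n₀ W₀) j * (edgeForm n₀ W₀ W ᵥ* coordMatrix n₀ W₀) k := by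
    rw [edgePrecision, precision, Finset.mul_sum, Finset.sum_mul, Matrix.sum_apply]
    refine Finset.sum_congr rfl fun W _ => ?_
    rw [mul_smul_comm, smul_mul_assoc, mul_vecMulVec, vecMulVec_mul, Matrix.smul_apply,
      vecMulVec_apply, mulVec_transpose, smul_eq_mul]
    ring
  rw [Matrix.smul_apply, hq, matrixA, Matrix.of_apply, smul_eq_mul, Finset.sum_filter]
  congr 1
  refine Finset.sum_congr rfl fun W hW => ?_
  rw [hL W hW, hL W hW, bernoulliVar]
  by_cases hj : j ∈ W <;> by_cases hk : k ∈ W <;> simp [hj, hk]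

lemma det_matrixA (hW₀ : W₀.card = r) (β : Fin n → ℝ) :
    (matrixA r β).det = (1 / 2) ^ n * ((r : ℝ) ^ 2 * (edgePrecision r n₀ W₀ (edgeProb β)).det) := by
  rw [matrixA_eq hW₀, det_smul, det_mul, det_mul, det_transpose, det_coordMatrix, hW₀,
    Fintype.card_fin]
  ring

lemma exists_coordMatrix_mulVec_eq (hW₀ : 0 < W₀.card) (y : Fin n → ℝ) :
    ∃ θ, coordMatrix n₀ W₀ *ᵥ θ = y := by
  have hu : IsUnit (coordMatrix n₀ W₀).det := by
    rw [det_coordMatrix]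
    exact (Nat.cast_pos.2 hW₀).ne'.isUnit
  exact ⟨(coordMatrix n₀ W₀)⁻¹ *ᵥ y, by rw [mulVec_mulVec, mul_nonsing_inv _ hu, one_mulVec]⟩

/-- The variance bound for the edge forms in terms of a lower bound `m` for the variances. -/
lemma edgeForm_sq_le (hr : 2 ≤ r) (hrn : r + 1 ≤ n) (hW₀ : W₀.card = r)
    {p : Finset (Fin n) → ℝ} {m : ℝ} (hm : 0 < m) (hp : ∀ W ∈ rSets n r, m ≤ bernoulliVar p W)
    {W : Finset (Fin n)} (hW : W ∈ rSets n r) (y : Fin n → ℝ) :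
    (edgeForm n₀ W₀ W ⬝ᵥ y) ^ 2
      ≤ 2 * n / (n.choose r * m) * (y ⬝ᵥ edgePrecision r n₀ W₀ p *ᵥ y) := by
  obtain ⟨θ, rfl⟩ := exists_coordMatrix_mulVec_eq (n₀ := n₀) (W₀ := W₀) (by omega) y
  have hc : ∀ W ∈ rSets n r, edgeForm n₀ W₀ W ⬝ᵥ (coordMatrix n₀ W₀ *ᵥ θ) = ∑ j ∈ W, θ j :=
    fun W hW => edgeForm_dotProduct_coordMatrix ((mem_rSets.1 hW).trans hW₀.symm) θ
  have hN : (0 : ℝ) < n.choose r := by exact_mod_cast Nat.choose_pos (by omega)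
  have h1 := sq_sum_le_sum_rSets_sq hr hrn θ hW
  have h2 : m * ∑ W ∈ rSets n r, (∑ j ∈ W, θ j) ^ 2 ≤
      (coordMatrix n₀ W₀ *ᵥ θ) ⬝ᵥ edgePrecision r n₀ W₀ p *ᵥ (coordMatrix n₀ W₀ *ᵥ θ) := by
    rw [edgePrecision, dotProduct_precision_mulVec, Finset.mul_sum]
    refine Finset.sum_le_sum fun W hW => ?_
    rw [hc W hW, mul_assoc, ← sq]
    gcongr
    exact hp W hW
  rw [hc W hW, div_mul_eq_mul_div, le_div_iff₀ (by positivity)]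
  calc (∑ j ∈ W, θ j) ^ 2 * (n.choose r * m) = (n.choose r * (∑ j ∈ W, θ j) ^ 2) * m := by ring
    _ ≤ (2 * n * ∑ W ∈ rSets n r, (∑ j ∈ W, θ j) ^ 2) * m := by gcongr
    _ = 2 * n * (m * ∑ W ∈ rSets n r, (∑ j ∈ W, θ j) ^ 2) := by ring
    _ ≤ _ := by gcongr

lemma posDef_edgePrecision (hr : 2 ≤ r) (hrn : r + 1 ≤ n) (hW₀ : W₀.card = r)
    {p : Finset (Fin n) → ℝ} (hp : ∀ W ∈ rSets n r, 0 < bernoulliVar p W) :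
    (edgePrecision r n₀ W₀ p).PosDef := by
  refine Matrix.PosDef.of_dotProduct_mulVec_pos ?_ ?_
  · rw [IsHermitian, conjTranspose_eq_transpose_of_trivial, edgePrecision, precision,
      transpose_sum]
    refine Finset.sum_congr rfl fun W _ => ?_
    rw [transpose_smul, transpose_vecMulVec]
  · intro y hy
    obtain ⟨θ, rfl⟩ := exists_coordMatrix_mulVec_eq (n₀ := n₀) (W₀ := W₀) (by omega) y
    have hc : ∀ W ∈ rSets n r, edgeForm n₀ W₀ W ⬝ᵥ (coordMatrix n₀ W₀ *ᵥ θ) = ∑ j ∈ W, θ j :=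
      fun W hW => edgeForm_dotProduct_coordMatrix ((mem_rSets.1 hW).trans hW₀.symm) θ
    rw [star_trivial, edgePrecision, dotProduct_precision_mulVec]
    have hθ : θ ≠ 0 := fun h => hy (by rw [h, mulVec_zero])
    obtain ⟨j, hj⟩ := Function.ne_iff.1 hθ
    have hpos : 0 < ∑ W ∈ rSets n r, (∑ j ∈ W, θ j) ^ 2 := by
      rw [sum_rSets_sq hr (by omega)]
      have h1 : (0 : ℝ) < (n - 2).choose (r - 1) := by
        exact_mod_cast Nat.choose_pos (by omega)
      have h2 : 0 < ∑ j, θ j ^ 2 :=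
        Finset.sum_pos' (fun _ _ => sq_nonneg _) ⟨j, Finset.mem_univ j, by
          have : θ j ≠ 0 := by simpa using hj
          positivity⟩
      positivity
    obtain ⟨W, hW, hWp⟩ : ∃ W ∈ rSets n r, 0 < (∑ j ∈ W, θ j) ^ 2 := by
      by_contra! hcon
      exact absurd (Finset.sum_nonpos hcon) (not_le.2 hpos)
    refine Finset.sum_pos' (fun V hV => ?_) ⟨W, hW, ?_⟩
    · rw [mul_assoc]
      exact mul_nonneg (hp V hV).le (mul_self_nonneg _)
    · rw [hc W hW, mul_assoc, ← sq]
      exact mul_pos (hp W hW) hWp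

end Coordinates

end

/-! ### Fourier inversion on the torus -/

section

open MeasureTheory Matrix

section Torus

/-- The fundamental cube `(-π, π]ⁿ` of the torus. -/
def torusCube (n : ℕ) : Set (Fin n → ℝ) := Set.univ.pi fun _ => Set.Ioc (-Real.pi) Real.pi

lemma integrableOn_torusCube {n : ℕ} {E : Type*} [NormedAddCommGroup E] {f : (Fin n → ℝ) → E}
    (hf : Continuous f) : IntegrableOn f (torusCube n) :=
  (hf.continuousOn.integrableOn_compact
    (isCompact_univ_pi fun _ => isCompact_Icc (a := -Real.pi) (b := Real.pi))).mono_set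
    (Set.pi_mono fun _ _ => Set.Ioc_subset_Icc_self)

lemma volume_torusCube (n : ℕ) : volume.real (torusCube n) = (2 * Real.pi) ^ n := by
  rw [torusCube, Measure.real, Real.volume_pi_Ioc_toReal]
  · simp; ring
  · intro i; linarith [Real.pi_pos]

lemma integral_exp_int_mul (k : ℤ) :
    ∫ x in Set.Ioc (-Real.pi) Real.pi, Complex.exp (k * x * Complex.I)
      = if k = 0 then (2 * Real.pi : ℂ) else 0 := by
  rw [← intervalIntegral.integral_of_le (by linarith [Real.pi_pos])]
  by_cases hk : k = 0
  · simp [hk]; ring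
  · rw [if_neg hk]
    have hc : (k : ℂ) * Complex.I ≠ 0 := mul_ne_zero (by exact_mod_cast hk) Complex.I_ne_zero
    have h := integral_exp_mul_complex (a := -Real.pi) (b := Real.pi) hc
    have e : ∀ x : ℝ, Complex.exp (k * x * Complex.I) = Complex.exp (k * Complex.I * x) := by
      intro x; congr 1; ring
    simp_rw [e]
    rw [h]
    have h2 : Complex.exp (k * Complex.I * (Real.pi : ℝ)) =
        Complex.exp (k * Complex.I * ((-Real.pi : ℝ) : ℂ)) := by
      rw [Complex.exp_eq_exp_iff_exists_int]
      exact ⟨k, by push_cast; ring⟩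
    rw [h2, sub_self, zero_div]

/-- Orthogonality of the characters of the torus. -/
lemma integral_torusCube_exp {n : ℕ} (k : Fin n → ℤ) :
    ∫ y in torusCube n, Complex.exp ((∑ j, (k j : ℂ) * y j) * Complex.I)
      = if k = 0 then ((2 * Real.pi) ^ n : ℂ) else 0 := by
  have e : ∀ y : Fin n → ℝ, Complex.exp ((∑ j, (k j : ℂ) * y j) * Complex.I) =
      ∏ j, Complex.exp (k j * y j * Complex.I) := by
    intro y
    rw [← Complex.exp_sum, Finset.sum_mul]
  simp_rw [e]
  rw [torusCube, volume_pi, Measure.restrict_pi_pi,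
    integral_fintype_prod_eq_prod (f := fun j (x : ℝ) => Complex.exp (k j * x * Complex.I))]
  simp_rw [integral_exp_int_mul]
  by_cases hk : k = 0
  · simp [hk]
  · rw [if_neg hk]
    obtain ⟨j, hj⟩ := Function.ne_iff.1 hk
    exact Finset.prod_eq_zero (Finset.mem_univ j) (if_neg (by simpa using hj))

end Torus

section Counting

variable {n r : ℕ}

/-- The families of `r`-sets in which each vertex `j` has degree `d j`. -/
def familiesWithDegrees (r : ℕ) (d : Fin n → ℕ) : Finset (Finset (Finset (Fin n))) :=
  (rSets n r).powerset.filter fun H => ∀ j, (H.filter (j ∈ ·)).card = d j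

lemma numHypergraphs_eq_card (r : ℕ) (d : Fin n → ℕ) :
    numHypergraphs r d = (familiesWithDegrees r d).card := by
  classical
  set φ : Finset (Finset (Fin n)) → Hypergraph (Fin n) := fun H =>
    { vertexSet := Set.univ
      edgeSet := (fun e : Finset (Fin n) => (e : Set (Fin n))) '' H
      subset_vertexSet_of_mem_edgeSet' := fun _ _ => Set.subset_univ _ } with hφ
  have hcoe : Function.Injective (fun e : Finset (Fin n) => (e : Set (Fin n))) :=
    Finset.coe_injective
  have hinj : Function.Injective φ := by
    intro H₁ H₂ h
    have h2 : (fun e : Finset (Fin n) => (e : Set (Fin n))) '' H₁ =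
        (fun e : Finset (Fin n) => (e : Set (Fin n))) '' H₂ := congrArg Hypergraph.edgeSet h
    exact Finset.coe_injective (hcoe.image_injective h2)
  have hdeg : ∀ (H : Finset (Finset (Fin n))) (j : Fin n),
      {e ∈ (φ H).edgeSet | j ∈ e}.ncard = (H.filter (j ∈ ·)).card := by
    intro H j
    have : {e ∈ (φ H).edgeSet | j ∈ e} =
        (fun e : Finset (Fin n) => (e : Set (Fin n))) '' (H.filter (j ∈ ·) : Finset _) := by
      ext e
      simp only [hφ, Set.mem_image, Finset.mem_coe, Finset.coe_filter, Set.mem_ofPred_eq]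
      constructor
      · rintro ⟨⟨f, hf, rfl⟩, hj⟩
        exact ⟨f, ⟨hf, by simpa using hj⟩, rfl⟩
      · rintro ⟨f, ⟨hf, hj⟩, rfl⟩
        exact ⟨⟨f, hf, rfl⟩, by simpa using hj⟩
    rw [this, Set.ncard_image_of_injective _ hcoe, Set.ncard_coe_finset]
  have himg : hypergraphsWithDegrees r d = φ '' (familiesWithDegrees r d) := by
    ext G
    simp only [hypergraphsWithDegrees, Set.mem_ofPred_eq, Set.mem_image, Finset.mem_coe,
      familiesWithDegrees, Finset.mem_filter, Finset.mem_powerset]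
    constructor
    · rintro ⟨hV, hr, hd⟩
      set H : Finset (Finset (Fin n)) :=
        Finset.univ.filter fun e : Finset (Fin n) => (e : Set (Fin n)) ∈ G.edgeSet with hH
      have hE : (fun e : Finset (Fin n) => (e : Set (Fin n))) '' H = G.edgeSet := by
        ext e
        simp only [hH, Set.mem_image, Finset.mem_coe, Finset.mem_filter, Finset.mem_univ, true_and]
        constructor
        · rintro ⟨f, hf, rfl⟩; exact hf
        · intro he
          obtain ⟨f, rfl⟩ := (Set.toFinite e).exists_finset_coe
          exact ⟨f, he, rfl⟩
      have hG : φ H = G := Hypergraph.ext (by rw [hV]) hE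
      refine ⟨H, ⟨fun e he => ?_, fun j => ?_⟩, hG⟩
      · rw [mem_rSets, ← Set.ncard_coe_finset]
        exact hr _ (by simpa [hH] using he)
      · rw [← hdeg, hG]; exact hd j
    · rintro ⟨H, ⟨hs, hd⟩, rfl⟩
      refine ⟨rfl, ?_, fun j => by rw [hdeg, hd]⟩
      rintro _ ⟨f, hf, rfl⟩
      change (f : Set (Fin n)).ncard = r
      rw [Set.ncard_coe_finset]
      exact mem_rSets.1 (hs hf)
  rw [numHypergraphs, himg, Set.ncard_image_of_injective _ hinj, Set.ncard_coe_finset]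

lemma sum_degrees (H : Finset (Finset (Fin n))) (hH : H ⊆ rSets n r) :
    ∑ j, (H.filter (j ∈ ·)).card = r * H.card := by
  have h := Finset.sum_card_bipartiteAbove_eq_sum_card_bipartiteBelow
    (s := (Finset.univ : Finset (Fin n))) (t := H) (fun j W => j ∈ W)
  simp only [Finset.bipartiteAbove, Finset.bipartiteBelow] at h
  rw [h, Finset.sum_congr rfl (g := fun _ => r)]
  · simp [mul_comm]
  · intro W hW
    simpa using mem_rSets.1 (hH hW)

end Counting

section EdgeProb

variable {n r : ℕ} {β : Fin n → ℝ}

lemma edgeProb_pos (β : Fin n → ℝ) (W : Finset (Fin n)) : 0 < edgeProb β W := by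
  unfold edgeProb; positivity

lemma one_sub_edgeProb (β : Fin n → ℝ) (W : Finset (Fin n)) :
    1 - edgeProb β W = (1 + Real.exp (∑ j ∈ W, β j))⁻¹ := by
  unfold edgeProb
  have : 1 + Real.exp (∑ j ∈ W, β j) ≠ 0 := by positivity
  field_simp; ring

lemma edgeProb_lt_one (β : Fin n → ℝ) (W : Finset (Fin n)) : edgeProb β W < 1 := by
  have h : 0 < 1 - edgeProb β W := by rw [one_sub_edgeProb]; positivity
  linarith

lemma edgeProb_eq (β : Fin n → ℝ) (W : Finset (Fin n)) :
    edgeProb β W = (1 - edgeProb β W) * Real.exp (∑ j ∈ W, β j) := by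
  rw [one_sub_edgeProb, edgeProb, div_eq_inv_mul]

/-- Exchanging the order of summation in `∑_W f(W) ∑_{j ∈ W} x_j`. -/
lemma sum_mul_sum_mem (s : Finset (Finset (Fin n))) (f : Finset (Fin n) → ℝ) (x : Fin n → ℝ) :
    ∑ W ∈ s, f W * ∑ j ∈ W, x j = ∑ j, x j * ∑ W ∈ s with j ∈ W, f W := by
  simp_rw [Finset.mul_sum, Finset.sum_filter]
  rw [Finset.sum_comm]
  refine Finset.sum_congr rfl fun W _ => ?_
  rw [← Finset.sum_subset (Finset.subset_univ W) fun j _ hj => by simp [hj]]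
  exact Finset.sum_congr rfl fun j hj => by rw [if_pos hj, mul_comm]

lemma sum_edgeProb {d : Fin n → ℕ} (hβ : IsBetaSolution r d β) :
    (r : ℝ) * ∑ W ∈ rSets n r, edgeProb β W = ∑ j, (d j : ℝ) := by
  have h := sum_mul_sum_mem (rSets n r) (edgeProb β) (fun _ => 1)
  simp only [one_mul, Finset.sum_const, nsmul_eq_mul, mul_one] at h
  rw [← Finset.sum_congr rfl fun j _ => hβ j, ← h, Finset.mul_sum]
  refine Finset.sum_congr rfl fun W hW => ?_
  rw [mem_rSets.1 hW, mul_comm]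

/-- Under the `β`-model all hypergraphs with degrees `d` have the same probability. -/
lemma prob_family_eq {d : Fin n → ℕ} (hβ : IsBetaSolution r d β)
    {H : Finset (Finset (Fin n))} (hH : H ∈ familiesWithDegrees r d) :
    (∏ W ∈ H, edgeProb β W) * ∏ W ∈ rSets n r \ H, (1 - edgeProb β W) =
      ∏ W ∈ rSets n r, (edgeProb β W ^ edgeProb β W * (1 - edgeProb β W) ^ (1 - edgeProb β W)) := by
  obtain ⟨hs, hd⟩ := Finset.mem_filter.1 hH
  rw [Finset.mem_powerset] at hs
  have h1 : ∏ W ∈ H, edgeProb β W =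
      (∏ W ∈ H, (1 - edgeProb β W)) * Real.exp (∑ j, β j * d j) := by
    rw [Finset.prod_congr rfl fun W _ => edgeProb_eq β W, Finset.prod_mul_distrib,
      ← Real.exp_sum]
    congr 2
    have h := sum_mul_sum_mem H (fun _ => 1) β
    simp only [one_mul] at h
    rw [h]
    refine Finset.sum_congr rfl fun j _ => ?_
    rw [← hd j]; simp
  have h2 : ∀ W ∈ rSets n r,
      edgeProb β W ^ edgeProb β W * (1 - edgeProb β W) ^ (1 - edgeProb β W) =
      (1 - edgeProb β W) * Real.exp (edgeProb β W * ∑ j ∈ W, β j) := by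
    intro W _
    have hq : 0 < 1 - edgeProb β W := by linarith [edgeProb_lt_one β W]
    set q := edgeProb β W with hqd
    have e1 : q ^ q = (1 - q) ^ q * Real.exp (q * ∑ j ∈ W, β j) := by
      conv_lhs => rw [hqd]
      rw [show edgeProb β W ^ edgeProb β W =
        ((1 - edgeProb β W) * Real.exp (∑ j ∈ W, β j)) ^ edgeProb β W by rw [← edgeProb_eq],
        Real.mul_rpow hq.le (Real.exp_pos _).le, ← Real.exp_mul, mul_comm (∑ j ∈ W, β j)]
    rw [e1, mul_right_comm, ← Real.rpow_add hq]
    simp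
  rw [Finset.prod_congr rfl h2, Finset.prod_mul_distrib, ← Real.exp_sum,
    sum_mul_sum_mem, Finset.sum_congr rfl fun j _ => by rw [hβ j], h1,
    ← Finset.prod_sdiff hs]
  ring

end EdgeProb

section Inversion

variable {n r : ℕ} {n₀ : Fin n} {W₀ : Finset (Fin n)} {β : Fin n → ℝ} {d : Fin n → ℕ}

/-- The degree vector in the coordinates given by `coordMatrix`, for `m` edges. -/
def degreeForm (n₀ : Fin n) (W₀ : Finset (Fin n)) (d : Fin n → ℕ) (m : ℕ) (j : Fin n) : ℤ :=
  if j = n₀ then m else d j - (if j ∈ W₀ then m else 0)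

lemma sum_edgeFormInt (H : Finset (Finset (Fin n))) (j : Fin n) :
    ∑ W ∈ H, edgeFormInt n₀ W₀ W j
      = degreeForm n₀ W₀ (fun j => (H.filter (j ∈ ·)).card) H.card j := by
  simp only [edgeFormInt, degreeForm]
  by_cases hj : j = n₀
  · simp [hj]
  · simp only [if_neg hj, Finset.sum_sub_distrib, Finset.sum_boole]
    by_cases hW : j ∈ W₀ <;> simp [hW]

lemma sum_edgeFormInt_eq_iff (hr : 0 < r) {m : ℕ} (hm : ∑ j, d j = r * m)
    {H : Finset (Finset (Fin n))} (hH : H ⊆ rSets n r) :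
    (∀ j, ∑ W ∈ H, edgeFormInt n₀ W₀ W j = degreeForm n₀ W₀ d m j)
      ↔ H ∈ familiesWithDegrees r d := by
  simp only [familiesWithDegrees, Finset.mem_filter, Finset.mem_powerset, hH, true_and]
  simp_rw [sum_edgeFormInt]
  have hs := sum_degrees H hH
  constructor
  · intro h
    have h0 := h n₀
    simp only [degreeForm, if_true] at h0
    have hc : H.card = m := by exact_mod_cast h0
    have hne : ∀ j, j ≠ n₀ → (H.filter (j ∈ ·)).card = d j := by
      intro j hj
      have := h j
      simp only [degreeForm, if_neg hj, hc] at this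
      have h2 : ((H.filter (j ∈ ·)).card : ℤ) = d j := by linarith
      exact_mod_cast h2
    intro j
    by_cases hj : j = n₀
    · subst hj
      rw [hc, ← hm, ← Finset.add_sum_erase _ _ (Finset.mem_univ j),
        ← Finset.add_sum_erase _ d (Finset.mem_univ j),
        Finset.sum_congr rfl fun k hk => hne k (Finset.ne_of_mem_erase hk)] at hs
      exact Nat.add_right_cancel hs
    · exact hne j hj
  · intro h j
    rw [Finset.sum_congr rfl fun j _ => h j, hm] at hs
    have hc : H.card = m := (Nat.eq_of_mul_eq_mul_left hr hs).symm
    simp only [degreeForm, hc, h]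

lemma sum_edgeProb_mul_edgeForm (hr : 0 < r) (hβ : IsBetaSolution r d β) {m : ℕ}
    (hm : ∑ j, d j = r * m) (j : Fin n) :
    ∑ W ∈ rSets n r, edgeProb β W * edgeForm n₀ W₀ W j = degreeForm n₀ W₀ d m j := by
  have hsum : ∑ W ∈ rSets n r, edgeProb β W = m := by
    have h := sum_edgeProb hβ
    have h2 : (∑ j, (d j : ℝ)) = r * m := by exact_mod_cast hm
    rw [h2] at h
    exact mul_left_cancel₀ (by positivity) h
  simp_rw [edgeForm_apply, degreeForm]
  by_cases hj : j = n₀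
  · simp [hj, hsum]
  · simp only [if_neg hj, mul_sub, Finset.sum_sub_distrib, mul_ite, mul_one, mul_zero,
      ← Finset.sum_filter]
    rw [hβ j]
    by_cases hW : j ∈ W₀ <;> simp [hW, hsum]

/-- Fourier inversion: the number of hypergraphs with degrees `d`, times their common probability in
the `β`-model, is the integral of the characteristic function. -/
theorem integral_torusCube_bernoulliProd (hr : 0 < r) (hβ : IsBetaSolution r d β)
    (hd : r ∣ ∑ j, d j) :
    ∫ y in torusCube n, bernoulliProd (rSets n r) (edgeProb β) (edgeForm n₀ W₀) y =
      (((2 * Real.pi) ^ n * (numHypergraphs r d * ∏ W ∈ rSets n r,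
        (edgeProb β W ^ edgeProb β W * (1 - edgeProb β W) ^ (1 - edgeProb β W))) : ℝ) : ℂ) := by
  obtain ⟨m, hm⟩ := hd
  set s := rSets n r with hs
  set p := edgeProb β with hp
  set L := edgeForm n₀ W₀ with hL
  set wt : Finset (Finset (Fin n)) → ℂ := fun H =>
    (∏ W ∈ H, (p W : ℂ)) * ∏ W ∈ s \ H, (1 - p W : ℂ) with hwt
  set k : Finset (Finset (Fin n)) → Fin n → ℤ := fun H j =>
    ∑ W ∈ H, edgeFormInt n₀ W₀ W j - degreeForm n₀ W₀ d m j with hk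
  have hexp : ∀ y : Fin n → ℝ, bernoulliProd s p L y =
      ∑ H ∈ s.powerset, wt H * Complex.exp ((∑ j, (k H j : ℂ) * y j) * Complex.I) := by
    intro y
    have h1 : bernoulliProd s p L y =
        (∏ W ∈ s, ((p W : ℂ) * Complex.exp ((L W ⬝ᵥ y : ℝ) * Complex.I)
        + (1 - p W))) * Complex.exp (-((∑ W ∈ s, p W * (L W ⬝ᵥ y) : ℝ) * Complex.I)) := by
      rw [bernoulliProd]
      simp only [bernoulliChar]
      rw [Finset.prod_mul_distrib, ← Complex.exp_sum]
      congr 1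
      · exact Finset.prod_congr rfl fun W _ => by ring
      · congr 1
        push_cast
        rw [Finset.sum_mul, Finset.sum_neg_distrib]
    have h2 : ∑ W ∈ s, p W * (L W ⬝ᵥ y) = ∑ j, (degreeForm n₀ W₀ d m j : ℝ) * y j := by
      simp only [dotProduct, Finset.mul_sum]
      rw [Finset.sum_comm]
      refine Finset.sum_congr rfl fun j _ => ?_
      rw [← sum_edgeProb_mul_edgeForm hr hβ hm, Finset.sum_mul]
      exact Finset.sum_congr rfl fun W _ => by ring
    rw [h1, h2, Finset.prod_add, Finset.sum_mul]
    refine Finset.sum_congr rfl fun H _ => ?_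
    have h3 : Complex.exp ((∑ j, (k H j : ℂ) * y j) * Complex.I) =
        Complex.exp (∑ W ∈ H, (L W ⬝ᵥ y : ℝ) * Complex.I) *
          Complex.exp (-((∑ j, (degreeForm n₀ W₀ d m j : ℝ) * y j : ℝ) * Complex.I)) := by
      rw [← Complex.exp_add, hk]
      congr 1
      push_cast
      simp only [sub_mul, Finset.sum_mul, Finset.sum_sub_distrib]
      rw [sub_eq_add_neg]
      congr 1
      rw [Finset.sum_comm]
      refine Finset.sum_congr rfl fun W _ => ?_
      rw [dotProduct, Complex.ofReal_sum, Finset.sum_mul]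
      refine Finset.sum_congr rfl fun j _ => ?_
      simp [hL, edgeForm]
    rw [Finset.prod_mul_distrib, ← Complex.exp_sum, h3]
    simp only [hwt]
    ring
  simp_rw [hexp]
  rw [integral_finsetSum _ fun H _ => integrableOn_torusCube (by fun_prop)]
  simp_rw [integral_const_mul, integral_torusCube_exp]
  have hval : ∀ H ∈ s.powerset, wt H * (if k H = 0 then ((2 * Real.pi) ^ n : ℂ) else 0) =
      if H ∈ familiesWithDegrees r d then (((2 * Real.pi) ^ n * ∏ W ∈ s,
        (p W ^ p W * (1 - p W) ^ (1 - p W)) : ℝ) : ℂ) else 0 := by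
    intro H hH
    have hiff : k H = 0 ↔ H ∈ familiesWithDegrees r d := by
      rw [← sum_edgeFormInt_eq_iff (n₀ := n₀) (W₀ := W₀) hr hm (Finset.mem_powerset.1 hH)]
      simp only [hk, funext_iff, Pi.zero_apply, sub_eq_zero]
    by_cases hmem : H ∈ familiesWithDegrees r d
    · rw [if_pos (hiff.2 hmem), if_pos hmem, ← prob_family_eq hβ hmem, hwt]
      push_cast; ring
    · rw [if_neg (mt hiff.1 hmem), if_neg hmem, mul_zero]
  rw [Finset.sum_congr rfl hval, ← Finset.sum_filter]
  have hfil : s.powerset.filter (· ∈ familiesWithDegrees r d) = familiesWithDegrees r d := by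
    ext H
    simp only [Finset.mem_filter, familiesWithDegrees]
    tauto
  rw [hfil, Finset.sum_const, ← numHypergraphs_eq_card, nsmul_eq_mul]
  push_cast
  ring

end Inversion

end

/-! ### The region away from the origin -/

section

open MeasureTheory Matrix

lemma one_sub_cos_sub_le (a b : ℝ) :
    1 - Real.cos (a - b) ≤ 2 * ((1 - Real.cos a) + (1 - Real.cos b)) := by
  have h : ∀ x : ℝ, 1 - Real.cos x = 2 * Real.sin (x / 2) ^ 2 := by
    intro x
    have := Real.cos_sq (x / 2)
    rw [Real.sin_sq, this]; ring_nf
  rw [h, h a, h b, show (a - b) / 2 = a / 2 - b / 2 by ring, Real.sin_sub]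
  set s := Real.sin (a / 2)
  set t := Real.sin (b / 2)
  set u := Real.cos (a / 2)
  set w := Real.cos (b / 2)
  have hu : u ^ 2 ≤ 1 := Real.cos_sq_le_one _
  have hw : w ^ 2 ≤ 1 := Real.cos_sq_le_one _
  nlinarith [sq_nonneg (s * w + u * t), mul_le_mul_of_nonneg_left hw (sq_nonneg s),
    mul_le_mul_of_nonneg_left hu (sq_nonneg t)]

section Far

variable {n r : ℕ} {n₀ : Fin n} {W₀ : Finset (Fin n)}

/-- Exchanging the vertex `j` of an `r`-set for `n₀`. -/
def swapVertex (n₀ j : Fin n) (W : Finset (Fin n)) : Finset (Fin n) := insert n₀ (W.erase j)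

lemma swapVertex_mem {j : Fin n} (hj : j ≠ n₀) {W : Finset (Fin n)}
    (hW : W ∈ (rSets n r).filter fun W => j ∈ W ∧ n₀ ∉ W) :
    swapVertex n₀ j W ∈ (rSets n r).filter fun W => n₀ ∈ W ∧ j ∉ W := by
  simp only [Finset.mem_filter, mem_rSets] at hW ⊢
  obtain ⟨hc, hjW, hnW⟩ := hW
  have h1 : n₀ ∉ W.erase j := fun h => hnW (Finset.mem_of_mem_erase h)
  refine ⟨?_, Finset.mem_insert_self _ _, by simp [swapVertex, hj]⟩
  rw [swapVertex, Finset.card_insert_of_notMem h1, Finset.card_erase_of_mem hjW, hc]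
  have : 0 < W.card := Finset.card_pos.2 ⟨j, hjW⟩
  omega

/-- The coordinate `y j` is the difference of the forms of two edges which differ by exchanging `j`
for `n₀`. -/
lemma edgeForm_sub_swapVertex {j : Fin n} (hj : j ≠ n₀) {W : Finset (Fin n)} (hjW : j ∈ W)
    (y : Fin n → ℝ) :
    edgeForm n₀ W₀ W ⬝ᵥ y - edgeForm n₀ W₀ (swapVertex n₀ j W) ⬝ᵥ y = y j := by
  rw [edgeForm_dotProduct, edgeForm_dotProduct, add_sub_add_left_eq_sub, ← Finset.sum_sub_distrib,
    Finset.sum_eq_single j]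
  · by_cases h : j ∈ W₀ <;> simp [hjW, swapVertex, hj, h]
  · intro k hk hkj
    have hkn := Finset.ne_of_mem_erase hk
    simp [swapVertex, hkj, hkn]
  · intro h; simp [hj] at h

/-- The edges through `j` but not `n₀` make up at least the fraction `1 / n` of all edges. -/
lemma choose_le_mul_choose (hr : 2 ≤ r) (hrn : r + 1 ≤ n) :
    (n.choose r : ℝ) ≤ n * (n - 2).choose (r - 1) := by
  obtain ⟨ha, -⟩ := choose_identities hr hrn
  have h1 : (2 : ℝ) ≤ r := by exact_mod_cast hr
  have h2 : (r : ℝ) + 1 ≤ n := by exact_mod_cast hrn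
  have h3 : (n : ℝ) - 1 ≤ r * (n - r) := by nlinarith
  have hN : (0 : ℝ) ≤ n.choose r := Nat.cast_nonneg _
  have h4 : n.choose r * ((n : ℝ) - 1) ≤ (n * (n - 2).choose (r - 1)) * ((n : ℝ) - 1) := by
    calc _ ≤ n.choose r * ((r : ℝ) * (n - r)) := by gcongr
      _ = _ := by rw [← ha]; ring
  exact le_of_mul_le_mul_right h4 (by linarith)

/-- Pairing the edges through `j` with those obtained by exchanging `j` for `n₀`. -/
lemma sum_one_sub_cos_ge (hr : 2 ≤ r) {j : Fin n} (hj : j ≠ n₀) (y : Fin n → ℝ) :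
    ((n - 2).choose (r - 1) : ℝ) * (1 - Real.cos (y j)) ≤
      2 * ∑ W ∈ rSets n r, (1 - Real.cos (edgeForm n₀ W₀ W ⬝ᵥ y)) := by
  classical
  set f : Finset (Fin n) → ℝ := fun W => 1 - Real.cos (edgeForm n₀ W₀ W ⬝ᵥ y) with hf
  have hf0 : ∀ W, 0 ≤ f W := fun W => sub_nonneg.2 (Real.cos_le_one _)
  set A := (rSets n r).filter fun W => j ∈ W ∧ n₀ ∉ W with hA
  set B := (rSets n r).filter fun W => n₀ ∈ W ∧ j ∉ W with hB
  have hinj : Set.InjOn (swapVertex n₀ j) A := by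
    intro W hW V hV h
    simp only [hA, Finset.coe_filter, Set.mem_ofPred_eq] at hW hV
    have h1 : ∀ U : Finset (Fin n), j ∈ U → n₀ ∉ U →
        insert j ((swapVertex n₀ j U).erase n₀) = U := by
      intro U hjU hnU
      rw [swapVertex, Finset.erase_insert fun h => hnU (Finset.mem_of_mem_erase h),
        Finset.insert_erase hjU]
    rw [← h1 W hW.2.1 hW.2.2, ← h1 V hV.2.1 hV.2.2, h]
  have hdisj : Disjoint A B := Finset.disjoint_left.2 fun W hW hW' =>
    (Finset.mem_filter.1 hW').2.2 (Finset.mem_filter.1 hW).2.1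
  have h1 : ∑ W ∈ A, f (swapVertex n₀ j W) ≤ ∑ W ∈ B, f W := by
    rw [← Finset.sum_image (f := f) hinj]
    refine Finset.sum_le_sum_of_subset_of_nonneg ?_ fun W _ _ => hf0 W
    intro W hW
    obtain ⟨V, hV, rfl⟩ := Finset.mem_image.1 hW
    exact swapVertex_mem hj hV
  have h2 : ∑ W ∈ A, f W + ∑ W ∈ B, f W ≤ ∑ W ∈ rSets n r, f W := by
    rw [← Finset.sum_union hdisj]
    exact Finset.sum_le_sum_of_subset_of_nonneg
      (Finset.union_subset (Finset.filter_subset _ _) (Finset.filter_subset _ _)) fun W _ _ => hf0 W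
  have h3 : (A.card : ℝ) * (1 - Real.cos (y j)) ≤ ∑ W ∈ A, 2 * (f W + f (swapVertex n₀ j W)) := by
    rw [← nsmul_eq_mul]
    refine Finset.card_nsmul_le_sum _ _ _ fun W hW => ?_
    rw [← edgeForm_sub_swapVertex (W₀ := W₀) hj (Finset.mem_filter.1 hW).2.1 y]
    exact one_sub_cos_sub_le _ _
  rw [card_rSets_mem_notMem hr hj, ← Finset.mul_sum, Finset.sum_add_distrib] at h3
  linarith

/-- The slab of width `1` meets no other period: on it all coordinates are at most `2 < π`. -/
lemma slab_subset_torusCube (hr : 2 ≤ r) (hrn : r + 1 ≤ n) (hW₀ : W₀ ∈ rSets n r) :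
    slab (rSets n r) (edgeForm n₀ W₀) 1 ⊆ torusCube n := by
  intro y hy
  have hpi := Real.pi_gt_three
  have hb : ∀ j, |y j| ≤ 2 := by
    intro j
    by_cases hj : j = n₀
    · have h1 := hy W₀ hW₀
      rw [edgeForm_dotProduct] at h1
      simp only [sub_self, zero_mul, Finset.sum_const_zero, add_zero] at h1
      rw [hj]; linarith
    · have hpos : 0 < ((rSets n r).filter fun W => j ∈ W ∧ n₀ ∉ W).card := by
        rw [card_rSets_mem_notMem hr hj]
        exact Nat.choose_pos (by omega)
      obtain ⟨W, hW⟩ := Finset.card_pos.1 hpos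
      have h1 := hy W (Finset.mem_filter.1 hW).1
      have h2 := hy _ (Finset.mem_filter.1 (swapVertex_mem hj hW)).1
      rw [← edgeForm_sub_swapVertex (W₀ := W₀) hj (Finset.mem_filter.1 hW).2.1 y]
      exact (abs_sub _ _).trans (by linarith)
  refine Set.mem_univ_pi.2 fun j => ?_
  have := abs_le.1 (hb j)
  constructor <;> linarith [this.1, this.2]

lemma abs_edgeForm_sub_le {q : ℕ} (hq : q = min r (n - r))
    (hW₀ : W₀ ∈ rSets n r) {W : Finset (Fin n)} (hW : W ∈ rSets n r) {t : ℝ} {y : Fin n → ℝ}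
    (ht : 0 ≤ t) (hy : ∀ j, j ≠ n₀ → |y j| ≤ t) :
    |edgeForm n₀ W₀ W ⬝ᵥ y - y n₀| ≤ 2 * q * t := by
  rw [edgeForm_dotProduct, add_sub_cancel_left]
  have hd : ∀ U V : Finset (Fin n), U ∈ rSets n r → V ∈ rSets n r → (U \ V).card ≤ q := by
    intro U V hU hV
    rw [hq]
    refine le_min ((Finset.card_le_card Finset.sdiff_subset).trans (mem_rSets.1 hU).le) ?_
    refine (Finset.card_le_card (Finset.sdiff_subset_sdiff (Finset.subset_univ U) le_rfl)).trans ?_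
    rw [Finset.card_sdiff_of_subset (Finset.subset_univ V), mem_rSets.1 hV]
    simp
  have hind : ∀ j, |(if j ∈ W then (1 : ℝ) else 0) - (if j ∈ W₀ then 1 else 0)| =
      (if j ∈ W \ W₀ then 1 else 0) + (if j ∈ W₀ \ W then 1 else 0) := by
    intro j
    by_cases h1 : j ∈ W <;> by_cases h2 : j ∈ W₀ <;> simp [h1, h2]
  calc _ ≤ ∑ j ∈ Finset.univ.erase n₀,
        |((if j ∈ W then (1 : ℝ) else 0) - (if j ∈ W₀ then 1 else 0)) * y j| :=
        Finset.abs_sum_le_sum_abs _ _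
    _ ≤ ∑ j ∈ Finset.univ.erase n₀,
        ((if j ∈ W \ W₀ then (1 : ℝ) else 0) + (if j ∈ W₀ \ W then 1 else 0)) * t := by
        refine Finset.sum_le_sum fun j hj => ?_
        rw [abs_mul, hind]
        exact mul_le_mul_of_nonneg_left (hy j (Finset.ne_of_mem_erase hj))
          (by split_ifs <;> norm_num)
    _ ≤ ∑ j, ((if j ∈ W \ W₀ then (1 : ℝ) else 0) + (if j ∈ W₀ \ W then 1 else 0)) * t :=
        Finset.sum_le_sum_of_subset_of_nonneg (Finset.subset_univ _) fun j _ _ =>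
          mul_nonneg (by split_ifs <;> norm_num) ht
    _ = (((W \ W₀).card : ℝ) + (W₀ \ W).card) * t := by
        rw [← Finset.sum_mul, Finset.sum_add_distrib]
        simp only [Finset.sum_ite_mem, Finset.univ_inter, Finset.sum_const, nsmul_eq_mul, mul_one]
    _ ≤ ((q : ℝ) + q) * t := by
        have h1 : ((W \ W₀).card : ℝ) ≤ q := by exact_mod_cast hd W W₀ hW hW₀
        have h2 : ((W₀ \ W).card : ℝ) ≤ q := by exact_mod_cast hd W₀ W hW₀ hW
        gcongr
    _ = _ := by ring

/-- Away from the slab of width `1`, either some coordinate `y j`, which is a difference of two edge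
forms, is not small, or all edge forms are bounded away from `2πℤ`. -/
lemma sum_one_sub_cos_ge_of_notMem_slab (hr : 2 ≤ r) (hrn : r + 1 ≤ n) {q : ℕ}
    (hq : q = min r (n - r)) (hW₀ : W₀ ∈ rSets n r) {y : Fin n → ℝ} (hyc : y ∈ torusCube n)
    (hy : y ∉ slab (rSets n r) (edgeForm n₀ W₀) 1) :
    (n.choose r : ℝ) / (640 * (n * (q : ℝ) ^ 2)) ≤
      ∑ W ∈ rSets n r, (1 - Real.cos (edgeForm n₀ W₀ W ⬝ᵥ y)) := by
  have hn1 : (1 : ℝ) ≤ n := by exact_mod_cast (by omega : 1 ≤ n)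
  have hq1 : (1 : ℝ) ≤ q := by exact_mod_cast (by omega : 1 ≤ q)
  have hN : (0 : ℝ) ≤ n.choose r := Nat.cast_nonneg _
  have hpi : Real.pi ^ 2 ≤ 10 := by nlinarith [Real.pi_lt_d2, Real.pi_gt_three]
  have hpi0 := Real.pi_pos
  have hpi3 := Real.pi_gt_three
  have hyb : ∀ j, |y j| ≤ Real.pi := by
    intro j
    have := Set.mem_univ_pi.1 hyc j
    exact abs_le.2 ⟨this.1.le, this.2⟩
  have hquad : ∀ {x t : ℝ}, 0 ≤ t → t ≤ |x| → |x| ≤ Real.pi → t ^ 2 / 5 ≤ 1 - Real.cos x := by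
    intro x t ht htx hx
    have h1 := Real.cos_le_one_sub_mul_cos_sq hx
    have h2 : t ^ 2 ≤ x ^ 2 := by rw [← sq_abs x]; gcongr
    have h3 : (1 : ℝ) / 5 ≤ 2 / Real.pi ^ 2 := by
      rw [div_le_div_iff₀ (by norm_num) (by positivity)]; linarith
    nlinarith [mul_le_mul h3 h2 (sq_nonneg t) (by positivity)]
  by_cases hcase : ∃ j, j ≠ n₀ ∧ 1 / (8 * (q : ℝ)) < |y j|
  · obtain ⟨j, hj, hjy⟩ := hcase
    have h1 := sum_one_sub_cos_ge (W₀ := W₀) hr hj y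
    have h2 := hquad (by positivity) hjy.le (hyb j)
    have h3 := choose_le_mul_choose hr hrn
    have h4 : (n.choose r : ℝ) / (640 * (n * (q : ℝ) ^ 2)) * 2 =
        n.choose r / n * ((1 / (8 * (q : ℝ))) ^ 2 / 5) := by field_simp; ring
    have h5 : (n.choose r : ℝ) / n ≤ (n - 2).choose (r - 1) := by
      rw [div_le_iff₀ (by linarith)]; linarith
    have h6 : n.choose r / n * ((1 / (8 * (q : ℝ))) ^ 2 / 5) ≤
        ((n - 2).choose (r - 1) : ℝ) * (1 - Real.cos (y j)) :=
      mul_le_mul h5 h2 (by positivity) (Nat.cast_nonneg _)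
    linarith
  · push Not at hcase
    have hdev : ∀ W ∈ rSets n r, |edgeForm n₀ W₀ W ⬝ᵥ y - y n₀| ≤ 1 / 4 := by
      intro W hW
      refine (abs_edgeForm_sub_le hq hW₀ hW (by positivity) hcase).trans (le_of_eq ?_)
      field_simp; norm_num
    have h0 : 1 / 2 < |y n₀| := by
      by_contra hle
      push Not at hle
      refine hy fun W hW => ?_
      have := abs_sub_abs_le_abs_sub (edgeForm n₀ W₀ W ⬝ᵥ y) (y n₀)
      have := hdev W hW
      linarith
    have hterm : ∀ W ∈ rSets n r, (1 : ℝ) / 80 ≤ 1 - Real.cos (edgeForm n₀ W₀ W ⬝ᵥ y) := by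
      intro W hW
      have h1 := abs_sub_abs_le_abs_sub (edgeForm n₀ W₀ W ⬝ᵥ y) (y n₀)
      have h2 := abs_sub_abs_le_abs_sub (y n₀) (edgeForm n₀ W₀ W ⬝ᵥ y)
      rw [abs_sub_comm] at h2
      have h3 := hdev W hW
      have h4 := hyb n₀
      set x := edgeForm n₀ W₀ W ⬝ᵥ y
      rcases le_total |x| Real.pi with h5 | h5
      · have := hquad (t := 1 / 4) (by norm_num) (by linarith) h5
        norm_num at this ⊢; linarith
      · have := Real.cos_nonpos_of_pi_div_two_le_of_le (x := |x|) (by linarith) (by linarith)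
        rw [Real.cos_abs] at this
        linarith
    have h1 := Finset.card_nsmul_le_sum (rSets n r) _ _ hterm
    rw [card_rSets, nsmul_eq_mul] at h1
    refine le_trans ?_ h1
    rw [div_eq_mul_one_div]
    gcongr
    nlinarith [one_le_pow₀ hq1 (n := 2)]

lemma norm_bernoulliProd_le_of_notMem_slab (hr : 2 ≤ r) (hrn : r + 1 ≤ n) {q : ℕ}
    (hq : q = min r (n - r)) (hW₀ : W₀ ∈ rSets n r) {p : Finset (Fin n) → ℝ} {m : ℝ} (hm : 0 ≤ m)
    (hp : ∀ W ∈ rSets n r, m ≤ bernoulliVar p W) {y : Fin n → ℝ} (hyc : y ∈ torusCube n)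
    (hy : y ∉ slab (rSets n r) (edgeForm n₀ W₀) 1) :
    ‖bernoulliProd (rSets n r) p (edgeForm n₀ W₀) y‖
      ≤ Real.exp (-(n.choose r * m / (640 * (n * (q : ℝ) ^ 2)))) := by
  have h := sum_one_sub_cos_ge_of_notMem_slab hr hrn hq hW₀ hyc hy
  rw [bernoulliProd, norm_prod]
  calc _ ≤ ∏ W ∈ rSets n r, Real.exp (-(m * (1 - Real.cos (edgeForm n₀ W₀ W ⬝ᵥ y)))) := by
        refine Finset.prod_le_prod (fun _ _ => norm_nonneg _) fun W hW => ?_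
        refine (norm_bernoulliChar_le _ _).trans (Real.exp_le_exp.2 (neg_le_neg ?_))
        exact mul_le_mul_of_nonneg_right (hp W hW) (sub_nonneg.2 (Real.cos_le_one _))
    _ = Real.exp (-(m * ∑ W ∈ rSets n r, (1 - Real.cos (edgeForm n₀ W₀ W ⬝ᵥ y)))) := by
        rw [← Real.exp_sum, Finset.sum_neg_distrib, Finset.mul_sum]
    _ ≤ _ := by
        refine Real.exp_le_exp.2 (neg_le_neg ?_)
        calc _ = m * (n.choose r / (640 * (n * (q : ℝ) ^ 2))) := by ring
          _ ≤ _ := by gcongr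

/-- A crude lower bound for the Gaussian mass, from a small box around the origin. -/
lemma le_gaussMass {p : Finset (Fin n) → ℝ}
    (hH : (edgePrecision r n₀ W₀ p).PosDef) {m τ : ℝ} (hτ : 0 ≤ τ)
    (hp0 : ∀ W ∈ rSets n r, 0 ≤ bernoulliVar p W)
    (hp : ∀ W ∈ rSets n r, bernoulliVar p W ≤ m) (hmτ : n.choose r * m * (n * τ) ^ 2 ≤ 2) :
    Real.exp (-1) * (2 * τ) ^ n ≤ gaussMass (edgePrecision r n₀ W₀ p) := by
  set H := edgePrecision r n₀ W₀ p with hHd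
  set S : Set (Fin n → ℝ) := Set.univ.pi fun _ => Set.Ioc (-τ) τ with hS
  have hmS : MeasurableSet S := MeasurableSet.univ_pi fun _ => measurableSet_Ioc
  have hvol : volume.real S = (2 * τ) ^ n := by
    rw [hS, Measure.real, Real.volume_pi_Ioc_toReal]
    · simp; ring
    · intro i; linarith
  have hfin : volume S ≠ ⊤ := by
    rw [hS, Real.volume_pi_Ioc]
    exact (ENNReal.prod_lt_top fun _ _ => ENNReal.ofReal_lt_top).ne
  have hpt : ∀ y ∈ S, Real.exp (-1) ≤ Real.exp (-(y ⬝ᵥ H *ᵥ y) / 2) := by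
    intro y hy
    refine Real.exp_le_exp.2 ?_
    have hyb : ∀ j, |y j| ≤ τ := fun j => by
      have := Set.mem_univ_pi.1 hy j
      exact abs_le.2 ⟨this.1.le, this.2⟩
    have hx : ∀ W : Finset (Fin n), |edgeForm n₀ W₀ W ⬝ᵥ y| ≤ n * τ := by
      intro W
      calc _ ≤ ∑ j, |edgeForm n₀ W₀ W j * y j| := Finset.abs_sum_le_sum_abs _ _
        _ ≤ ∑ j : Fin n, τ := by
            refine Finset.sum_le_sum fun j _ => ?_
            rw [abs_mul]
            have : |edgeForm n₀ W₀ W j| ≤ 1 := by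
              rw [edgeForm_apply]; split_ifs <;> norm_num
            calc _ ≤ 1 * τ := mul_le_mul this (hyb j) (abs_nonneg _) zero_le_one
              _ = τ := one_mul τ
        _ = n * τ := by simp
    have hQ : y ⬝ᵥ H *ᵥ y ≤ n.choose r * (m * (n * τ) ^ 2) := by
      rw [hHd, edgePrecision, dotProduct_precision_mulVec, ← card_rSets, ← nsmul_eq_mul]
      refine Finset.sum_le_card_nsmul _ _ _ fun W hW => ?_
      rw [mul_assoc, ← sq, ← sq_abs]
      have h1 := hp0 W hW
      have h2 := hp W hW
      have h3 := hx W
      have hm0 : 0 ≤ m := h1.trans h2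
      gcongr
    linarith
  rw [← integral_exp_neg_quadForm hH]
  have hint := integrable_exp_neg_quadForm hH
  calc Real.exp (-1) * (2 * τ) ^ n = ∫ _ in S, Real.exp (-1) := by
        rw [setIntegral_const, hvol, smul_eq_mul, mul_comm]
    _ ≤ ∫ y in S, Real.exp (-(y ⬝ᵥ H *ᵥ y) / 2) :=
        setIntegral_mono_on (integrableOn_const hfin) hint.integrableOn hmS hpt
    _ ≤ _ := setIntegral_le_integral hint (ae_of_all _ fun y => (Real.exp_pos _).le)

end Far

end

/-! ### Comparing edge probabilities with the density -/

section

open MeasureTheory Matrix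

section Density

variable {n r : ℕ} {β : Fin n → ℝ} {d : Fin n → ℕ}

lemma edgeProb_le_exp_mul {B : ℝ} {W W' : Finset (Fin n)}
    (h : |∑ j ∈ W, β j - ∑ j ∈ W', β j| ≤ B) :
    edgeProb β W ≤ Real.exp B * edgeProb β W' ∧
      1 - edgeProb β W ≤ Real.exp B * (1 - edgeProb β W') := by
  have h0 : 0 ≤ B := (abs_nonneg _).trans h
  have hB : 1 ≤ Real.exp B := Real.one_le_exp h0
  have h1 : Real.exp (∑ j ∈ W, β j) ≤ Real.exp B * Real.exp (∑ j ∈ W', β j) := by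
    rw [← Real.exp_add]; exact Real.exp_le_exp.2 (by linarith [(abs_le.1 h).2])
  have h2 : Real.exp (∑ j ∈ W', β j) ≤ Real.exp B * Real.exp (∑ j ∈ W, β j) := by
    rw [← Real.exp_add]; exact Real.exp_le_exp.2 (by linarith [(abs_le.1 h).1])
  rw [one_sub_edgeProb, one_sub_edgeProb, edgeProb, edgeProb]
  set x := Real.exp (∑ j ∈ W, β j)
  set x' := Real.exp (∑ j ∈ W', β j)
  have hx : 0 < x := Real.exp_pos _
  have hx' : 0 < x' := Real.exp_pos _
  constructor
  · rw [← mul_div_assoc, div_le_div_iff₀ (by positivity) (by positivity)]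
    nlinarith [mul_pos hx hx']
  · rw [← div_eq_mul_inv, inv_eq_one_div, div_le_div_iff₀ (by positivity) (by positivity)]
    nlinarith

/-- The exponents `∑_{j ∈ W} β_j` of two edges differ by a bounded amount: the edges differ in at
most `2 min(r, n - r)` vertices. -/
lemma abs_sum_sub_sum_le (hr : 1 ≤ r) (hrn : r + 1 ≤ n) {C : ℝ}
    (hC : ∀ j k, |β j - β k| ≤ C * ((n : ℝ) / (r * ((n : ℝ) - r))))
    {W W' : Finset (Fin n)} (hW : W ∈ rSets n r) (hW' : W' ∈ rSets n r) :
    |∑ j ∈ W, β j - ∑ j ∈ W', β j| ≤ 4 * C := by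
  have n₀ : Fin n := ⟨0, by omega⟩
  have hr1 : (1 : ℝ) ≤ r := by exact_mod_cast hr
  have hrn1 : (r : ℝ) + 1 ≤ n := by exact_mod_cast hrn
  have hpos : 0 < (r : ℝ) * (n - r) := mul_pos (by linarith) (by linarith)
  have ht := (abs_nonneg _).trans (hC n₀ n₀)
  have hCn : 0 ≤ C := by
    by_contra hneg
    exact absurd ht (not_le.2 (mul_neg_of_neg_of_pos (not_le.1 hneg) (div_pos (by linarith) hpos)))
  have h := abs_edgeForm_sub_le (n₀ := n₀) (W₀ := W') rfl hW' hW ht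
    (y := coordMatrix n₀ W' *ᵥ β) fun j hj => by
      rw [coordMatrix_mulVec, if_neg hj]; exact hC j n₀
  rw [edgeForm_dotProduct_coordMatrix ((mem_rSets.1 hW).trans (mem_rSets.1 hW').symm),
    coordMatrix_mulVec, if_pos rfl] at h
  refine h.trans ?_
  have hq : ((min r (n - r) : ℕ) : ℝ) * n ≤ 2 * (r * (n - r)) := by
    have hcast : ((n - r : ℕ) : ℝ) = n - r := Nat.cast_sub (by omega)
    rcases le_total r (n - r) with h1 | h1
    · rw [min_eq_left h1]
      have : (r : ℝ) ≤ n - r := by rw [← hcast]; exact_mod_cast h1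
      nlinarith
    · rw [min_eq_right h1, hcast]
      have : (n : ℝ) - r ≤ r := by rw [← hcast]; exact_mod_cast h1
      nlinarith
  calc _ = 2 * C * (((min r (n - r) : ℕ) : ℝ) * n / (r * (n - r))) := by ring
    _ ≤ 2 * C * 2 := by
        refine mul_le_mul_of_nonneg_left ?_ (by linarith)
        rwa [div_le_iff₀ hpos]
    _ = 4 * C := by ring

/-- The density is the average of the edge probabilities. -/
lemma density_mul_choose (hr : 1 ≤ r) (hrn : r ≤ n) (hβ : IsBetaSolution r d β) :
    density r d * n.choose r = ∑ W ∈ rSets n r, edgeProb β W := by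
  have hr1 : (0 : ℝ) < r := by exact_mod_cast hr
  have hn1 : (0 : ℝ) < n := by exact_mod_cast (by omega : 0 < n)
  have hc : (0 : ℝ) < (n - 1).choose (r - 1) := by exact_mod_cast Nat.choose_pos (by omega)
  have hid : (n : ℝ) * (n - 1).choose (r - 1) = n.choose r * r := by
    have := Nat.add_one_mul_choose_eq (n - 1) (r - 1)
    rw [Nat.sub_add_cancel hr, Nat.sub_add_cancel (hr.trans hrn)] at this
    exact_mod_cast this
  rw [density, ← sum_edgeProb hβ, div_div, hid, div_mul_eq_mul_div,
    mul_comm (n.choose r : ℝ) (r : ℝ), mul_assoc, mul_div_mul_left _ _ hr1.ne', mul_div_assoc,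
    div_self, mul_one]
  exact_mod_cast (Nat.choose_pos hrn).ne'

/-- All variances `λ_W (1 - λ_W)` are within a constant factor of `λ (1 - λ)`. -/
lemma exists_bound_density (hr : 1 ≤ r) (hrn : r + 1 ≤ n) (hβ : IsBetaSolution r d β) {C : ℝ}
    (hC : ∀ j k, |β j - β k| ≤ C * ((n : ℝ) / (r * ((n : ℝ) - r)))) :
    0 < density r d * (1 - density r d) ∧
    ∀ W ∈ rSets n r,
      density r d * (1 - density r d) ≤ Real.exp (8 * C) * bernoulliVar (edgeProb β) W ∧
      bernoulliVar (edgeProb β) W ≤ Real.exp (8 * C) * (density r d * (1 - density r d)) := by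
  set lam := density r d with hlam
  have hN : (0 : ℝ) < n.choose r := by exact_mod_cast Nat.choose_pos (by omega : r ≤ n)
  have hsum := density_mul_choose hr (by omega) hβ
  have hsum' : (1 - lam) * n.choose r = ∑ W ∈ rSets n r, (1 - edgeProb β W) := by
    rw [Finset.sum_sub_distrib, ← hsum, Finset.sum_const, card_rSets, nsmul_eq_mul]; ring
  have hcomp := fun {W W'} (hW : W ∈ rSets n r) (hW' : W' ∈ rSets n r) =>
    edgeProb_le_exp_mul (abs_sum_sub_sum_le hr hrn hC hW hW')
  have hne : (rSets n r).Nonempty := by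
    rw [← Finset.card_pos, card_rSets]; exact Nat.choose_pos (by omega)
  -- an average lies between the bounds for its terms
  have avg_le : ∀ {x b : ℝ} {f : Finset (Fin n) → ℝ}, x * n.choose r = ∑ W ∈ rSets n r, f W →
      (∀ W ∈ rSets n r, f W ≤ b) → x ≤ b := by
    intro x b f h hb
    have := Finset.sum_le_card_nsmul _ _ _ hb
    rw [← h, card_rSets, nsmul_eq_mul, mul_comm] at this
    exact le_of_mul_le_mul_left this hN
  have le_avg : ∀ {x b : ℝ} {f : Finset (Fin n) → ℝ}, x * n.choose r = ∑ W ∈ rSets n r, f W →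
      (∀ W ∈ rSets n r, b ≤ f W) → b ≤ x := by
    intro x b f h hb
    have := Finset.card_nsmul_le_sum _ _ _ hb
    rw [← h, card_rSets, nsmul_eq_mul, mul_comm x] at this
    exact le_of_mul_le_mul_left this hN
  have hl0 : 0 < lam := by
    refine pos_of_mul_pos_left (b := (n.choose r : ℝ)) ?_ hN.le
    rw [hsum]; exact Finset.sum_pos (fun W _ => edgeProb_pos β W) hne
  have hl1 : 0 < 1 - lam := by
    refine pos_of_mul_pos_left (b := (n.choose r : ℝ)) ?_ hN.le
    rw [hsum']; exact Finset.sum_pos (fun W _ => sub_pos.2 (edgeProb_lt_one β W)) hne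
  refine ⟨mul_pos hl0 hl1, fun W hW => ?_⟩
  have hE : Real.exp (8 * C) = Real.exp (4 * C) * Real.exp (4 * C) := by
    rw [← Real.exp_add]; congr 1; ring
  have he := Real.exp_pos (4 * C)
  have hp0 := edgeProb_pos β W
  have hp1 : 0 < 1 - edgeProb β W := sub_pos.2 (edgeProb_lt_one β W)
  have a1 : lam ≤ Real.exp (4 * C) * edgeProb β W := avg_le hsum fun V hV => (hcomp hV hW).1
  have a2 : 1 - lam ≤ Real.exp (4 * C) * (1 - edgeProb β W) :=
    avg_le hsum' fun V hV => (hcomp hV hW).2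
  have hflip : ∀ {x y : ℝ}, x ≤ Real.exp (4 * C) * y → x / Real.exp (4 * C) ≤ y := fun h => by
    rwa [div_le_iff₀' he]
  have b1 : edgeProb β W ≤ Real.exp (4 * C) * lam := by
    rw [← div_le_iff₀' he]; exact le_avg hsum fun V hV => hflip (hcomp hW hV).1
  have b2 : 1 - edgeProb β W ≤ Real.exp (4 * C) * (1 - lam) := by
    rw [← div_le_iff₀' he]; exact le_avg hsum' fun V hV => hflip (hcomp hW hV).2
  rw [hE, bernoulliVar]
  constructor
  · calc _ ≤ (Real.exp (4 * C) * edgeProb β W) * (Real.exp (4 * C) * (1 - edgeProb β W)) :=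
        mul_le_mul a1 a2 hl1.le (by positivity)
      _ = _ := by ring
  · calc _ ≤ (Real.exp (4 * C) * lam) * (Real.exp (4 * C) * (1 - lam)) :=
        mul_le_mul b1 b2 hp1.le (by positivity)
      _ = _ := by ring

end Density

end

/-! ### The integral over the torus -/

section

open MeasureTheory Matrix

section Laplace

lemma choose_le_pow_min {n r q : ℕ} (hrn : r ≤ n) (hq : q = min r (n - r)) :
    (n.choose r : ℝ) ≤ (n : ℝ) ^ q := by
  have h : n.choose r ≤ n ^ q := by
    rcases min_cases r (n - r) with ⟨h, -⟩ | ⟨h, -⟩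
    · rw [hq, h]; exact Nat.choose_le_pow n r
    · rw [hq, h, ← Nat.choose_symm hrn]; exact Nat.choose_le_pow n (n - r)
  exact_mod_cast h

/-- The union bound over `N ≤ n ^ q` edges is absorbed by the Gaussian tail. -/
lemma mul_exp_neg_inv_le {n N a : ℝ} {q : ℕ} (hn : 1 ≤ n) (hq : 1 ≤ q) (hN : N ≤ n ^ q)
    (ha : 0 < a) (h : 2048 * a * ((q : ℝ) ^ 2 * Real.log n) ≤ 1) :
    n * N * Real.exp (-1 / (512 * a)) ≤ 1024 * a := by
  have hq1 : (1 : ℝ) ≤ q := by exact_mod_cast hq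
  have hlog : 0 ≤ Real.log n := Real.log_nonneg hn
  have hn0 : 0 < n := by linarith
  set X := Real.exp (1 / (1024 * a)) with hX
  have hX0 : 0 < X := Real.exp_pos _
  have h1 : n * N ≤ X := by
    calc n * N ≤ n * n ^ q := by gcongr
      _ = Real.exp ((q + 1) * Real.log n) := by
        rw [← pow_succ', mul_comm, ← Real.rpow_def_of_pos hn0]
        exact_mod_cast (Real.rpow_natCast n (q + 1)).symm
      _ ≤ X := by
        refine Real.exp_le_exp.2 ?_
        rw [le_div_iff₀ (by positivity)]
        have h2 : (q : ℝ) + 1 ≤ 2 * q ^ 2 := by nlinarith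
        have h3 : 0 ≤ a * Real.log n := by positivity
        nlinarith [mul_le_mul_of_nonneg_left h2 h3]
  have h2 : Real.exp (-1 / (512 * a)) = X⁻¹ * X⁻¹ := by
    rw [hX, ← Real.exp_neg, ← Real.exp_add]
    congr 1
    field_simp; norm_num
  have h3 : X⁻¹ ≤ 1024 * a := by
    rw [inv_le_comm₀ hX0 (by positivity), ← one_div]
    linarith [Real.add_one_le_exp (1 / (1024 * a))]
  calc n * N * Real.exp (-1 / (512 * a)) ≤ X * (X⁻¹ * X⁻¹) := by rw [h2]; gcongr
    _ = X⁻¹ := by field_simp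
    _ ≤ _ := h3

/-- If `Y ≤ n ^ 4`, then `M ≥ c Y log n` with `c` large implies `M ≥ c' Y log M`. -/
lemma log_mul_le {n D M Y : ℝ} (hD : 1 ≤ D) (hn : 7680 * D ≤ n) (hY0 : 0 < Y) (hY : Y ≤ n ^ 4)
    (hM : 100000 * D * (Y * Real.log n) ≤ M) : 3840 * D * Real.log M * Y ≤ M := by
  have hD0 : 0 < D := by linarith
  have hn7 : (7680 : ℝ) ≤ n := by linarith
  have hn0 : 0 < n := by linarith
  have hlog : 1 ≤ Real.log n := by
    rw [Real.le_log_iff_exp_le hn0]; linarith [Real.exp_one_lt_d9]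
  set u := M / Y with hu
  have hMu : M = u * Y := by rw [hu]; field_simp
  have hu1 : 100000 * D * Real.log n ≤ u := by
    rw [hu, le_div_iff₀ hY0]; linarith
  have hu0 : 0 < u := lt_of_lt_of_le (by positivity) hu1
  have h1 : Real.log M = Real.log u + Real.log Y := by rw [hMu, Real.log_mul hu0.ne' hY0.ne']
  have h2 : Real.log Y ≤ 4 * Real.log n := by
    have := Real.log_le_log hY0 hY
    rwa [Real.log_pow] at this
  have h3 : Real.log u ≤ u / (7680 * D) + Real.log (7680 * D) := by
    have := Real.log_le_sub_one_of_pos (x := u / (7680 * D)) (by positivity)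
    rw [Real.log_div hu0.ne' (by positivity)] at this
    linarith
  have h4 : Real.log (7680 * D) ≤ Real.log n := Real.log_le_log (by positivity) hn
  have h5 : Real.log M ≤ 5 * Real.log n + u / (7680 * D) := by linarith
  have h6 : 3840 * D * Real.log M ≤ u := by
    calc _ ≤ 3840 * D * (5 * Real.log n + u / (7680 * D)) := by gcongr
      _ = 19200 * (D * Real.log n) + u / 2 := by field_simp; ring
      _ ≤ u := by linarith
  rw [hMu]
  rw [hMu] at h6
  gcongr

/-- The contribution of the far region, of exponential order `-M / (n q²)`, is small compared with
the crude lower bound `(n √(D M)) ^ (-n)` for the Gaussian mass. -/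
lemma volume_mul_exp_neg_le {n q : ℕ} {D M : ℝ} (hD : 1 ≤ D) (hq : 1 ≤ q) (hqn : q ≤ n)
    (hn : 7680 * D ≤ n) (hM : 100000 * D * ((n : ℝ) ^ 2 * (q : ℝ) ^ 2 * Real.log n) ≤ M) :
    (2 * Real.pi) ^ n * Real.exp (-(M / (640 * D * (n * (q : ℝ) ^ 2))))
      ≤ (D * n ^ 2 / M) * (Real.exp (-1) * (2 * (1 / (n * √(D * M)))) ^ n) := by
  have hD0 : 0 < D := by linarith
  have hq1 : (1 : ℝ) ≤ q := by exact_mod_cast hq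
  have hqn1 : (q : ℝ) ≤ n := by exact_mod_cast hqn
  have hn7 : (7680 : ℝ) ≤ n := by linarith
  have hn0 : (0 : ℝ) < n := by linarith
  have hlog : 1 ≤ Real.log n := by
    rw [Real.le_log_iff_exp_le hn0]; linarith [Real.exp_one_lt_d9]
  have hYn : (n : ℝ) ^ 2 * (q : ℝ) ^ 2 ≤ (n : ℝ) ^ 4 := by
    calc _ ≤ (n : ℝ) ^ 2 * (n : ℝ) ^ 2 := by gcongr
      _ = _ := by ring
  have hlogM := log_mul_le hD hn (by positivity) hYn hM
  have hMn : 100000 * D * (n : ℝ) ^ 2 ≤ M := by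
    refine le_trans ?_ hM
    gcongr
    have h1 : 1 ≤ (q : ℝ) ^ 2 := one_le_pow₀ hq1
    calc (n : ℝ) ^ 2 = (n : ℝ) ^ 2 * 1 * 1 := by ring
      _ ≤ _ := by gcongr
  have hn2 : 1 ≤ (n : ℝ) ^ 2 := one_le_pow₀ (by linarith)
  have hDn2 : 1 ≤ D * (n : ℝ) ^ 2 := one_le_mul_of_one_le_of_one_le hD hn2
  have hM1 : 1 ≤ M := by linarith
  have hM0 : 0 < M := by linarith
  have hDM : 1 ≤ D * M := one_le_mul_of_one_le_of_one_le hD hM1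
  have hDn : 1 ≤ 4 * D * (n : ℝ) := one_le_mul_of_one_le_of_one_le (by linarith) (by linarith)
  -- `Z` dominates `2π / T`, `M / (D n²)` and `e`, so that the claim reduces to
  -- `(n + 2) log Z ≤ M / (640 D n q²)`
  set Z := 4 * D * n * M with hZ
  have hZ1 : 1 ≤ Z := one_le_mul_of_one_le_of_one_le hDn hM1
  have hZ0 : 0 < Z := by linarith
  have hs0 : 0 < √(D * M) := Real.sqrt_pos.2 (by linarith)
  have hss : √(D * M) ^ 2 = D * M := Real.sq_sqrt (by linarith)
  have hs1 : 1 ≤ √(D * M) := Real.one_le_sqrt.2 hDM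
  set T := 2 * (1 / (n * √(D * M))) with hT
  have hT0 : 0 < T := by positivity
  have h1 : 2 * Real.pi ≤ Z * T := by
    have : Z * T = 8 * √(D * M) := by
      rw [hZ, hT]
      field_simp
      linear_combination (-8 : ℝ) * hss
    rw [this]; linarith [Real.pi_lt_four]
  have hZM : Real.log Z ≤ 2 * Real.log M := by
    have h2 : 4 * D * (n : ℝ) ≤ M := by
      have : D * (n : ℝ) * 1 ≤ D * n * n := by gcongr; linarith
      nlinarith
    have h3 : Z ≤ M ^ 2 := by rw [hZ, sq]; gcongr
    have := Real.log_le_log hZ0 h3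
    rwa [Real.log_pow] at this
  have hE : Real.exp (-(M / (640 * D * (n * (q : ℝ) ^ 2)))) ≤ (Z ^ (n + 2))⁻¹ := by
    have hexp : Z ^ (n + 2) = Real.exp ((n + 2) * Real.log Z) := by
      rw [mul_comm, ← Real.rpow_def_of_pos hZ0]
      exact_mod_cast (Real.rpow_natCast Z (n + 2)).symm
    rw [hexp, ← Real.exp_neg]
    refine Real.exp_le_exp.2 (neg_le_neg ?_)
    have hlM : 0 ≤ Real.log M := Real.log_nonneg hM1
    rw [le_div_iff₀ (by positivity)]
    have h6 : ((n : ℝ) + 2) * Real.log Z ≤ (3 * n) * (2 * Real.log M) :=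
      mul_le_mul (by linarith) hZM (Real.log_nonneg hZ1) (by positivity)
    calc _ ≤ (3 * n) * (2 * Real.log M) * (640 * D * (n * (q : ℝ) ^ 2)) := by gcongr
      _ = 3840 * D * Real.log M * ((n : ℝ) ^ 2 * (q : ℝ) ^ 2) := by ring
      _ ≤ _ := hlogM
  have hZa : Z⁻¹ ≤ D * n ^ 2 / M := by
    rw [inv_eq_one_div, div_le_div_iff₀ hZ0 hM0, hZ, one_mul]
    calc M = 1 * (1 * M) := by ring
      _ ≤ D * n ^ 2 * (4 * D * n * M) := by gcongr
  have hZe : Z⁻¹ ≤ Real.exp (-1) := by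
    rw [Real.exp_neg]
    refine inv_anti₀ (Real.exp_pos _) ?_
    have h3 : 4 * 1 * 1 * 1 ≤ Z := by rw [hZ]; gcongr; linarith
    linarith [Real.exp_one_lt_d9]
  calc _ ≤ (Z * T) ^ n * (Z ^ (n + 2))⁻¹ := by gcongr
    _ = Z⁻¹ * (Z⁻¹ * T ^ n) := by
      rw [mul_pow, pow_add]; field_simp
    _ ≤ _ := by gcongr

variable {n r q : ℕ} {n₀ : Fin n} {W₀ : Finset (Fin n)}

/-- Laplace's method on the torus: the integral of the characteristic function agrees with the
Gaussian mass up to a relative error of order `n² / M`, where `M` is the product of `n.choose r` and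
the typical size `Λ` of the variances. -/
theorem norm_integral_torusCube_sub_le (hr : 2 ≤ r) (hrn : r + 1 ≤ n) (hq : q = min r (n - r))
    (hW₀ : W₀ ∈ rSets n r) {p : Finset (Fin n) → ℝ} (hp : ∀ W ∈ rSets n r, 0 < p W ∧ p W < 1)
    {D Λ : ℝ} (hD : 1 ≤ D) (hΛ : 0 < Λ)
    (hv : ∀ W ∈ rSets n r, Λ ≤ D * bernoulliVar p W ∧ bernoulliVar p W ≤ D * Λ)
    (hn : 7680 * D ≤ n)
    (hM : 100000 * D * ((n : ℝ) ^ 2 * (q : ℝ) ^ 2 * Real.log n) ≤ Λ * n.choose r) :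
    ‖(∫ y in torusCube n, bernoulliProd (rSets n r) p (edgeForm n₀ W₀) y)
        - gaussMass (edgePrecision r n₀ W₀ p)‖
      ≤ gaussMass (edgePrecision r n₀ W₀ p) * (140000 * (D * n ^ 2 / (Λ * n.choose r))) := by
  have hD0 : 0 < D := by linarith
  have hq1 : 1 ≤ q := by omega
  have hqn : q ≤ n := by omega
  have hq1' : (1 : ℝ) ≤ q := by exact_mod_cast hq1
  have hN : (0 : ℝ) < n.choose r := by exact_mod_cast Nat.choose_pos (by omega : r ≤ n)
  have hn7 : (7680 : ℝ) ≤ n := by nlinarith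
  have hn0 : (0 : ℝ) < n := by linarith
  have hlog : 1 ≤ Real.log n := by
    rw [Real.le_log_iff_exp_le hn0]; linarith [Real.exp_one_lt_d9]
  have hcard := mem_rSets.1 hW₀
  have hbv : ∀ W ∈ rSets n r, 0 < bernoulliVar p W := fun W hW =>
    mul_pos (hp W hW).1 (sub_pos.2 (hp W hW).2)
  set m := Λ / D with hm
  have hm0 : 0 < m := div_pos hΛ hD0
  have hmv : ∀ W ∈ rSets n r, m ≤ bernoulliVar p W := fun W hW => by
    rw [hm, div_le_iff₀' hD0]; exact (hv W hW).1
  have hH := posDef_edgePrecision (n₀ := n₀) hr hrn hcard hbv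
  set H := edgePrecision r n₀ W₀ p with hHd
  set F := bernoulliProd (rSets n r) p (edgeForm n₀ W₀) with hF
  have hG := gaussMass_pos hH
  set M := Λ * n.choose r with hMd
  have hM0 : 0 < M := by positivity
  set a := D * (n : ℝ) ^ 2 / M with ha
  have ha0 : 0 < a := by positivity
  set v := 2 * n / (n.choose r * m) with hvd
  have hv0 : 0 < v := by positivity
  have hnv : (n : ℝ) * v = 2 * a := by
    rw [hvd, ha, hMd, hm]; field_simp
  have haq : 2048 * a * ((q : ℝ) ^ 2 * Real.log n) ≤ 1 := by
    rw [ha, mul_div_assoc', div_mul_eq_mul_div, div_le_one hM0]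
    refine le_trans ?_ hM
    have : 0 ≤ D * ((n : ℝ) ^ 2 * (q : ℝ) ^ 2 * Real.log n) := by positivity
    linarith
  have ha1 : 2048 * a ≤ 1 := by
    have : 1 ≤ (q : ℝ) ^ 2 * Real.log n := by nlinarith [one_le_pow₀ hq1' (n := 2)]
    nlinarith
  have hcn : (Fintype.card (Fin n) : ℝ) = n := by simp
  have hmain := norm_integral_slab_one_sub_le (s := rSets n r) (L := edgeForm n₀ W₀) hp hH hv0
    (fun W hW y => edgeForm_sq_le hr hrn hcard hm0 hmv hW y) (by simp; omega)
    (by rw [hcn, hnv]; linarith)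
  rw [hcn, card_rSets, hnv, show 256 * (2 * a) = 512 * a by ring] at hmain
  have hunion := mul_exp_neg_inv_le (by linarith) hq1 (choose_le_pow_min (by omega) hq) ha0 haq
  -- the complement of the slab
  have hbox := le_gaussMass (n₀ := n₀) (W₀ := W₀) (r := r) (m := D * Λ)
    (τ := 1 / (n * √(D * M))) hH (by positivity) (fun W hW => (hbv W hW).le)
    (fun W hW => (hv W hW).2) (by
      have e : (n * (1 / (n * √(D * M)))) ^ 2 = 1 / (D * M) := by
        rw [← Real.sq_sqrt (show 0 ≤ D * M by positivity)]
        field_simp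
        rw [Real.sqrt_sq (Real.sqrt_nonneg _)]
      rw [e, hMd]; field_simp; norm_num)
  have hfar := volume_mul_exp_neg_le hD hq1 hqn hn hM
  set U := slab (rSets n r) (edgeForm n₀ W₀) 1 with hU
  have hsub : U ⊆ torusCube n := slab_subset_torusCube hr hrn hW₀
  have hint : IntegrableOn F (torusCube n) :=
    integrableOn_torusCube (continuous_bernoulliProd _ _ _)
  have hmU : MeasurableSet U := measurableSet_slab _ _ _
  have hsplit : ∫ y in torusCube n, F y =
      (∫ y in torusCube n \ U, F y) + ∫ y in U, F y := by
    rw [← setIntegral_union Set.disjoint_sdiff_left hmU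
      (hint.mono_set Set.sdiff_subset) (hint.mono_set hsub), Set.sdiff_union_of_subset hsub]
  have hfin : volume (torusCube n) < ⊤ := by
    rw [torusCube, Real.volume_pi_Ioc]
    exact ENNReal.prod_lt_top fun _ _ => ENNReal.ofReal_lt_top
  have hfarI : ‖∫ y in torusCube n \ U, F y‖ ≤ gaussMass H * a := by
    have h1 := norm_setIntegral_le_of_norm_le_const (μ := volume) (s := torusCube n \ U) (f := F)
      (C := Real.exp (-(n.choose r * m / (640 * (n * (q : ℝ) ^ 2)))))
      ((measure_mono Set.sdiff_subset).trans_lt hfin)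
      (fun y hy => norm_bernoulliProd_le_of_notMem_slab hr hrn hq hW₀ hm0.le hmv hy.1 hy.2)
    have h2 : volume.real (torusCube n \ U) ≤ (2 * Real.pi) ^ n := by
      rw [← volume_torusCube]
      exact measureReal_mono Set.sdiff_subset hfin.ne
    have e : n.choose r * m / (640 * (n * (q : ℝ) ^ 2)) = M / (640 * D * (n * (q : ℝ) ^ 2)) := by
      rw [hm, hMd]; field_simp
    rw [e] at h1
    calc _ ≤ _ := h1
      _ ≤ Real.exp (-(M / (640 * D * (n * (q : ℝ) ^ 2)))) * (2 * Real.pi) ^ n := by gcongr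
      _ ≤ a * (Real.exp (-1) * (2 * (1 / (n * √(D * M)))) ^ n) := by rw [mul_comm]; exact hfar
      _ ≤ a * gaussMass H := by gcongr
      _ = _ := mul_comm _ _
  rw [hsplit, add_sub_assoc]
  calc _ ≤ gaussMass H * a + gaussMass H * (126 * (2 * a) +
        130 * n * n.choose r * Real.exp (-1 / (512 * a))) :=
        (norm_add_le _ _).trans (add_le_add hfarI hmain)
    _ = gaussMass H * (253 * a + 130 * (n * n.choose r * Real.exp (-1 / (512 * a)))) := by ring
    _ ≤ gaussMass H * (253 * a + 130 * (1024 * a)) := by gcongr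
    _ ≤ gaussMass H * (140000 * a) := by gcongr; linarith

end Laplace

/-! ### The enumeration formula for given `n` -/

section Enumeration

variable {n r q : ℕ} {β : Fin n → ℝ} {d : Fin n → ℕ}

/-- The Gaussian mass in terms of `A(β)`. The powers of `2` cancel because `2 A(β)` is the precision
matrix in the original coordinates, and the factor `r` is the determinant of the change of
coordinates. -/
lemma gaussMass_edgePrecision (hr : 2 ≤ r) (hrn : r + 1 ≤ n) {n₀ : Fin n} {W₀ : Finset (Fin n)}
    (hW₀ : W₀.card = r) (β : Fin n → ℝ) :
    gaussMass (edgePrecision r n₀ W₀ (edgeProb β)) =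
      r * Real.pi ^ ((n : ℝ) / 2) / (matrixA r β).det ^ (1 / 2 : ℝ) := by
  have hH := posDef_edgePrecision (n₀ := n₀) hr hrn hW₀ (p := edgeProb β) fun W _ =>
    mul_pos (edgeProb_pos β W) (sub_pos.2 (edgeProb_lt_one β W))
  have hdet := hH.det_pos
  have hr0 : (0 : ℝ) < r := by exact_mod_cast (by omega : 0 < r)
  rw [det_matrixA hW₀ (n₀ := n₀), gaussMass, Fintype.card_fin, ← Real.sqrt_eq_rpow]
  set h := (edgePrecision r n₀ W₀ (edgeProb β)).det
  have e : Real.pi ^ ((n : ℝ) / 2) = √(Real.pi ^ n) := by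
    rw [Real.sqrt_eq_rpow, ← Real.rpow_natCast, ← Real.rpow_mul Real.pi_pos.le]
    congr 1; ring
  rw [e, ← Real.sqrt_sq hr0.le, ← Real.sqrt_mul (by positivity), ← Real.sqrt_div (by positivity),
    Real.sqrt_sq hr0.le]
  congr 1
  rw [mul_pow, one_div, inv_pow]
  field_simp

/-- The enumeration formula with an explicit error, for given `n`. -/
theorem exists_numHypergraphs_eq (hr : 2 ≤ r) (hrn : r + 1 ≤ n) (hq : q = min r (n - r))
    (hd : r ∣ ∑ j, d j) (hβ : IsBetaSolution r d β) {C : ℝ} (hC0 : 0 ≤ C)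
    (hC : ∀ j k, |β j - β k| ≤ C * ((n : ℝ) / (r * ((n : ℝ) - r))))
    (hn : 7680 * Real.exp (8 * C) ≤ n)
    (hM : 100000 * Real.exp (8 * C) * ((n : ℝ) ^ 2 * (q : ℝ) ^ 2 * Real.log n)
      ≤ density r d * (1 - density r d) * n.choose r) :
    ∃ δ : ℝ, |δ| ≤ 140000 * Real.exp (8 * C) *
        ((n : ℝ) ^ 2 / (density r d * (1 - density r d) * n.choose r)) ∧
      (numHypergraphs r d : ℝ) =
        (r : ℝ) * (1 + δ) / ((2 : ℝ) ^ n * Real.pi ^ ((n : ℝ) / 2)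
            * (matrixA r β).det ^ (1 / 2 : ℝ))
          * ∏ W ∈ rSets n r, (edgeProb β W ^ (-edgeProb β W)
              * (1 - edgeProb β W) ^ (-(1 - edgeProb β W))) := by
  obtain ⟨W₀, hW₀⟩ : (rSets n r).Nonempty := by
    rw [← Finset.card_pos, card_rSets]; exact Nat.choose_pos (by omega)
  have n₀ : Fin n := ⟨0, by omega⟩
  have hcard := mem_rSets.1 hW₀
  obtain ⟨hΛ, hv⟩ := exists_bound_density (by omega) hrn hβ hC
  have hmain := norm_integral_torusCube_sub_le (n₀ := n₀) hr hrn hq hW₀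
    (fun W _ => ⟨edgeProb_pos β W, edgeProb_lt_one β W⟩)
    (Real.one_le_exp (by linarith : 0 ≤ 8 * C)) hΛ hv hn hM
  have hH := posDef_edgePrecision (n₀ := n₀) hr hrn hcard (p := edgeProb β) fun W _ =>
    mul_pos (edgeProb_pos β W) (sub_pos.2 (edgeProb_lt_one β W))
  have hG := gaussMass_pos hH
  rw [integral_torusCube_bernoulliProd (by omega) hβ hd] at hmain
  have hGeq := gaussMass_edgePrecision (n₀ := n₀) hr hrn hcard β
  set G := gaussMass (edgePrecision r n₀ W₀ (edgeProb β)) with hGd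
  set P := ∏ W ∈ rSets n r,
    (edgeProb β W ^ edgeProb β W * (1 - edgeProb β W) ^ (1 - edgeProb β W)) with hP
  rw [← Complex.ofReal_sub, Complex.norm_real, Real.norm_eq_abs] at hmain
  have hP0 : 0 < P := Finset.prod_pos fun W _ => mul_pos (Real.rpow_pos_of_pos (edgeProb_pos β W) _)
    (Real.rpow_pos_of_pos (sub_pos.2 (edgeProb_lt_one β W)) _)
  have hPinv : ∏ W ∈ rSets n r, (edgeProb β W ^ (-edgeProb β W)
      * (1 - edgeProb β W) ^ (-(1 - edgeProb β W))) = P⁻¹ := by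
    rw [hP, ← Finset.prod_inv_distrib]
    refine Finset.prod_congr rfl fun W _ => ?_
    rw [Real.rpow_neg (edgeProb_pos β W).le, Real.rpow_neg (sub_pos.2 (edgeProb_lt_one β W)).le,
      mul_inv]
  set I := (2 * Real.pi) ^ n * (numHypergraphs r d * P) with hI
  refine ⟨I / G - 1, ?_, ?_⟩
  · rw [div_sub_one hG.ne', abs_div, abs_of_pos hG, div_le_iff₀ hG]
    refine hmain.trans (le_of_eq ?_)
    ring
  · have hpi : (0 : ℝ) < Real.pi ^ ((n : ℝ) / 2) := Real.rpow_pos_of_pos Real.pi_pos _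
    have hpi2 : Real.pi ^ ((n : ℝ) / 2) * Real.pi ^ ((n : ℝ) / 2) = Real.pi ^ n := by
      rw [← Real.rpow_add Real.pi_pos, add_halves, Real.rpow_natCast]
    have hr0 : (r : ℝ) ≠ 0 := by positivity
    have hdet : (matrixA r β).det ^ (1 / 2 : ℝ) ≠ 0 := by
      intro h0
      rw [h0, div_zero] at hGeq
      exact hG.ne' hGeq
    rw [hPinv, add_sub_cancel, hI, hGeq, mul_pow, ← hpi2]
    field_simp

end Enumeration

end

/-! ### The error term -/

section

section Asymptotics

variable {n r : ℕ}

/-- The growth hypothesis in terms of `q = min r (n - r)`, using `n q ≤ 2 r (n - r)`; here `M`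
stands for `λ (1 - λ) n.choose r`. -/
lemma sq_mul_sq_mul_log_le (hr : 3 ≤ r) (hrn : r + 3 ≤ n) {c M : ℝ}
    (h : (r : ℝ) ^ 3 * ((n : ℝ) - r) ^ 3 * Real.log n ≤ c * (M * n)) :
    (n : ℝ) ^ 2 * ((min r (n - r) : ℕ) : ℝ) ^ 2 * Real.log n ≤ 8 * c * M := by
  have hn : (1 : ℝ) ≤ n := by exact_mod_cast (by omega : 1 ≤ n)
  have hlog := Real.log_nonneg hn
  have hcast : ((n - r : ℕ) : ℝ) = n - r := Nat.cast_sub (by omega)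
  set q := min r (n - r) with hq
  have hq1 : (1 : ℝ) ≤ q := by exact_mod_cast (by omega : 1 ≤ q)
  have hmul : (n : ℝ) * q ≤ 2 * (r * ((n : ℝ) - r)) := by
    have h1 : n * q ≤ 2 * (r * (n - r)) := by
      have e : r * (n - r) = min r (n - r) * max r (n - r) := (min_mul_max r (n - r)).symm
      have h2 : n ≤ 2 * max r (n - r) := by omega
      calc n * q ≤ (2 * max r (n - r)) * q := Nat.mul_le_mul_right _ h2
        _ = _ := by rw [e, hq]; ring
    rw [← hcast]; exact_mod_cast h1
  have hcube : (n : ℝ) ^ 3 * (q : ℝ) ^ 2 ≤ 8 * (r ^ 3 * ((n : ℝ) - r) ^ 3) := by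
    calc (n : ℝ) ^ 3 * (q : ℝ) ^ 2 ≤ (n : ℝ) ^ 3 * (q : ℝ) ^ 3 := by gcongr; norm_num
      _ = ((n : ℝ) * q) ^ 3 := by ring
      _ ≤ (2 * (r * ((n : ℝ) - r))) ^ 3 := by gcongr
      _ = _ := by ring
  have hn0 : (0 : ℝ) < n := by linarith
  refine le_of_mul_le_mul_left ?_ hn0
  calc (n : ℝ) * ((n : ℝ) ^ 2 * (q : ℝ) ^ 2 * Real.log n)
      = (n : ℝ) ^ 3 * (q : ℝ) ^ 2 * Real.log n := by ring
    _ ≤ 8 * (r ^ 3 * ((n : ℝ) - r) ^ 3) * Real.log n := by gcongr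
    _ = 8 * (r ^ 3 * ((n : ℝ) - r) ^ 3 * Real.log n) := by ring
    _ ≤ 8 * (c * (M * n)) := by gcongr
    _ = _ := by ring

lemma le_mul_sub_of_three (hr : 3 ≤ r) (hrn : r + 3 ≤ n) : (n : ℝ) ≤ r * ((n : ℝ) - r) := by
  have h1 : (3 : ℝ) ≤ r := by exact_mod_cast hr
  have h2 : (r : ℝ) + 3 ≤ n := by exact_mod_cast hrn
  nlinarith

/-- The first term of the error dominates `n² / M`, since `r (n - r) ≥ n`. -/
lemma sq_div_le_errorTerm (hr : 3 ≤ r) (hrn : r + 3 ≤ n) (c : ℝ) {lam : ℝ}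
    (hM : 0 < lam * (1 - lam) * n.choose r) :
    (n : ℝ) ^ 2 / (lam * (1 - lam) * n.choose r) ≤ errorTerm c n r lam := by
  have h := le_mul_sub_of_three hr hrn
  have hn : (1 : ℝ) ≤ n := by exact_mod_cast (by omega : 1 ≤ n)
  have hnr : (0 : ℝ) ≤ n - r := sub_nonneg.2 (by exact_mod_cast (by omega : r ≤ n))
  have hlog := Real.log_nonneg hn
  have h1 : (n : ℝ) ^ 2 / (lam * (1 - lam) * n.choose r) ≤
      (r : ℝ) * ((n : ℝ) - r) * n / (lam * (1 - lam) * n.choose r) := by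
    rw [sq]; gcongr
  have h2 : 0 ≤ Real.log n ^ 9 / (n : ℝ) ^ 2 *
      ((r : ℝ) ^ 3 * ((n : ℝ) - r) ^ 3 / (lam * (1 - lam) * (n.choose r : ℝ))) ^ (3 / 2 : ℝ) := by
    positivity
  have h3 : 0 ≤ (n : ℝ) ^ (-(c * Real.log n)) := by positivity
  rw [errorTerm]
  linarith

/-- With `l = log n` and `x = r³ (n - r)³ / (λ (1 - λ) n.choose r)`: the second term of the error is
at most `(log n) ^ 9 / √n` once `x log n ≤ n`. -/
lemma log_pow_mul_rpow_le {l n x : ℝ} (hn : 0 < n) (hl : 1 ≤ l) (hx0 : 0 ≤ x) (hx : x * l ≤ n) :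
    l ^ 9 / n ^ 2 * x ^ (3 / 2 : ℝ) ≤ l ^ 9 * n ^ (-(1 / 2) : ℝ) := by
  have hxn : x ≤ n := (le_mul_of_one_le_right hx0 hl).trans hx
  have h1 : x ^ (3 / 2 : ℝ) ≤ n ^ (3 / 2 : ℝ) := Real.rpow_le_rpow hx0 hxn (by norm_num)
  have h2 : n ^ (3 / 2 : ℝ) = n ^ (-(1 / 2) : ℝ) * n ^ 2 := by
    rw [← Real.rpow_natCast n 2, ← Real.rpow_add hn]; norm_num
  calc _ ≤ l ^ 9 / n ^ 2 * (n ^ (-(1 / 2) : ℝ) * n ^ 2) := by rw [← h2]; gcongr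
    _ = _ := by field_simp

lemma isLittleO_log_pow_mul_rpow :
    (fun n : ℕ => Real.log n ^ 9 * (n : ℝ) ^ (-(1 / 2) : ℝ)) =o[atTop]
      fun n : ℕ => (Real.log n)⁻¹ := by
  have h : (fun x : ℝ => Real.log x ^ (10 : ℝ)) =o[atTop] fun x => x ^ (1 / 2 : ℝ) :=
    isLittleO_log_rpow_rpow_atTop _ (by norm_num)
  have h2 := (h.comp_tendsto tendsto_natCast_atTop_atTop).mul_isBigO
    (isBigO_refl (fun n : ℕ => (n : ℝ) ^ (-(1 / 2) : ℝ) * (Real.log n)⁻¹) atTop)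
  refine h2.congr' ?_ ?_
  · filter_upwards [eventually_ge_atTop 3] with n hn
    have hl : 0 < Real.log n := Real.log_pos (by exact_mod_cast (by omega : 1 < n))
    simp only [Function.comp]
    rw [show (10 : ℝ) = ((10 : ℕ) : ℝ) by norm_num, Real.rpow_natCast]
    field_simp
  · filter_upwards [eventually_ge_atTop 3] with n hn
    have hn0 : (0 : ℝ) < n := by exact_mod_cast (by omega : 0 < n)
    simp only [Function.comp]
    rw [← mul_assoc, ← Real.rpow_add hn0]
    norm_num

lemma isLittleO_rpow_neg_log :
    (fun n : ℕ => (n : ℝ) ^ (-(1 * Real.log n))) =o[atTop] fun n : ℕ => (Real.log n)⁻¹ := by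
  refine IsBigO.trans_isLittleO (IsBigO.of_bound 1 ?_) isLittleO_log_pow_mul_rpow
  filter_upwards [eventually_ge_atTop 3] with n hn
  have hn3 : (3 : ℝ) ≤ n := by exact_mod_cast hn
  have hl : 1 ≤ Real.log n := by
    rw [Real.le_log_iff_exp_le (by linarith)]; linarith [Real.exp_one_lt_d9]
  have h1 : (n : ℝ) ^ (-(1 * Real.log n)) ≤ (n : ℝ) ^ (-(1 / 2) : ℝ) :=
    Real.rpow_le_rpow_of_exponent_le (by linarith) (by linarith)
  rw [Real.norm_of_nonneg (by positivity), Real.norm_of_nonneg (by positivity), one_mul (_ * _)]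
  exact h1.trans (le_mul_of_one_le_left (by positivity) (one_le_pow₀ hl))

/-- The error term tends to zero faster than `1 / log n`. -/
theorem isLittleO_errorTerm {S : Set ℕ} {r : ℕ → ℕ} {lam : ℕ → ℝ}
    (hr : ∀ n ∈ S, 3 ≤ r n ∧ r n + 3 ≤ n)
    (hlam : ∀ n ∈ S, 0 < lam n * (1 - lam n))
    (h : (fun n : ℕ => (r n : ℝ) ^ 3 * ((n : ℝ) - r n) ^ 3 * Real.log n) =o[atTop ⊓ 𝓟 S]
      fun n : ℕ => lam n * (1 - lam n) * n * (n.choose (r n) : ℝ)) :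
    (fun n : ℕ => errorTerm 1 n (r n) (lam n)) =o[atTop ⊓ 𝓟 S] fun n : ℕ => (Real.log n)⁻¹ := by
  have hS : ∀ᶠ n in atTop ⊓ 𝓟 S, n ∈ S := eventually_inf_principal.2 (by simp)
  have hpos : ∀ n ∈ S, 0 < lam n * (1 - lam n) * (n.choose (r n) : ℝ) ∧ (6 : ℝ) ≤ n ∧
      (0 : ℝ) < n - r n ∧ 1 ≤ Real.log n := by
    intro n hn
    have h1 := hr n hn
    have h6 : (6 : ℝ) ≤ n := by exact_mod_cast (by omega : 6 ≤ n)
    refine ⟨mul_pos (hlam n hn) (by exact_mod_cast Nat.choose_pos (by omega)), h6,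
      sub_pos.2 (by exact_mod_cast (by omega : r n < n)), ?_⟩
    rw [Real.le_log_iff_exp_le (by linarith)]; linarith [Real.exp_one_lt_d9]
  unfold errorTerm
  refine (IsLittleO.add ?_ ?_).add (isLittleO_rpow_neg_log.mono inf_le_left)
  · refine isLittleO_iff.2 fun c hc => ?_
    filter_upwards [isLittleO_iff.1 h hc, hS] with n hn hnS
    obtain ⟨hM, h6, hnr, hl⟩ := hpos n hnS
    have hge := le_mul_sub_of_three (hr n hnS).1 (hr n hnS).2
    rw [Real.norm_of_nonneg (by positivity), mul_right_comm _ (n : ℝ),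
      Real.norm_of_nonneg (mul_pos hM (by linarith)).le] at hn
    set M := lam n * (1 - lam n) * (n.choose (r n) : ℝ)
    set x := (r n : ℝ) * ((n : ℝ) - r n) with hx
    rw [Real.norm_of_nonneg (by positivity), Real.norm_of_nonneg (by positivity),
      ← div_eq_mul_inv, div_le_div_iff₀ hM (by linarith)]
    have hn0 : (0 : ℝ) < n := by linarith
    refine le_of_mul_le_mul_right ?_ hn0
    -- `n ≤ r (n - r)` bounds the first term by the quotient in the hypothesis
    calc x * n * Real.log n * n = x * n ^ 2 * Real.log n := by ring
      _ ≤ x * x ^ 2 * Real.log n := by gcongr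
      _ = (r n : ℝ) ^ 3 * ((n : ℝ) - r n) ^ 3 * Real.log n := by rw [hx]; ring
      _ ≤ _ := hn
      _ = _ := by ring
  · refine IsBigO.trans_isLittleO (IsBigO.of_bound 1 ?_)
      (isLittleO_log_pow_mul_rpow.mono inf_le_left)
    filter_upwards [isLittleO_iff.1 h one_pos, hS] with n hn hnS
    obtain ⟨hM, h6, hnr, hl⟩ := hpos n hnS
    rw [Real.norm_of_nonneg (by positivity), mul_right_comm _ (n : ℝ),
      Real.norm_of_nonneg (mul_pos hM (by linarith)).le, one_mul] at hn
    set M := lam n * (1 - lam n) * (n.choose (r n) : ℝ)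
    rw [one_mul, Real.norm_of_nonneg (by positivity), Real.norm_of_nonneg (by positivity)]
    refine log_pow_mul_rpow_le (by linarith) hl (by positivity) ?_
    rw [div_mul_eq_mul_div, div_le_iff₀ hM]
    linarith

end Asymptotics

end

end HypergraphEnum

end

/-! ### The asymptotic formula -/

theorem theorem1p1 :
    ∀ C : ℝ, ∃ K c : ℝ, 0 < c ∧
      ∀ (S : Set ℕ) (r : ℕ → ℕ) (d : (n : ℕ) → Fin n → ℕ) (β : (n : ℕ) → Fin n → ℝ),
        (∀ n ∈ S, 3 ≤ r n ∧ r n + 3 ≤ n) →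
        (∀ n ∈ S, r n ∣ ∑ j, d n j) →
        ((fun n : ℕ => (r n : ℝ) ^ 3 * ((n : ℝ) - r n) ^ 3 * Real.log n)
          =o[atTop ⊓ 𝓟 S]
          (fun n : ℕ => HypergraphEnum.density (r n) (d n)
            * (1 - HypergraphEnum.density (r n) (d n)) * n * (n.choose (r n) : ℝ))) →
        (∀ n ∈ S, HypergraphEnum.IsBetaSolution (r n) (d n) (β n)) →
        (∀ n ∈ S, ∀ j k : Fin n,
          |β n j - β n k| ≤ C * ((n : ℝ) / ((r n : ℝ) * ((n : ℝ) - r n)))) →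
        (∀ᶠ n in atTop ⊓ 𝓟 S, ∃ δ : ℝ,
          |δ| ≤ K * HypergraphEnum.errorTerm c n (r n) (HypergraphEnum.density (r n) (d n)) ∧
          (HypergraphEnum.numHypergraphs (r n) (d n) : ℝ) =
            (r n : ℝ) * (1 + δ) /
                ((2 : ℝ) ^ n * Real.pi ^ ((n : ℝ) / 2)
                  * (HypergraphEnum.matrixA (r n) (β n)).det ^ (1 / 2 : ℝ))
              * ∏ W ∈ HypergraphEnum.rSets n (r n),
                  (HypergraphEnum.edgeProb (β n) W ^ (-HypergraphEnum.edgeProb (β n) W)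
                    * (1 - HypergraphEnum.edgeProb (β n) W)
                        ^ (-(1 - HypergraphEnum.edgeProb (β n) W)))) ∧
        ((fun n : ℕ =>
            HypergraphEnum.errorTerm c n (r n) (HypergraphEnum.density (r n) (d n)))
          =o[atTop ⊓ 𝓟 S] (fun n : ℕ => (Real.log n)⁻¹)) := by
  intro C
  -- all variances `λ_W (1 - λ_W)` lie within a factor `D` of `λ (1 - λ)`
  set D := Real.exp (8 * |C|) with hD
  have hD0 : 0 < D := Real.exp_pos _
  refine ⟨140000 * D, 1, one_pos, ?_⟩
  intro S r d β hr hd hlit hβ hC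
  have hC' : ∀ n ∈ S, ∀ j k : Fin n,
      |β n j - β n k| ≤ |C| * ((n : ℝ) / ((r n : ℝ) * ((n : ℝ) - r n))) := by
    intro n hn j k
    refine (hC n hn j k).trans (mul_le_mul_of_nonneg_right (le_abs_self C) ?_)
    have : (0 : ℝ) ≤ n - r n := sub_nonneg.2 (by exact_mod_cast (by have := hr n hn; omega))
    positivity
  have hdens : ∀ n ∈ S, 0 < HypergraphEnum.density (r n) (d n) *
      (1 - HypergraphEnum.density (r n) (d n)) := fun n hn =>
    (HypergraphEnum.exists_bound_density (by have := hr n hn; omega) (by have := hr n hn; omega)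
      (hβ n hn) (hC' n hn)).1
  refine ⟨?_, HypergraphEnum.isLittleO_errorTerm hr hdens hlit⟩
  have hS : ∀ᶠ n in atTop ⊓ 𝓟 S, n ∈ S := eventually_inf_principal.2 (by simp)
  have hlarge : ∀ᶠ n : ℕ in atTop ⊓ 𝓟 S, 7680 * D ≤ n :=
    (tendsto_natCast_atTop_atTop.eventually_ge_atTop _).filter_mono inf_le_left
  filter_upwards [hS, hlarge,
    isLittleO_iff.1 hlit (show 0 < 1 / (800000 * D) by positivity)] with n hn hnD hlit_n
  obtain ⟨hr3, hrn3⟩ := hr n hn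
  have hN : (0 : ℝ) < n.choose (r n) := by exact_mod_cast Nat.choose_pos (by omega)
  have hM := mul_pos (hdens n hn) hN
  have hn0 : (0 : ℝ) < n := by exact_mod_cast (by omega : 0 < n)
  rw [mul_right_comm _ (n : ℝ), Real.norm_of_nonneg (mul_pos hM hn0).le] at hlit_n
  have hq := HypergraphEnum.sq_mul_sq_mul_log_le hr3 hrn3 ((Real.le_norm_self _).trans hlit_n)
  obtain ⟨δ, hδ, heq⟩ := HypergraphEnum.exists_numHypergraphs_eq (by omega) (by omega) rfl (hd n hn)
    (hβ n hn) (abs_nonneg C) (hC' n hn) hnD (by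
      refine (mul_le_mul_of_nonneg_left hq (by positivity)).trans (le_of_eq ?_)
      rw [← hD]; field_simp; norm_num)
  refine ⟨δ, hδ.trans ?_, heq⟩
  exact mul_le_mul_of_nonneg_left (HypergraphEnum.sq_div_le_errorTerm hr3 hrn3 1 hM) (by positivity)
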